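/- **Setting.** There are $K$ arms with means $\mu_1,\dots,\mu_K\in[0,1]$ and threshold $\tau=1/2$. A pull of arm $i$ gives an independent Bernoulli($\mu_i$) reward; a duel of arm $i$ against arm $j$ is won by $i$, independently of everything else, with probability $M_{ij}=(1+\mu_i-\mu_j)/2$ (linear link). Let $S_\tau=\{i:\mu_i\ge\tau\}$, $\Delta_i=|\mu_i-\tau|$, $p_i=\frac1{K-1}\sum_{j\ne i}M_{ij}$, and let $u\in\arg\min_{i\in S_\tau}p_i$, $v\in\arg\max_{i\notin S_\tau}p_i$. Put $\Delta^c_i=p_i-p_u$ for $i\in S_\tau$ and $\Delta^c_i=p_v-p_i$ for $i\notin S_\tau$, and $$\bar\Delta^c_i=\begin{cases}\max_{j\in S_\tau}\min\{p_j-p_v,\;p_i-p_j\}, & i\in S_\tau,\\ \max_{j\notin S_\tau}\min\{p_j-p_i,\;p_u-p_j\}, & i\notin S_\tau,\end{cases}$$ $$H_{c,1}=\sum_{i\ne u,v}(\Delta^c_i)^{-2},\qquad H_{c,2}=\sum_{i\neq u,v}(\bar\Delta^c_i)^{-2}.$$ **Algorithms.** A *pull-only algorithm* is an adaptive, possibly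 randomized rule that pulls arms and may stop and return a set of arms. It is *$\delta$-correct* if it returns $S_\tau$ with probability at least $1-\delta$ for every $\mu\in[0,1]^K$ with all $\mu_i\ne\tau$. Below, $R\ge 1/2$ is the sub-Gaussian parameter given to the algorithms. *CLUCB* pulls every arm once; then, after $t$ pulls of which $T_i$ were of arm $i$, with empirical means $\hat\mu_i$ and $r_i=R\sqrt{2\log(4Kt^3/\delta)/T_i}$, it returns $\{i:\hat\mu_i\ge\tau\}$ if $|\hat\mu_i-\tau|\ge r_i$ for all $i$, and otherwise pulls an arm of largest $r_i$ among those with $|\hat\mu_i-\tau|<r_i$. *Rank-Search*, with $\gamma_t=\frac14\kappa^{-t}$, $\kappa>1$, keeps a working set $S$, initially all arms. In round $t=0,1,\dots$, while $S\ne\emptyset$: (a) Every arm of $S$ is compared with uniformly random arms of $[K]$ until each of them has more than $\gamma_t^{-2}\log(8|S|(t+1)^2/\delta)$ comparisons in total (counts and wins are carried over between rounds). $S$ is ranked as $i_1,\dots,i_{|S|}$ by increasing win rate $\hat p$. (b) A binary search is made with $b_{\min}=0$, $b_{\max}=|S|$: while $b_{\min}<b_{\max}$, label the arm $i_b$, $b=\lceil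 (b_{\min}+b_{\max})/2\rceil$, with confidence $\delta_1=\delta_0/\log|S|$ ($\delta_1=\delta_0$ if $|S|=1$), where $\delta_0=\delta/(4(t+1)^2)$, and set $b_{\max}=b-1$ if the label is positive, $b_{\min}=b$ otherwise. To label an arm with confidence $\delta_1$, for $s=0,1,\dots$ pull it until it has $2^s+1$ pulls, and stop as soon as its empirical mean differs from $\tau$ by more than $R\sqrt{2\log(4(s+1)^2/\delta_1)/(2^s+1)}$; the label is positive if this mean exceeds $\tau$. (c) With the final $b=b_{\min}$, label as positive all $i\in S$ with $\hat p_i-\hat p_{i_{b+1}}>2\gamma_t$ (if $b<|S|$) and as negative all $i\in S$ with $\hat p_i-\hat p_{i_b}<-2\gamma_t$ (if $b>0$). Remove from $S$ these arms and the arms labelled in (b). When $S=\emptyset$, the set of arms labelled positive is returned. **Statement (Example 2, exponential means).** There is an absolute constant $c_0>0$ such that for every $\delta\in(0,1/2)$, $R\ge1/2$ and $\kappa>1$ there are constants $C_1$ and $c_1>0$ depending only on $\delta$, $C_2$ depending only on $\delta,R$, and $C_3$ depending only on $\delta,R,\kappa$, such that the following holds for every $l\ge1$ and $K=2l$. Let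 $x_1,\dots,x_K$ be i.i.d. exponential with rate $\lambda=4\log(4l/\delta)$, and let $\mu_i=x_i$ for $1\le i\le l$ and $\mu_i=1-x_i$ for $l+1\le i\le 2l$. There is an event of probability at least $1-\delta$ for the sample $x$ on which: 1. $\mu_i\in[0,1]$ for all $i$; 2. $\Delta_i\ge c_0$ for all $i$, both $S_\tau$ and its complement are nonempty, and $H_{c,2}=H_{c,1}\le C_1K\log^2K$; 3. every $\delta$-correct pull-only algorithm makes at least $c_1K$ pulls in expectation on the instance $\mu$, while CLUCB, with probability at least $1-\delta$, returns $S_\tau$ after at most $C_2K\log K$ pulls; 4. Rank-Search, with probability at least $1-\delta$, returns $S_\tau$ after at most $C_3K\log^3K$ duels and at most $C_3\log^2K$ pulls. -/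

import Mathlib

open MeasureTheory ProbabilityTheory
open scoped ENNReal

namespace TBPDC

/-! ### Instances and their complexity

An instance with arms `Fin K` consists of a mean vector `μ`, a preference matrix `M` and a
threshold `τ`. -/

/-- The positive arms: those with mean at least `τ`. -/
noncomputable def positiveSet {K : ℕ} (τ : ℝ) (μ : Fin K → ℝ) : Finset (Fin K) :=
  {i | τ ≤ μ i}

/-- The gap `Δ_i = |μ_i - τ|`. -/
noncomputable def gap {K : ℕ} (τ : ℝ) (μ : Fin K → ℝ) (i : Fin K) : ℝ := |μ i - τ|

/-- The linear link: arm `i` beats arm `j` with probability `(1 + μ_i - μ_j) / 2`. -/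
noncomputable def linearLink {K : ℕ} (μ : Fin K → ℝ) (i j : Fin K) : ℝ := (1 + μ i - μ j) / 2

/-- The Borda score `p_i = (K - 1)⁻¹ ∑_{j ≠ i} M_ij`. -/
noncomputable def borda {K : ℕ} (M : Fin K → Fin K → ℝ) (i : Fin K) : ℝ :=
  (∑ j ∈ Finset.univ.erase i, M i j) / ((K : ℝ) - 1)

/-- `u` is a worst positive arm, i.e. a minimizer of the score over the positive arms `S`. -/
def IsWorstPositive {K : ℕ} (p : Fin K → ℝ) (S : Finset (Fin K)) (u : Fin K) : Prop :=
  u ∈ S ∧ ∀ j ∈ S, p u ≤ p j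

/-- `v` is a best negative arm, i.e. a maximizer of the score over the negative arms `Sᶜ`. -/
def IsBestNegative {K : ℕ} (p : Fin K → ℝ) (S : Finset (Fin K)) (v : Fin K) : Prop :=
  v ∈ Sᶜ ∧ ∀ j ∈ Sᶜ, p j ≤ p v

/-- The duel gap `Δ^c_i`: the distance in score to the worst positive arm `u` if `i` is positive,
and to the best negative arm `v` if `i` is negative. -/
noncomputable def duelGap {K : ℕ} (p : Fin K → ℝ) (S : Finset (Fin K)) (u v i : Fin K) : ℝ :=
  if i ∈ S then p i - p u else p v - p i

/-- The duel gap `Δ̄^c_i`: the maximum over `j` in the class of `i` of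
`min (p_j - p_v) (p_i - p_j)` if `i` is positive and of `min (p_j - p_i) (p_u - p_j)` if `i` is
negative. -/
noncomputable def duelGapBar {K : ℕ} (p : Fin K → ℝ) (S : Finset (Fin K)) (u v i : Fin K) : ℝ :=
  if h : i ∈ S then S.sup' ⟨i, h⟩ fun j => min (p j - p v) (p i - p j)
  else Sᶜ.sup' ⟨i, Finset.mem_compl.2 h⟩ fun j => min (p j - p i) (p u - p j)

/-- `H_{c,1} = ∑_{i ≠ u, v} (Δ^c_i)⁻²`, with value `∞` if one of these gaps vanishes. -/
noncomputable def hc1 {K : ℕ} (p : Fin K → ℝ) (S : Finset (Fin K)) (u v : Fin K) : ℝ≥0∞ :=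
  ∑ i ∈ Finset.univ \ {u, v}, (ENNReal.ofReal (duelGap p S u v i) ^ 2)⁻¹

/-- `H_{c,2} = ∑_{i ≠ u, v} (Δ̄^c_i)⁻²`, with value `∞` if one of these gaps vanishes. -/
noncomputable def hc2 {K : ℕ} (p : Fin K → ℝ) (S : Finset (Fin K)) (u v : Fin K) : ℝ≥0∞ :=
  ∑ i ∈ Finset.univ \ {u, v}, (ENNReal.ofReal (duelGapBar p S u v i) ^ 2)⁻¹

/-! ### Observations -/

/-- The Bernoulli law on `Bool` with success probability `p` (only used for `p ∈ [0,1]`; outside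
this interval `p` is projected to it). -/
noncomputable def ber (p : ℝ) : Measure Bool :=
  bernoulliMeasure true false (Set.projIcc (0 : ℝ) 1 zero_le_one p)

instance (p : ℝ) : IsProbabilityMeasure (ber p) := by
  unfold ber; infer_instance

/-- The law of the rewards: entry `(i, n)` is the outcome of the `n`-th pull of arm `i`; the entries
are independent and the rewards of arm `i` are Bernoulli with mean `μ i`. -/
noncomputable def rewardLaw {K : ℕ} (μ : Fin K → ℝ) : Measure (Fin K × ℕ → Bool) :=
  Measure.infinitePi fun a => ber (μ a.1)

/-- The law of the random opponents: independent and uniform on all arms. -/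
noncomputable def opponentLaw (K : ℕ) [NeZero K] : Measure (Fin K × ℕ → Fin K) :=
  Measure.infinitePi fun _ => (PMF.uniformOfFintype (Fin K)).toMeasure

/-- The law of the duels: entry `(i, j, n)` is a duel of `i` against `j`, with value `true` if `i`
wins; the entries are independent and `i` beats `j` with probability `M i j`. -/
noncomputable def duelLaw {K : ℕ} (M : Fin K → Fin K → ℝ) : Measure (Fin K × Fin K × ℕ → Bool) :=
  Measure.infinitePi fun a => ber (M a.1 a.2.1)

/-- All randomness that a run of Rank-Search may use: rewards, opponents, duel outcomes. -/
abbrev Samples (K : ℕ) : Type :=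
  (Fin K × ℕ → Bool) × (Fin K × ℕ → Fin K) × (Fin K × Fin K × ℕ → Bool)

noncomputable def sampleLaw {K : ℕ} [NeZero K] (M : Fin K → Fin K → ℝ) (μ : Fin K → ℝ) :
    Measure (Samples K) :=
  (rewardLaw μ).prod ((opponentLaw K).prod (duelLaw M))

/-! ### The subroutine Figure-Out-Label -/

/-- Number of pulls made by the end of round `t`: the loop `while n ≤ 2^t` ends at `2^t + 1`. -/
def folCount (t : ℕ) : ℕ := 2 ^ t + 1

/-- Empirical mean of the stream of rewards `y` at the end of round `t`. -/
noncomputable def folMean (y : ℕ → Bool) (t : ℕ) : ℝ :=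
  (∑ m ∈ Finset.range (folCount t), if y m then (1 : ℝ) else 0) / folCount t

/-- Confidence radius at the end of round `t`. -/
noncomputable def folRadius (R δ₁ : ℝ) (t : ℕ) : ℝ :=
  R * √(2 * Real.log (4 * ((t : ℝ) + 1) ^ 2 / δ₁) / folCount t)

open Classical in
/-- Figure-Out-Label on an arm with reward stream `y`: at the first round in which `τ` is outside
the confidence interval, return whether the empirical mean exceeds `τ`, together with the number of
pulls made; `none` if this never happens. -/
noncomputable def figureOutLabel (R τ δ₁ : ℝ) (y : ℕ → Bool) : Option (Bool × ℕ) :=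
  if h : ∃ t, folRadius R δ₁ t < |folMean y t - τ| then
    some (decide (τ < folMean y (Nat.find h)), folCount (Nat.find h))
  else none

/-! ### The subroutine Binary-Search -/

/-- The loop of Binary-Search on the ranked list `seq = (i_1, …, i_s)` from `b_min = lo`,
`b_max = hi`; position `b` of the list is `seq[b - 1]`, and `⌈(lo + hi) / 2⌉ = (lo + hi + 1) / 2`.
`lab i` is the result of Figure-Out-Label on arm `i`. The result consists of the boundary, the list
of arms labelled on the way (the set `T`) with their labels, and the number of pulls made. -/
def binarySearch {K : ℕ} (lab : Fin K → Option (Bool × ℕ)) (seq : List (Fin K)) (lo hi : ℕ) :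
    Option (ℕ × List (Fin K × Bool) × ℕ) :=
  if lo < hi then
    match seq[(lo + hi + 1) / 2 - 1]? with
    | none => none
    | some i =>
      match lab i with
      | none => none
      | some (y, n) =>
        (if y then binarySearch lab seq lo ((lo + hi + 1) / 2 - 1)
          else binarySearch lab seq ((lo + hi + 1) / 2) hi).map
          fun r => (r.1, (i, y) :: r.2.1, n + r.2.2)
  else some (lo, [], 0)
termination_by hi - lo
decreasing_by all_goals omega

/-- Confidence with which Binary-Search (with confidence `δ₀`, on `s` arms) calls Figure-Out-Label:
`δ₀ / log s`. For `s = 1`, where this quotient is undefined and only one call is made, it is `δ₀`. -/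
noncomputable def callConfidence (δ₀ : ℝ) (s : ℕ) : ℝ :=
  if s ≤ 1 then δ₀ else δ₀ / Real.log s

/-! ### Rank-Search -/

/-- Input of Rank-Search: error rate `δ`, threshold `τ`, sub-Gaussian parameter `R` of the rewards,
initial confidence level `γ₀`, shrinking factor `κ`. -/
structure RSParams where
  δ : ℝ
  τ : ℝ
  R : ℝ
  γ₀ : ℝ
  κ : ℝ

/-- State of Rank-Search between two rounds. All arms of the working set have been compared equally
often, so that one comparison count serves for all of them. -/
structure RSState (K : ℕ) where
  /-- the working set `S` -/
  active : Finset (Fin K)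
  /-- the number of comparisons made so far by each arm of `S` -/
  count : ℕ
  /-- the labels `ŷ`, where `true` means positive -/
  label : Fin K → Bool
  /-- the total number of duels so far -/
  duels : ℕ
  /-- the total number of pulls so far -/
  pulls : ℕ

/-- `γ_t = γ₀ / κ^t`. -/
noncomputable def RSParams.γ (P : RSParams) (t : ℕ) : ℝ := P.γ₀ / P.κ ^ t

/-- Comparison count at the end of the ranking phase of round `t`, which adds one comparison to each
of the `s` arms of the working set as long as the count is at most
`γ_t⁻² log (8 s (t+1)² / δ)`. -/
noncomputable def RSParams.newCount (P : RSParams) (t s n : ℕ) : ℕ :=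
  max n (⌊1 / P.γ t ^ 2 * Real.log (8 * s * ((t : ℝ) + 1) ^ 2 / P.δ)⌋₊ + 1)

/-- Does arm `i` win its `m`-th comparison, made against a random opponent? -/
def wins {K : ℕ} (ω : Samples K) (i : Fin K) (m : ℕ) : Bool :=
  ω.2.2 (i, ω.2.1 (i, m), m)

/-- Win rate of arm `i` in its first `n` comparisons. -/
noncomputable def winRate {K : ℕ} (ω : Samples K) (n : ℕ) (i : Fin K) : ℝ :=
  (∑ m ∈ Finset.range n, if wins ω i m then (1 : ℝ) else 0) / n

open Classical in
/-- The arms of `S` in increasing order of `p`, ties broken by the index. -/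
noncomputable def rankBy {K : ℕ} (p : Fin K → ℝ) (S : Finset (Fin K)) : List (Fin K) :=
  (S.sort (· ≤ ·)).insertionSort fun i j => p i ≤ p j

/-- The arms `S̄` separated from `i_{b+1} = seq[b]` (no arm if `b = |S|`). -/
noncomputable def upperSeparated {K : ℕ} (p : Fin K → ℝ) (g : ℝ) (S : Finset (Fin K))
    (seq : List (Fin K)) (b : ℕ) : Finset (Fin K) :=
  match seq[b]? with
  | some j => {i ∈ S | 2 * g < p i - p j}
  | none => ∅

/-- The arms `S̲` separated from `i_b = seq[b-1]` (no arm if `b = 0`). -/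
noncomputable def lowerSeparated {K : ℕ} (p : Fin K → ℝ) (g : ℝ) (S : Finset (Fin K))
    (seq : List (Fin K)) (b : ℕ) : Finset (Fin K) :=
  if b = 0 then ∅ else
    match seq[b - 1]? with
    | some j => {i ∈ S | p i - p j < -(2 * g)}
    | none => ∅

/-- Round `t` of Rank-Search: ranking by duels, binary search by pulls with confidence
`δ / (4 (t+1)²)`, labelling of the separated arms, removal of all labelled arms from the working
set. An arm that is pulled leaves the working set at the end of the round, and the positions probed
by one binary search are distinct, so each arm is given to Figure-Out-Label at most once and its
reward stream is read from the start. -/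
noncomputable def rsRound {K : ℕ} (P : RSParams) (ω : Samples K) (t : ℕ) (s : RSState K) :
    Option (RSState K) :=
  let n := P.newCount t s.active.card s.count
  let p := winRate ω n
  let seq := rankBy p s.active
  let δ₁ := callConfidence (P.δ / (4 * ((t : ℝ) + 1) ^ 2)) s.active.card
  let lab := fun i : Fin K => figureOutLabel P.R P.τ δ₁ fun m => ω.1 (i, m)
  (binarySearch lab seq 0 s.active.card).map fun r =>
    let up := upperSeparated p (P.γ t) s.active seq r.1
    let lo := lowerSeparated p (P.γ t) s.active seq r.1
    { active := ((s.active \ up) \ lo) \ (r.2.1.map Prod.fst).toFinset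
      count := n
      label := fun i =>
        if i ∈ lo then false
        else if i ∈ up then true
        else if (i, true) ∈ r.2.1 then true
        else if (i, false) ∈ r.2.1 then false
        else s.label i
      duels := s.duels + s.active.card * (n - s.count)
      pulls := s.pulls + r.2.2 }

/-- State of Rank-Search after `t` rounds (unchanged once the working set is empty); `none` if a
call of Figure-Out-Label did not terminate. -/
noncomputable def rsState {K : ℕ} (P : RSParams) (ω : Samples K) : ℕ → Option (RSState K)
  | 0 => some ⟨Finset.univ, 0, fun _ => false, 0, 0⟩
  | t + 1 => (rsState P ω t).bind fun s => if s.active = ∅ then some s else rsRound P ω t s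

/-- On the samples `ω`, Rank-Search terminates, returns `A` as the set of positive arms, and uses at
most `D` duels and at most `N` pulls. -/
def RSReturns {K : ℕ} (P : RSParams) (ω : Samples K) (A : Finset (Fin K)) (D N : ℝ) : Prop :=
  ∃ t s, rsState P ω t = some s ∧ s.active = ∅ ∧ (∀ i, i ∈ A ↔ s.label i = true) ∧
    (s.duels : ℝ) ≤ D ∧ (s.pulls : ℝ) ≤ N

/-! ### Pull-only algorithms -/

/-- A pull-only algorithm on `K` arms: given its internal randomness and the history of arms pulled
and rewards received, it either pulls an arm or stops and returns a set of arms. -/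
structure PullAlgorithm (K : ℕ) where
  Seed : Type
  [mSeed : MeasurableSpace Seed]
  law : Measure Seed
  [isProb : IsProbabilityMeasure law]
  next : Seed → List (Fin K × Bool) → Fin K ⊕ Finset (Fin K)
  measurable_next : ∀ h a, MeasurableSet {s | next s h = a}

attribute [instance] PullAlgorithm.mSeed PullAlgorithm.isProb

/-- Number of pulls of arm `i` in a history. -/
def pullsOf {K : ℕ} (h : List (Fin K × Bool)) (i : Fin K) : ℕ := h.countP fun a => a.1 = i

/-- History after `t` steps (constant once the algorithm has stopped), on the rewards `y`. -/
def PullAlgorithm.history {K : ℕ} (A : PullAlgorithm K) (s : A.Seed) (y : Fin K × ℕ → Bool) :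
    ℕ → List (Fin K × Bool)
  | 0 => []
  | t + 1 =>
    match A.next s (A.history s y t) with
    | Sum.inl i => A.history s y t ++ [(i, y (i, pullsOf (A.history s y t) i))]
    | Sum.inr _ => A.history s y t

/-- Total number of pulls, possibly infinite. -/
noncomputable def PullAlgorithm.pulls {K : ℕ} (A : PullAlgorithm K) (s : A.Seed)
    (y : Fin K × ℕ → Bool) : ℝ≥0∞ :=
  ⨆ t, ((A.history s y t).length : ℝ≥0∞)

/-- The algorithm stops and returns the set `B`. -/
def PullAlgorithm.Returns {K : ℕ} (A : PullAlgorithm K) (s : A.Seed) (y : Fin K × ℕ → Bool)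
    (B : Finset (Fin K)) : Prop :=
  ∃ t, A.next s (A.history s y t) = Sum.inr B

/-- Law of internal randomness and rewards. -/
noncomputable def PullAlgorithm.runLaw {K : ℕ} (A : PullAlgorithm K) (μ : Fin K → ℝ) :
    Measure (A.Seed × (Fin K × ℕ → Bool)) :=
  A.law.prod (rewardLaw μ)

/-- The algorithm succeeds with probability at least `1 - δ` on every Bernoulli instance none of
whose means equals the threshold. -/
def PullAlgorithm.IsCorrect {K : ℕ} (A : PullAlgorithm K) (τ δ : ℝ) : Prop :=
  ∀ μ : Fin K → ℝ, (∀ i, μ i ∈ Set.Icc (0 : ℝ) 1) → (∀ i, μ i ≠ τ) →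
    ENNReal.ofReal (1 - δ) ≤ A.runLaw μ {ω | A.Returns ω.1 ω.2 (positiveSet τ μ)}

/-! ### CLUCB

The CLUCB algorithm for the decision class of all sets of arms and the weights `μ_i - τ`. -/

/-- Empirical mean of arm `i` in a history. -/
noncomputable def histMean {K : ℕ} (h : List (Fin K × Bool)) (i : Fin K) : ℝ :=
  (h.countP fun a => a = (i, true) : ℝ) / pullsOf h i

/-- Confidence radius `R √(2 log (4 K t³ / δ) / T_i)` of arm `i`, where `t` is the number of pulls so
far and `T_i` is the number of pulls of arm `i`. -/
noncomputable def clucbRadius {K : ℕ} (R δ : ℝ) (h : List (Fin K × Bool)) (i : Fin K) : ℝ :=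
  R * √(2 * Real.log (4 * K * (h.length : ℝ) ^ 3 / δ) / pullsOf h i)

/-- The symmetric difference of the empirically best set `{i | τ ≤ mean_i}` and of the set that is
best for the pessimistic weights (`mean_i - rad_i` inside, `mean_i + rad_i` outside): the arms with
`τ` strictly inside their confidence interval. -/
noncomputable def clucbAmbiguous {K : ℕ} (R τ δ : ℝ) (h : List (Fin K × Bool)) :
    Finset (Fin K) :=
  {i | |histMean h i - τ| < clucbRadius R δ h i}

open Classical in
/-- One decision of CLUCB: first pull every arm once; then pull an ambiguous arm of largest radius,
or, if there is none, stop and return the empirically best set. -/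
noncomputable def clucbNext {K : ℕ} (R τ δ : ℝ) (h : List (Fin K × Bool)) :
    Fin K ⊕ Finset (Fin K) :=
  if hK : h.length < K then Sum.inl ⟨h.length, hK⟩
  else if ha : (clucbAmbiguous R τ δ h).Nonempty then
    Sum.inl (Finset.exists_max_image _ (clucbRadius R δ h) ha).choose
  else Sum.inr (Finset.univ.filter fun i => τ ≤ histMean h i)

noncomputable def clucb (K : ℕ) (R τ δ : ℝ) : PullAlgorithm K where
  Seed := Unit
  law := Measure.dirac ()
  next := fun _ => clucbNext R τ δ
  measurable_next := fun _ _ => MeasurableSpace.measurableSet_top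

/-! ### The random instance -/

/-- The rate `λ = 4 log (4 l / δ)` of the exponential distribution. -/
noncomputable def expRate (l : ℕ) (δ : ℝ) : ℝ := 4 * Real.log (4 * l / δ)

/-- Law of the sample `(x_1, …, x_{2l})`, i.i.d. exponential of rate `λ`. -/
noncomputable def sampleXLaw (l : ℕ) (δ : ℝ) : Measure (Fin (2 * l) → ℝ) :=
  Measure.pi fun _ => expMeasure (expRate l δ)

/-- The means: `x_i` for the first `l` arms and `1 - x_i` for the last `l` arms. -/
def armMeans {l : ℕ} (x : Fin (2 * l) → ℝ) (i : Fin (2 * l)) : ℝ :=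
  if (i : ℕ) < l then x i else 1 - x i

end TBPDC

namespace TBPDC

/-! ### A maximal inequality -/

/-- Partial products of `x`, frozen as soon as they reach the level `a`. -/
noncomputable def frozenProd (a : ℝ≥0∞) (x : ℕ → ℝ≥0∞) : ℕ → ℝ≥0∞
  | 0 => 1
  | k + 1 => if a ≤ frozenProd a x k then frozenProd a x k else frozenProd a x k * x k

lemma frozenProd_congr (a : ℝ≥0∞) {x x' : ℕ → ℝ≥0∞} (k : ℕ) (h : ∀ m < k, x m = x' m) :
    frozenProd a x k = frozenProd a x' k := by
  induction k with
  | zero => rfl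
  | succ k ih =>
    simp only [frozenProd]
    rw [ih fun m hm => h m (by omega), h k (by omega)]

lemma le_frozenProd_succ {a : ℝ≥0∞} {x : ℕ → ℝ≥0∞} {k : ℕ} (h : a ≤ frozenProd a x k) :
    a ≤ frozenProd a x (k + 1) := by
  simp only [frozenProd, if_pos h]; exact h

lemma frozenProd_eq_or (a : ℝ≥0∞) (x : ℕ → ℝ≥0∞) (k : ℕ) :
    a ≤ frozenProd a x k ∨ frozenProd a x k = ∏ m ∈ Finset.range k, x m := by
  induction k with
  | zero => right; simp [frozenProd]
  | succ k ih =>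
    rcases ih with h | h
    · exact Or.inl (le_frozenProd_succ h)
    · by_cases h' : a ≤ frozenProd a x k
      · exact Or.inl (le_frozenProd_succ h')
      · right; simp only [frozenProd, if_neg h']; rw [Finset.prod_range_succ, h]

lemma measurable_frozenProd (a : ℝ≥0∞) (k : ℕ) :
    Measurable fun x : ℕ → ℝ≥0∞ => frozenProd a x k := by
  induction k with
  | zero => exact measurable_const
  | succ k ih =>
    simp only [frozenProd]
    exact Measurable.ite (measurableSet_le measurable_const ih) ih (ih.mul (measurable_pi_apply k))

/-- Ville's inequality for products of independent nonnegative random variables. -/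
theorem measure_exists_le_prod_le {Ω : Type*} {mΩ : MeasurableSpace Ω} {P : Measure Ω}
    [IsProbabilityMeasure P] {X : ℕ → Ω → ℝ≥0∞} (hX : ∀ n, Measurable (X n)) (hind : iIndepFun X P)
    (hint : ∀ n, ∫⁻ ω, X n ω ∂P ≤ 1) {a : ℝ≥0∞} :
    P {ω | ∃ n, a ≤ ∏ m ∈ Finset.range n, X m ω} ≤ a⁻¹ := by
  have hZm : ∀ k, Measurable fun ω => frozenProd a (fun m => X m ω) k := fun k =>
    (measurable_frozenProd a k).comp (measurable_pi_lambda _ hX)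
  have hindk : ∀ k, IndepFun (fun ω => frozenProd a (fun m => X m ω) k) (X k) P := by
    intro k
    have h := hind.indepFun_finset (Finset.range k) {k} (by simp) hX
    let ext : (Finset.range k → ℝ≥0∞) → ℕ → ℝ≥0∞ := fun y m =>
      if hm : m ∈ Finset.range k then y ⟨m, hm⟩ else 0
    have hext : Measurable ext := by
      refine measurable_pi_lambda _ fun m => ?_
      by_cases hm : m ∈ Finset.range k
      · simp only [ext, dif_pos hm]; exact measurable_pi_apply _
      · simp only [ext, dif_neg hm]; exact measurable_const
    have h2 := h.comp ((measurable_frozenProd a k).comp hext)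
      (measurable_pi_apply (⟨k, by simp⟩ : ({k} : Finset ℕ)))
    have he : (fun ω => frozenProd a (fun m => X m ω) k)
        = ((fun x => frozenProd a x k) ∘ ext) ∘ fun ω (m : Finset.range k) => X m ω := by
      funext ω
      refine frozenProd_congr a k fun m hm => ?_
      simp only [ext, dif_pos (Finset.mem_range.2 hm)]
    rw [he]
    exact h2
  have hexp : ∀ k, ∫⁻ ω, frozenProd a (fun m => X m ω) k ∂P ≤ 1 := by
    intro k
    induction k with
    | zero => simp [frozenProd]
    | succ k ih =>
      set Z : Ω → ℝ≥0∞ := fun ω => frozenProd a (fun m => X m ω) k with hZ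
      have hA : MeasurableSet {z : ℝ≥0∞ | a ≤ z} := measurableSet_Ici
      let f1 : ℝ≥0∞ → ℝ≥0∞ := fun z => if a ≤ z then z else 0
      let f2 : ℝ≥0∞ → ℝ≥0∞ := fun z => if a ≤ z then 0 else z
      have hf1 : Measurable f1 := Measurable.ite hA measurable_id measurable_const
      have hf2 : Measurable f2 := Measurable.ite hA measurable_const measurable_id
      have hsplit : ∀ ω, frozenProd a (fun m => X m ω) (k + 1)
          = f1 (Z ω) + f2 (Z ω) * X k ω := by
        intro ω
        simp only [frozenProd, f1, f2, hZ]
        split_ifs <;> simp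
      have hI : IndepFun (fun ω => f2 (Z ω)) (X k) P := (hindk k).comp hf2 measurable_id
      have hm := lintegral_mul_eq_lintegral_mul_lintegral_of_indepFun
        (hf2.comp (hZm k)) (hX k) hI
      calc ∫⁻ ω, frozenProd a (fun m => X m ω) (k + 1) ∂P
          = ∫⁻ ω, f1 (Z ω) + f2 (Z ω) * X k ω ∂P := lintegral_congr hsplit
        _ = ∫⁻ ω, f1 (Z ω) ∂P + ∫⁻ ω, f2 (Z ω) * X k ω ∂P :=
            lintegral_add_left (hf1.comp (hZm k)) _
        _ ≤ ∫⁻ ω, f1 (Z ω) ∂P + ∫⁻ ω, f2 (Z ω) ∂P := by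
            refine add_le_add le_rfl (hm.le.trans ?_)
            calc _ ≤ (∫⁻ ω, (f2 ∘ Z) ω ∂P) * 1 := by gcongr; exact hint k
              _ = _ := by rw [mul_one]; rfl
        _ = ∫⁻ ω, f1 (Z ω) + f2 (Z ω) ∂P := (lintegral_add_left (hf1.comp (hZm k)) _).symm
        _ = ∫⁻ ω, Z ω ∂P := by
            refine lintegral_congr fun ω => ?_
            simp only [f1, f2]; split_ifs <;> simp
        _ ≤ 1 := ih
  have hsub : {ω | ∃ n, a ≤ ∏ m ∈ Finset.range n, X m ω}
      ⊆ ⋃ k, {ω | a ≤ frozenProd a (fun m => X m ω) k} := by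
    rintro ω ⟨n, hn⟩
    refine Set.mem_iUnion.2 ⟨n, ?_⟩
    rcases frozenProd_eq_or a (fun m => X m ω) n with h | h
    · exact h
    · exact hn.trans h.ge
  refine (measure_mono hsub).trans ?_
  have hmono : Monotone fun k => {ω | a ≤ frozenProd a (fun m => X m ω) k} :=
    monotone_nat_of_le_succ fun k ω hω => le_frozenProd_succ hω
  rw [hmono.measure_iUnion]
  refine iSup_le fun k => ?_
  have := mul_meas_ge_le_lintegral (μ := P) (hZm k) a
  rw [ENNReal.le_inv_iff_mul_le, mul_comm]
  exact this.trans (hexp k)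

/-! ### Bernoulli rewards -/

lemma lintegral_ber (p : ℝ) (hp : p ∈ Set.Icc (0 : ℝ) 1) (f : Bool → ℝ≥0∞) :
    ∫⁻ b, f b ∂(ber p) = ENNReal.ofReal p * f true + ENNReal.ofReal (1 - p) * f false := by
  have h1 : (unitInterval.toNNReal (Set.projIcc (0 : ℝ) 1 zero_le_one p) : ℝ≥0∞)
      = ENNReal.ofReal p := by
    rw [Set.projIcc_of_mem zero_le_one hp, ENNReal.ofReal, ENNReal.coe_inj]
    ext; simp [Real.coe_toNNReal _ hp.1]
  have h2 : (unitInterval.toNNReal (unitInterval.symm (Set.projIcc (0 : ℝ) 1 zero_le_one p)) : ℝ≥0∞)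
      = ENNReal.ofReal (1 - p) := by
    rw [Set.projIcc_of_mem zero_le_one hp, ENNReal.ofReal, ENNReal.coe_inj]
    ext; simp [Real.coe_toNNReal _ (sub_nonneg.2 hp.2)]
  rw [ber, bernoulliMeasure_def, lintegral_add_measure]
  simp only [← h1, ← h2]
  rw [show ∀ (c : NNReal) (m : Measure Bool), c • m = (c : ℝ≥0∞) • m from fun _ _ => rfl,
    show ∀ (c : NNReal) (m : Measure Bool), c • m = (c : ℝ≥0∞) • m from fun _ _ => rfl,
    lintegral_smul_measure, lintegral_smul_measure]
  simp

/-- Number `0` or `1` of an outcome. -/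
def bit (b : Bool) : ℝ := if b then 1 else 0

lemma lintegral_ber_exp_le (p : ℝ) (hp : p ∈ Set.Icc (0 : ℝ) 1) (s : ℝ) :
    ∫⁻ b, ENNReal.ofReal (Real.exp (s * (bit b - p) - s ^ 2 / 8)) ∂(ber p) ≤ 1 := by
  have hint : ∀ f : Bool → ℝ, ∫ b, f b ∂(ber p) = p * f true + (1 - p) * f false := by
    intro f
    rw [ber, integral_bernoulliMeasure, Set.projIcc_of_mem zero_le_one hp]
    simp
  have h := hasSubgaussianMGF_of_mem_Icc (μ := ber p) (X := bit) (a := 0) (b := 1)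
    (Measurable.of_discrete).aemeasurable (ae_of_all _ fun b => by cases b <;> simp [bit])
  have h2 := h.mgf_le s
  have h3 : ∫ b, bit b ∂(ber p) = p := by rw [hint]; simp [bit]
  rw [mgf, h3, hint] at h2
  have h4 : p * Real.exp (s * (bit true - p)) + (1 - p) * Real.exp (s * (bit false - p))
      ≤ Real.exp (s ^ 2 / 8) := by
    refine h2.trans (le_of_eq ?_)
    congr 1
    simp; ring
  rw [lintegral_ber p hp, ← ENNReal.ofReal_mul hp.1, ← ENNReal.ofReal_mul (sub_nonneg.2 hp.2),
    ← ENNReal.ofReal_add (by have := hp.1; positivity)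
      (mul_nonneg (sub_nonneg.2 hp.2) (Real.exp_pos _).le), ← ENNReal.ofReal_one]
  refine ENNReal.ofReal_le_ofReal ?_
  rw [Real.exp_sub, Real.exp_sub, ← mul_div_assoc, ← mul_div_assoc, ← add_div,
    div_le_one (Real.exp_pos _)]
  exact h4

instance {K : ℕ} (μ : Fin K → ℝ) : IsProbabilityMeasure (rewardLaw μ) := by
  unfold rewardLaw; infer_instance

/-- Mean of the first `n` outcomes of arm `i`. -/
noncomputable def avg {K : ℕ} (y : Fin K × ℕ → Bool) (i : Fin K) (n : ℕ) : ℝ :=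
  (∑ m ∈ Finset.range n, bit (y (i, m))) / n

/-- Uniform deviation bound for the running means of an arm, on the side given by the sign `c`. -/
theorem rewardLaw_exists_dev_le {K : ℕ} (μ : Fin K → ℝ) (i : Fin K)
    (hμ : μ i ∈ Set.Icc (0 : ℝ) 1) {c : ℝ} (hc : c ^ 2 = 1) {N ε : ℝ} (hε : 0 ≤ ε) :
    rewardLaw μ {y | ∃ n : ℕ, 1 ≤ n ∧ N ≤ n ∧ ε ≤ c * (avg y i n - μ i)}
      ≤ ENNReal.ofReal (Real.exp (-(2 * N * ε ^ 2))) := by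
  let f : Bool → ℝ≥0∞ := fun b =>
    ENNReal.ofReal (Real.exp (4 * c * ε * (bit b - μ i) - (4 * c * ε) ^ 2 / 8))
  have hind : iIndepFun (fun (n : ℕ) (y : Fin K × ℕ → Bool) => f (y (i, n))) (rewardLaw μ) := by
    have h := iIndepFun_infinitePi (P := fun a : Fin K × ℕ => ber (μ a.1)) (X := fun _ => f)
      (fun _ => Measurable.of_discrete)
    exact h.precomp (g := fun n : ℕ => (i, n)) (fun a b hab => by simpa using hab)
  have hmeas : ∀ n : ℕ, Measurable fun y : Fin K × ℕ → Bool => f (y (i, n)) := fun n =>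
    (Measurable.of_discrete (f := f)).comp (measurable_pi_apply _)
  have hint : ∀ n : ℕ, ∫⁻ y, f (y (i, n)) ∂(rewardLaw μ) ≤ 1 := by
    intro n
    have h := (measurePreserving_eval_infinitePi (fun a : Fin K × ℕ => ber (μ a.1)) (i, n))
    have h2 := h.lintegral_comp (f := f) Measurable.of_discrete
    refine le_trans (le_of_eq h2) ?_
    exact lintegral_ber_exp_le (μ i) hμ _
  have hV := measure_exists_le_prod_le hmeas hind hint
    (a := ENNReal.ofReal (Real.exp (2 * N * ε ^ 2)))

  rw [← ENNReal.ofReal_inv_of_pos (Real.exp_pos _), ← Real.exp_neg] at hV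
  refine (measure_mono ?_).trans hV
  rintro y ⟨n, hn1, hnN, hn⟩
  refine ⟨n, ?_⟩
  simp only [f]
  rw [← ENNReal.ofReal_prod_of_nonneg fun _ _ => (Real.exp_pos _).le, ← Real.exp_sum]
  refine ENNReal.ofReal_le_ofReal (Real.exp_le_exp.2 ?_)
  have hn0 : (0 : ℝ) < n := by exact_mod_cast hn1
  have hsum : ∑ m ∈ Finset.range n, (4 * c * ε * (bit (y (i, m)) - μ i) - (4 * c * ε) ^ 2 / 8)
      = n * (4 * ε * (c * (avg y i n - μ i)) - 2 * ε ^ 2) := by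
    rw [Finset.sum_sub_distrib, ← Finset.mul_sum, Finset.sum_sub_distrib]
    simp only [Finset.sum_const, Finset.card_range, nsmul_eq_mul, avg]
    have : (4 * c * ε) ^ 2 = 16 * ε ^ 2 := by rw [mul_pow, mul_pow, hc]; ring
    rw [this]
    field_simp
    ring
  rw [hsum]
  have h1 : 4 * ε * ε ≤ 4 * ε * (c * (avg y i n - μ i)) := by gcongr
  have h2 : N * ε ^ 2 ≤ n * ε ^ 2 := by gcongr
  nlinarith


/-! ### The law of the comparisons -/

lemma ber_apply (p : ℝ) (hp : p ∈ Set.Icc (0 : ℝ) 1) (t : Set Bool) :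
    ber p t = ENNReal.ofReal p * t.indicator 1 true + ENNReal.ofReal (1 - p) * t.indicator 1 false := by
  rw [← lintegral_indicator_one (MeasurableSet.of_discrete), lintegral_ber p hp]

/-- Win probability of arm `i` against a uniformly random opponent. -/
noncomputable def meanScore {K : ℕ} (M : Fin K → Fin K → ℝ) (i : Fin K) : ℝ := (∑ j, M i j) / K

lemma meanScore_mem {K : ℕ} [NeZero K] {M : Fin K → Fin K → ℝ}
    (hM : ∀ i j, M i j ∈ Set.Icc (0 : ℝ) 1) (i : Fin K) : meanScore M i ∈ Set.Icc (0 : ℝ) 1 := by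
  have hK : (0 : ℝ) < K := by exact_mod_cast Nat.pos_of_ne_zero (NeZero.ne K)
  refine ⟨div_nonneg (Finset.sum_nonneg fun j _ => (hM i j).1) hK.le, ?_⟩
  rw [meanScore, div_le_one hK]
  calc ∑ j, M i j ≤ ∑ _j : Fin K, (1 : ℝ) := Finset.sum_le_sum fun j _ => (hM i j).2
    _ = K := by simp

instance (K : ℕ) [NeZero K] : IsProbabilityMeasure (opponentLaw K) := by
  unfold opponentLaw; infer_instance

instance {K : ℕ} (M : Fin K → Fin K → ℝ) : IsProbabilityMeasure (duelLaw M) := by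
  unfold duelLaw; infer_instance

/-- The outcomes of all comparisons, as a function of opponents and duels. -/
def winsOf {K : ℕ} (d : (Fin K × ℕ → Fin K) × (Fin K × Fin K × ℕ → Bool)) :
    Fin K × ℕ → Bool := fun a => d.2 (a.1, d.1 a, a.2)

lemma measurable_winsOf {K : ℕ} : Measurable (winsOf (K := K)) := by
  refine measurable_pi_lambda _ fun a => ?_
  have h : Measurable fun p : Fin K × (Fin K × Fin K × ℕ → Bool) => p.2 (a.1, p.1, a.2) :=
    measurable_from_prod_countable_right fun j =>
      (measurable_pi_apply (a.1, j, a.2) : Measurable fun D : Fin K × Fin K × ℕ → Bool => D (a.1, j, a.2))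
  have h1 : Measurable fun d : (Fin K × ℕ → Fin K) × (Fin K × Fin K × ℕ → Bool) => (d.1 a, d.2) :=
    ((measurable_pi_apply a).comp measurable_fst).prodMk measurable_snd
  exact h.comp h1

lemma lintegral_uniform {K : ℕ} [NeZero K] (f : Fin K → ℝ≥0∞) :
    ∫⁻ j, f j ∂(PMF.uniformOfFintype (Fin K)).toMeasure = (∑ j, f j) / K := by
  rw [lintegral_fintype]
  simp only [PMF.toMeasure_apply_singleton _ _ (measurableSet_singleton _),
    PMF.uniformOfFintype_apply, Fintype.card_fin]
  rw [← Finset.sum_mul, ENNReal.div_eq_inv_mul, mul_comm]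

/-- The comparisons are independent, and arm `i` wins each of them with probability
`meanScore M i`. -/
theorem map_winsOf {K : ℕ} [NeZero K] {M : Fin K → Fin K → ℝ}
    (hM : ∀ i j, M i j ∈ Set.Icc (0 : ℝ) 1) :
    ((opponentLaw K).prod (duelLaw M)).map winsOf = rewardLaw (meanScore M) := by
  have hK : (0 : ℝ) < K := by exact_mod_cast Nat.pos_of_ne_zero (NeZero.ne K)
  refine Measure.eq_infinitePi _ fun s t ht => ?_
  have hS : MeasurableSet ((s : Set (Fin K × ℕ)).pi t) :=
    MeasurableSet.pi s.countable_toSet fun i _ => ht i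
  rw [Measure.map_apply measurable_winsOf hS, Measure.prod_apply (measurable_winsOf hS)]
  have h1 : ∀ o : Fin K × ℕ → Fin K, duelLaw M (Prod.mk o ⁻¹' (winsOf ⁻¹' ((s : Set _).pi t)))
      = ∏ a ∈ s, ber (M a.1 (o a)) (t a) := by
    intro o
    have hinj : Function.Injective fun a : Fin K × ℕ => (a.1, o a, a.2) := by
      rintro ⟨a, b⟩ ⟨a', b'⟩ h
      simp only [Prod.mk.injEq] at h
      ext <;> simp [h.1, h.2.2]
    have h2 := Measure.map_infinitePi_infinitePi_of_inj
      (P := fun a : Fin K × Fin K × ℕ => ber (M a.1 a.2.1)) hinj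
    have h3 := Measure.infinitePi_pi (fun a : Fin K × ℕ => ber (M a.1 (o a))) (s := s) (t := t)
      (fun i _ => ht i)
    rw [← h3, ← h2, Measure.map_apply (measurable_pi_lambda _ fun a => measurable_pi_apply _) hS]
    rfl
  simp_rw [h1]
  have hind : iIndepFun (fun (a : Fin K × ℕ) (o : Fin K × ℕ → Fin K) => ber (M a.1 (o a)) (t a))
      (opponentLaw K) :=
    iIndepFun_infinitePi (P := fun _ : Fin K × ℕ => (PMF.uniformOfFintype (Fin K)).toMeasure)
      (X := fun a j => ber (M a.1 j) (t a)) (fun _ => Measurable.of_discrete)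
  have hms : ∀ a : Fin K × ℕ, Measurable fun o : Fin K × ℕ → Fin K => ber (M a.1 (o a)) (t a) :=
    fun a => (Measurable.of_discrete (f := fun j => ber (M a.1 j) (t a))).comp (measurable_pi_apply a)
  rw [lintegral_prod_eq_prod_lintegral_of_indepFun s _ hind hms]
  refine Finset.prod_congr rfl fun a _ => ?_
  have h := (measurePreserving_eval_infinitePi
    (fun _ : Fin K × ℕ => (PMF.uniformOfFintype (Fin K)).toMeasure) a).lintegral_comp
    (f := fun j => ber (M a.1 j) (t a)) Measurable.of_discrete
  refine (show _ = _ from h).trans ?_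
  rw [lintegral_uniform, ber_apply _ (meanScore_mem hM a.1)]
  simp_rw [fun j => ber_apply _ (hM a.1 j) (t a)]
  rw [Finset.sum_add_distrib, ← Finset.sum_mul, ← Finset.sum_mul,
    ← ENNReal.ofReal_sum_of_nonneg fun j _ => (hM a.1 j).1,
    ← ENNReal.ofReal_sum_of_nonneg fun j _ => sub_nonneg.2 (hM a.1 j).2, ENNReal.add_div,
    ENNReal.mul_div_right_comm, ENNReal.mul_div_right_comm]
  have hKe : (K : ℝ≥0∞) = ENNReal.ofReal K := by simp
  rw [hKe, ← ENNReal.ofReal_div_of_pos hK, ← ENNReal.ofReal_div_of_pos hK]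
  congr 3
  rw [Finset.sum_sub_distrib, meanScore]
  simp only [Finset.sum_const, Finset.card_univ, Fintype.card_fin, nsmul_eq_mul, mul_one]
  field_simp


/-! ### Exponential samples -/

lemma expMeasure_Ioi {r : ℝ} (hr : 0 < r) {y : ℝ} (hy : 0 ≤ y) :
    expMeasure r (Set.Ioi y) = ENNReal.ofReal (Real.exp (-(r * y))) := by
  have := isProbabilityMeasure_expMeasure hr
  have h := cdf_expMeasure_eq hr y
  rw [if_pos hy, cdf_eq_real] at h
  rw [← Set.compl_Iic, prob_compl_eq_one_sub measurableSet_Iic, ← ofReal_measureReal, h,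
    ← ENNReal.ofReal_one, ← ENNReal.ofReal_sub _ (by
      rw [sub_nonneg, Real.exp_le_one_iff]; nlinarith)]
  congr 1; ring

lemma expMeasure_Ioi_le {r : ℝ} (hr : 0 < r) (y : ℝ) :
    expMeasure r (Set.Ioi y) ≤ ENNReal.ofReal (Real.exp (-(r * y))) := by
  have := isProbabilityMeasure_expMeasure hr
  rcases le_total 0 y with hy | hy
  · exact (expMeasure_Ioi hr hy).le
  · refine prob_le_one.trans ?_
    rw [← ENNReal.ofReal_one]
    exact ENNReal.ofReal_le_ofReal (Real.one_le_exp (by nlinarith))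

lemma expMeasure_eq (r : ℝ) : expMeasure r = volume.withDensity (exponentialPDF r) := rfl

lemma measurable_exponentialPDF (r : ℝ) : Measurable (exponentialPDF r) :=
  (measurable_exponentialPDFReal r).ennreal_ofReal

lemma expMeasure_Iio_zero (r : ℝ) : expMeasure r (Set.Iio 0) = 0 := by
  rw [expMeasure_eq, withDensity_apply _ measurableSet_Iio]
  exact lintegral_exponentialPDF_of_nonpos le_rfl

lemma exponentialPDF_le (r x : ℝ) :
    exponentialPDF r x ≤ ENNReal.ofReal (r * Real.exp (-(r * x))) := by
  rw [exponentialPDF_eq]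
  split_ifs
  · exact le_rfl
  · simp

lemma expMeasure_Icc_le {r : ℝ} (hr : 0 < r) {a b : ℝ} :
    expMeasure r (Set.Icc a b) ≤ ENNReal.ofReal (r * Real.exp (-(r * a)) * (b - a)) := by
  rw [expMeasure_eq, withDensity_apply _ measurableSet_Icc]
  calc ∫⁻ x in Set.Icc a b, exponentialPDF r x
      ≤ ∫⁻ _ in Set.Icc a b, ENNReal.ofReal (r * Real.exp (-(r * a))) := by
        refine setLIntegral_mono measurable_const fun x hx => (exponentialPDF_le r x).trans ?_
        refine ENNReal.ofReal_le_ofReal ?_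
        have : -(r * x) ≤ -(r * a) := by nlinarith [hx.1]
        gcongr
    _ = _ := by
        rw [setLIntegral_const, Real.volume_Icc, ← ENNReal.ofReal_mul (by positivity)]

lemma lintegral_expMeasure_exp_le {r : ℝ} (hr : 0 < r) {c : ℝ} :
    ∫⁻ x, (Set.Iic c).indicator (fun x => ENNReal.ofReal (Real.exp (r * x))) x ∂(expMeasure r)
      ≤ ENNReal.ofReal (r * c) := by
  have hm : Measurable fun x => (Set.Iic c).indicator (fun x => ENNReal.ofReal (Real.exp (r * x))) x :=
    Measurable.indicator (by fun_prop) measurableSet_Iic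
  rw [expMeasure_eq, lintegral_withDensity_eq_lintegral_mul _ (measurable_exponentialPDF r) hm]
  calc ∫⁻ x, (exponentialPDF r *
          fun x => (Set.Iic c).indicator (fun x => ENNReal.ofReal (Real.exp (r * x))) x) x
      ≤ ∫⁻ x, (Set.Icc 0 c).indicator (fun _ => ENNReal.ofReal r) x := by
        refine lintegral_mono fun x => ?_
        simp only [Pi.mul_apply]
        by_cases h1 : x ≤ c
        · rw [Set.indicator_of_mem (show x ∈ Set.Iic c from h1)]
          by_cases h0 : 0 ≤ x
          · rw [Set.indicator_of_mem (show x ∈ Set.Icc 0 c from ⟨h0, h1⟩),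
              exponentialPDF_of_nonneg h0, ← ENNReal.ofReal_mul (by positivity), mul_assoc,
              ← Real.exp_add]
            simp
          · rw [exponentialPDF_of_neg (not_le.1 h0)]; simp
        · rw [Set.indicator_of_notMem (show x ∉ Set.Iic c from h1)]; simp
    _ = ENNReal.ofReal (r * c) := by
        rw [lintegral_indicator measurableSet_Icc, setLIntegral_const, Real.volume_Icc, sub_zero,
          ENNReal.ofReal_mul hr.le]

section Sample

variable {n : ℕ} {r : ℝ}

lemma expSample_eval (hr : 0 < r) (i : Fin n) :
    MeasurePreserving (fun x : Fin n → ℝ => x i) (Measure.pi fun _ => expMeasure r)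
      (expMeasure r) := by
  have := isProbabilityMeasure_expMeasure hr
  exact measurePreserving_eval (fun _ : Fin n => expMeasure r) i

lemma expSample_isProbabilityMeasure (hr : 0 < r) :
    IsProbabilityMeasure (Measure.pi fun _ : Fin n => expMeasure r) := by
  have := isProbabilityMeasure_expMeasure hr
  infer_instance

lemma expSample_exists_gt (hr : 0 < r) (y : ℝ) :
    (Measure.pi fun _ : Fin n => expMeasure r) {x | ∃ i, y < x i}
      ≤ ENNReal.ofReal (n * Real.exp (-(r * y))) := by
  have h : {x : Fin n → ℝ | ∃ i, y < x i} = ⋃ i, (fun x : Fin n → ℝ => x i) ⁻¹' Set.Ioi y := by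
    ext x; simp
  rw [h]
  refine (measure_iUnion_fintype_le _ _).trans ?_
  calc ∑ i : Fin n, (Measure.pi fun _ : Fin n => expMeasure r)
        ((fun x : Fin n → ℝ => x i) ⁻¹' Set.Ioi y)
      ≤ ∑ _i : Fin n, ENNReal.ofReal (Real.exp (-(r * y))) := by
        refine Finset.sum_le_sum fun i _ => ?_
        rw [(expSample_eval hr i).measure_preimage measurableSet_Ioi.nullMeasurableSet]
        exact expMeasure_Ioi_le hr y
    _ = _ := by
        rw [Finset.sum_const, Finset.card_univ, Fintype.card_fin, nsmul_eq_mul,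
          ENNReal.ofReal_mul (by positivity)]
        simp

lemma expSample_exists_neg (hr : 0 < r) :
    (Measure.pi fun _ : Fin n => expMeasure r) {x | ∃ i, x i < 0} = 0 := by
  have h : {x : Fin n → ℝ | ∃ i, x i < 0} = ⋃ i, (fun x : Fin n → ℝ => x i) ⁻¹' Set.Iio 0 := by
    ext x; simp
  rw [h, measure_iUnion_null_iff]
  intro i
  rw [(expSample_eval hr i).measure_preimage measurableSet_Iio.nullMeasurableSet]
  exact expMeasure_Iio_zero r

lemma expSample_sum_exp (hr : 0 < r) (c : ℝ) {A : ℝ} (hA : 0 < A) :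
    (Measure.pi fun _ : Fin n => expMeasure r)
        {x | (∀ i, x i ≤ c) ∧ A ≤ ∑ i, Real.exp (r * x i)}
      ≤ ENNReal.ofReal (n * (r * c) / A) := by
  let f : ℝ → ℝ≥0∞ := (Set.Iic c).indicator fun x => ENNReal.ofReal (Real.exp (r * x))
  have hf : Measurable f := Measurable.indicator (by fun_prop) measurableSet_Iic
  have hsub : {x : Fin n → ℝ | (∀ i, x i ≤ c) ∧ A ≤ ∑ i, Real.exp (r * x i)}
      ⊆ {x | ENNReal.ofReal A ≤ ∑ i, f (x i)} := by
    rintro x ⟨h1, h2⟩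
    have : ∑ i, f (x i) = ENNReal.ofReal (∑ i, Real.exp (r * x i)) := by
      rw [ENNReal.ofReal_sum_of_nonneg fun _ _ => (Real.exp_pos _).le]
      exact Finset.sum_congr rfl fun i _ => Set.indicator_of_mem (show x i ∈ Set.Iic c from h1 i) _
    exact (ENNReal.ofReal_le_ofReal h2).trans this.ge
  refine (measure_mono hsub).trans ?_
  have hmeas : Measurable fun x : Fin n → ℝ => ∑ i, f (x i) :=
    Finset.measurable_sum _ fun i _ => hf.comp (measurable_pi_apply i)
  refine (meas_ge_le_lintegral_div hmeas.aemeasurable (by simpa using hA)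
    ENNReal.ofReal_ne_top).trans ?_
  rw [ENNReal.ofReal_div_of_pos hA]
  gcongr
  rw [lintegral_finsetSum Finset.univ (f := fun i (x : Fin n → ℝ) => f (x i))
    fun i _ => hf.comp (measurable_pi_apply i)]
  calc ∑ i : Fin n, ∫⁻ x, f (x i) ∂(Measure.pi fun _ : Fin n => expMeasure r)
      ≤ ∑ _i : Fin n, ENNReal.ofReal (r * c) := by
        refine Finset.sum_le_sum fun i _ => ?_
        rw [(expSample_eval hr i).lintegral_comp hf]
        exact lintegral_expMeasure_exp_le hr
    _ = _ := by
        rw [Finset.sum_const, Finset.card_univ, Fintype.card_fin, nsmul_eq_mul,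
          ENNReal.ofReal_mul (Nat.cast_nonneg n)]
        simp

lemma expSample_indep (hr : 0 < r) {f : Fin n → ℝ → ℝ≥0∞} (hf : ∀ i, Measurable (f i)) :
    iIndepFun (fun i (x : Fin n → ℝ) => f i (x i)) (Measure.pi fun _ => expMeasure r) := by
  have := isProbabilityMeasure_expMeasure hr
  exact iIndepFun_pi fun i => (hf i).aemeasurable

/-- A lower tail bound for the number of sample points above `y` among those with index in `C`. -/
lemma expSample_card_le (hr : 0 < r) {y : ℝ} (hy : 0 ≤ y) (C : Finset (Fin n)) :
    (Measure.pi fun _ : Fin n => expMeasure r)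
        {x | (({i ∈ C | y < x i} : Finset (Fin n)).card : ℝ) ≤ C.card * Real.exp (-(r * y)) / 2}
      ≤ ENNReal.ofReal (Real.exp (-(C.card * Real.exp (-(r * y)) / 8))) := by
  have := isProbabilityMeasure_expMeasure hr
  set p := Real.exp (-(r * y)) with hp
  have hp0 : 0 < p := Real.exp_pos _
  have hp1 : p ≤ 1 := by rw [hp, Real.exp_le_one_iff]; nlinarith
  let f : ℝ → ℝ≥0∞ := fun x => if y < x then ENNReal.ofReal (Real.exp (-1)) else 1
  have hf : Measurable f := Measurable.ite measurableSet_Ioi measurable_const measurable_const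
  have hfint : ∫⁻ x, f x ∂(expMeasure r) ≤ ENNReal.ofReal (Real.exp (-(5 / 8 * p))) := by
    have h1 : ∀ x, f x = (Set.Ioi y).indicator (fun _ => ENNReal.ofReal (Real.exp (-1))) x
        + (Set.Ioi y)ᶜ.indicator (fun _ => 1) x := by
      intro x
      by_cases h : y < x
      · simp [f, h, not_le.2 h]
      · simp [f, h, not_lt.1 h]
    simp_rw [h1]
    rw [lintegral_add_left (measurable_const.indicator measurableSet_Ioi),
      lintegral_indicator measurableSet_Ioi, lintegral_indicator measurableSet_Ioi.compl,
      setLIntegral_const, setLIntegral_const, prob_compl_eq_one_sub measurableSet_Ioi,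
      expMeasure_Ioi hr hy, ← hp, one_mul, ← ENNReal.ofReal_one, ← ENNReal.ofReal_sub _ hp0.le,
      ← ENNReal.ofReal_mul (Real.exp_pos _).le, ← ENNReal.ofReal_add (by positivity) (by linarith)]
    refine ENNReal.ofReal_le_ofReal ?_
    have h2 : Real.exp (-1) ≤ 3 / 8 := by
      rw [Real.exp_neg, inv_le_comm₀ (Real.exp_pos _) (by norm_num)]
      linarith [Real.exp_one_gt_d9]
    have h3 := Real.add_one_le_exp (-(5 / 8 * p))
    nlinarith
  have hsub : {x : Fin n → ℝ | (({i ∈ C | y < x i} : Finset (Fin n)).card : ℝ) ≤ C.card * p / 2}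
      ⊆ {x | ENNReal.ofReal (Real.exp (-(C.card * p / 2))) ≤ ∏ i ∈ C, f (x i)} := by
    intro x hx
    have h1 : ∏ i ∈ C, f (x i)
        = ENNReal.ofReal (Real.exp (-(({i ∈ C | y < x i} : Finset (Fin n)).card : ℝ))) := by
      simp only [f]
      rw [← Finset.prod_filter, Finset.prod_const, ← ENNReal.ofReal_pow (Real.exp_pos _).le,
        ← Real.exp_nat_mul]
      simp
    refine le_trans (ENNReal.ofReal_le_ofReal (Real.exp_le_exp.2 ?_)) h1.ge
    exact neg_le_neg hx
  refine (measure_mono hsub).trans ?_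
  have hmeas : Measurable fun x : Fin n → ℝ => ∏ i ∈ C, f (x i) :=
    Finset.measurable_prod _ fun i _ => hf.comp (measurable_pi_apply i)
  refine (meas_ge_le_lintegral_div hmeas.aemeasurable (by simp [Real.exp_pos])
    ENNReal.ofReal_ne_top).trans ?_
  rw [lintegral_prod_eq_prod_lintegral_of_indepFun C _ (expSample_indep hr fun _ => hf)
    fun i => hf.comp (measurable_pi_apply i)]
  have h4 : ∏ i ∈ C, ∫⁻ x, f (x i) ∂(Measure.pi fun _ : Fin n => expMeasure r)
      ≤ ENNReal.ofReal (Real.exp (-(5 / 8 * (C.card * p)))) := by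
    calc _ ≤ ∏ _i ∈ C, ENNReal.ofReal (Real.exp (-(5 / 8 * p))) := by
          refine Finset.prod_le_prod' fun i _ => ?_
          rw [(expSample_eval hr i).lintegral_comp hf]
          exact hfint
      _ = _ := by
          rw [Finset.prod_const, ← ENNReal.ofReal_pow (Real.exp_pos _).le, ← Real.exp_nat_mul]
          congr 2; ring
  refine (ENNReal.div_le_div_right h4 _).trans ?_
  rw [← ENNReal.ofReal_div_of_pos (Real.exp_pos _), ← Real.exp_sub]
  refine ENNReal.ofReal_le_ofReal (Real.exp_le_exp.2 ?_)
  linarith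

/-- Sample points above `y` are unlikely to be close to other sample points. -/
lemma expSample_exists_close (hr : 0 < r) (y : ℝ) {g : ℝ} (hg : 0 ≤ g) :
    (Measure.pi fun _ : Fin n => expMeasure r)
        {x | ∃ i j, i ≠ j ∧ y < x i ∧ |x i - x j| ≤ g}
      ≤ ENNReal.ofReal (n ^ 2 * (2 * g * r * Real.exp (r * g) * Real.exp (-(2 * r * y)))) := by
  have := isProbabilityMeasure_expMeasure hr
  set c := 2 * g * r * Real.exp (r * g) * Real.exp (-(2 * r * y)) with hc
  have hc0 : 0 ≤ c := by positivity
  let B : Set (ℝ × ℝ) := {p | y < p.1 ∧ |p.1 - p.2| ≤ g}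
  have hB : MeasurableSet B :=
    (measurableSet_lt measurable_const measurable_fst).inter
      (measurableSet_le (f := fun p : ℝ × ℝ => |p.1 - p.2|) (by fun_prop) measurable_const)
  have hpair : ∀ i j : Fin n, i ≠ j → (Measure.pi fun _ : Fin n => expMeasure r)
      {x | y < x i ∧ |x i - x j| ≤ g} ≤ ENNReal.ofReal c := by
    intro i j hij
    have h1 := Measure.infinitePi_map_eval_prod (P := fun _ : Fin n => expMeasure r) hij
    rw [Measure.infinitePi_eq_pi] at h1
    have h2 : (Measure.pi fun _ : Fin n => expMeasure r) {x | y < x i ∧ |x i - x j| ≤ g}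
        = ((expMeasure r).prod (expMeasure r)) B := by
      rw [← h1, Measure.map_apply (by fun_prop) hB]; rfl
    rw [h2, Measure.prod_apply hB]
    calc ∫⁻ a, expMeasure r (Prod.mk a ⁻¹' B) ∂(expMeasure r)
        ≤ ∫⁻ a, (Set.Ioi y).indicator
            (fun _ => ENNReal.ofReal (2 * g * r * Real.exp (r * g) * Real.exp (-(r * y)))) a
            ∂(expMeasure r) := by
          refine lintegral_mono fun a => ?_
          by_cases ha : y < a
          · simp only [Set.indicator_of_mem (show a ∈ Set.Ioi y from ha)]
            have hss : Prod.mk a ⁻¹' B ⊆ Set.Icc (a - g) (a + g) := by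
              rintro b ⟨_, hb⟩
              have := abs_le.1 hb
              simp only at this
              constructor <;> linarith [this.1, this.2]
            refine (measure_mono hss).trans ((expMeasure_Icc_le hr).trans ?_)
            refine ENNReal.ofReal_le_ofReal ?_
            have h3 : Real.exp (-(r * (a - g))) ≤ Real.exp (r * g) * Real.exp (-(r * y)) := by
              rw [← Real.exp_add, Real.exp_le_exp]; nlinarith
            have h4 : 0 ≤ r * (2 * g) := by positivity
            calc r * Real.exp (-(r * (a - g))) * (a + g - (a - g))
                = r * (2 * g) * Real.exp (-(r * (a - g))) := by ring
              _ ≤ r * (2 * g) * (Real.exp (r * g) * Real.exp (-(r * y))) := by gcongr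
              _ = _ := by ring
          · have : Prod.mk a ⁻¹' B = ∅ := by
              ext b; simp only [Set.mem_preimage, Set.mem_empty_iff_false, iff_false]
              exact fun h => ha h.1
            rw [this]; simp
      _ ≤ _ := by
          rw [lintegral_indicator measurableSet_Ioi, setLIntegral_const]
          refine (mul_le_mul_right (expMeasure_Ioi_le hr y) _).trans ?_
          rw [← ENNReal.ofReal_mul (by positivity)]
          refine ENNReal.ofReal_le_ofReal (le_of_eq ?_)
          rw [hc, mul_assoc (2 * g * r * Real.exp (r * g)), ← Real.exp_add]
          congr 2; ring
  have h : {x : Fin n → ℝ | ∃ i j, i ≠ j ∧ y < x i ∧ |x i - x j| ≤ g}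
      = ⋃ i, ⋃ j, {x | i ≠ j ∧ y < x i ∧ |x i - x j| ≤ g} := by
    ext x; simp only [Set.mem_iUnion]; rfl
  rw [h]
  refine (measure_iUnion_fintype_le _ _).trans ?_
  calc ∑ i : Fin n, (Measure.pi fun _ : Fin n => expMeasure r)
          (⋃ j, {x | i ≠ j ∧ y < x i ∧ |x i - x j| ≤ g})
      ≤ ∑ _i : Fin n, ∑ _j : Fin n, ENNReal.ofReal c := by
        refine Finset.sum_le_sum fun i _ => (measure_iUnion_fintype_le _ _).trans ?_
        refine Finset.sum_le_sum fun j _ => ?_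
        by_cases hij : i = j
        · simp [hij]
        · refine (measure_mono ?_).trans (hpair i j hij)
          exact fun x hx => hx.2
    _ = _ := by
        simp only [Finset.sum_const, Finset.card_univ, Fintype.card_fin, nsmul_eq_mul]
        rw [ENNReal.ofReal_mul (p := (n : ℝ) ^ 2) (q := c) (by positivity),
          ENNReal.ofReal_pow (Nat.cast_nonneg n)]
        simp only [ENNReal.ofReal_natCast]
        ring

end Sample


/-! ### Histories of pull-only algorithms -/

section History

variable {K : ℕ} (A : PullAlgorithm K)

lemma history_succ_inl {s : A.Seed} {y : Fin K × ℕ → Bool} {t : ℕ} {i : Fin K}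
    (h : A.next s (A.history s y t) = Sum.inl i) :
    A.history s y (t + 1)
      = A.history s y t ++ [(i, y (i, pullsOf (A.history s y t) i))] := by
  simp only [PullAlgorithm.history, h]

lemma history_succ_inr {s : A.Seed} {y : Fin K × ℕ → Bool} {t : ℕ} {B : Finset (Fin K)}
    (h : A.next s (A.history s y t) = Sum.inr B) :
    A.history s y (t + 1) = A.history s y t := by
  simp only [PullAlgorithm.history, h]

lemma history_add_of_inr {s : A.Seed} {y : Fin K × ℕ → Bool} {t : ℕ} {B : Finset (Fin K)}
    (h : A.next s (A.history s y t) = Sum.inr B) (k : ℕ) :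
    A.history s y (t + k) = A.history s y t := by
  induction k with
  | zero => rfl
  | succ k ih =>
    have h1 : A.next s (A.history s y (t + k)) = Sum.inr B := by rw [ih, h]
    rw [← add_assoc, history_succ_inr A h1, ih]

lemma returns_unique {s : A.Seed} {y : Fin K × ℕ → Bool} {B B' : Finset (Fin K)}
    (h : A.Returns s y B) (h' : A.Returns s y B') : B = B' := by
  have key : ∀ {B B' : Finset (Fin K)} {t t' : ℕ}, t ≤ t' →
      A.next s (A.history s y t) = Sum.inr B → A.next s (A.history s y t') = Sum.inr B' →
      B = B' := by
    intro B B' t t' htt h h'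
    obtain ⟨k, rfl⟩ := Nat.exists_eq_add_of_le htt
    rw [history_add_of_inr A h k, h] at h'
    exact Sum.inr.inj h'
  obtain ⟨t, ht⟩ := h
  obtain ⟨t', ht'⟩ := h'
  rcases le_total t t' with htt | htt
  · exact key htt ht ht'
  · exact (key htt ht' ht).symm

lemma pullsOf_append (h : List (Fin K × Bool)) (a : Fin K × Bool) (i : Fin K) :
    pullsOf (h ++ [a]) i = pullsOf h i + if a.1 = i then 1 else 0 := by
  simp [pullsOf, List.countP_append, List.countP_cons]

lemma length_eq_sum_pullsOf (h : List (Fin K × Bool)) : h.length = ∑ i, pullsOf h i := by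
  induction h with
  | nil => simp [pullsOf]
  | cons a h ih =>
    simp only [pullsOf, List.countP_cons, List.length_cons] at ih ⊢
    rw [Finset.sum_add_distrib, ← ih]
    simp

lemma pullsOf_history_mono (s : A.Seed) (y : Fin K × ℕ → Bool) (i : Fin K) :
    Monotone fun t => pullsOf (A.history s y t) i := by
  refine monotone_nat_of_le_succ fun t => ?_
  cases h : A.next s (A.history s y t) with
  | inl j => rw [history_succ_inl A h, pullsOf_append]; omega
  | inr B => rw [history_succ_inr A h]

/-- As long as arm `i` is not pulled, the run does not depend on its rewards. -/
lemma history_congr (s : A.Seed) {y y' : Fin K × ℕ → Bool} {i : Fin K}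
    (hy : ∀ a, a.1 ≠ i → y a = y' a) (t : ℕ) (h : pullsOf (A.history s y t) i = 0) :
    A.history s y' t = A.history s y t := by
  induction t with
  | zero => rfl
  | succ t ih =>
    have h0 : pullsOf (A.history s y t) i = 0 :=
      Nat.le_zero.1 (h ▸ pullsOf_history_mono A s y i (Nat.le_succ t))
    have ih' := ih h0
    cases hn : A.next s (A.history s y t) with
    | inl j =>
      have hji : j ≠ i := by
        rintro rfl
        rw [history_succ_inl A hn, pullsOf_append] at h
        simp at h
      rw [history_succ_inl A hn, history_succ_inl A (i := j) (by rw [ih', hn]), ih', hy _ hji]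
    | inr B => rw [history_succ_inr A hn, history_succ_inr A (B := B) (by rw [ih', hn]), ih']

lemma measurableSet_history (t : ℕ) (h : List (Fin K × Bool)) :
    MeasurableSet {ω : A.Seed × (Fin K × ℕ → Bool) | A.history ω.1 ω.2 t = h} := by
  induction t generalizing h with
  | zero => exact MeasurableSet.const ([] = h)
  | succ t ih =>
    have hset : {ω : A.Seed × (Fin K × ℕ → Bool) | A.history ω.1 ω.2 (t + 1) = h}
        = ⋃ h', ⋃ a, {ω | A.history ω.1 ω.2 t = h'} ∩ ({ω | A.next ω.1 h' = a} ∩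
          {ω | (match a with
            | Sum.inl i => h' ++ [(i, ω.2 (i, pullsOf h' i))]
            | Sum.inr _ => h') = h}) := by
      ext ω
      simp only [Set.mem_iUnion]
      constructor
      · intro hω
        refine ⟨_, _, rfl, rfl, ?_⟩
        exact hω
      · rintro ⟨h', a, h1, h2, h3⟩
        change A.history ω.1 ω.2 t = h' at h1
        change A.next ω.1 h' = a at h2
        subst h1 h2
        exact h3
    rw [hset]
    refine MeasurableSet.iUnion fun h' => MeasurableSet.iUnion fun a =>
      (ih h').inter (MeasurableSet.inter ?_ ?_)
    · exact (A.measurable_next h' a).preimage measurable_fst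
    · cases a with
      | inl i =>
        have hm : Measurable fun ω : A.Seed × (Fin K × ℕ → Bool) => ω.2 (i, pullsOf h' i) :=
          (measurable_pi_apply _).comp measurable_snd
        exact hm (MeasurableSet.of_discrete (s := {b | h' ++ [(i, b)] = h}))
      | inr B => exact MeasurableSet.const (h' = h)

lemma measurableSet_history_prop (t : ℕ) (Q : List (Fin K × Bool) → Prop) :
    MeasurableSet {ω : A.Seed × (Fin K × ℕ → Bool) | Q (A.history ω.1 ω.2 t)} := by
  have hset : {ω : A.Seed × (Fin K × ℕ → Bool) | Q (A.history ω.1 ω.2 t)}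
      = ⋃ h, {ω | A.history ω.1 ω.2 t = h} ∩ {_ω | Q h} := by
    ext ω
    simp only [Set.mem_iUnion]
    exact ⟨fun h => ⟨_, rfl, h⟩, fun ⟨h', h1, h2⟩ => by
      change A.history ω.1 ω.2 t = h' at h1
      subst h1; exact h2⟩
  rw [hset]
  exact MeasurableSet.iUnion fun h => (measurableSet_history A t h).inter (MeasurableSet.const _)

lemma measurableSet_returns (B : Finset (Fin K)) :
    MeasurableSet {ω : A.Seed × (Fin K × ℕ → Bool) | A.Returns ω.1 ω.2 B} := by
  have hset : {ω : A.Seed × (Fin K × ℕ → Bool) | A.Returns ω.1 ω.2 B}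
      = ⋃ t, ⋃ h, {ω | A.history ω.1 ω.2 t = h} ∩ {ω | A.next ω.1 h = Sum.inr B} := by
    ext ω
    simp only [Set.mem_iUnion]
    exact ⟨fun ⟨t, h⟩ => ⟨t, _, rfl, h⟩, fun ⟨t, h', h1, h2⟩ => ⟨t, by
      change A.history ω.1 ω.2 t = h' at h1
      subst h1; exact h2⟩⟩
  rw [hset]
  exact MeasurableSet.iUnion fun t => MeasurableSet.iUnion fun h =>
    (measurableSet_history A t h).inter ((A.measurable_next h _).preimage measurable_fst)

/-- Arm `i` is pulled at some time. -/
def PullAlgorithm.EverPulls (i : Fin K) : Set (A.Seed × (Fin K × ℕ → Bool)) :=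
  {ω | ∃ t, pullsOf (A.history ω.1 ω.2 t) i ≠ 0}

lemma measurableSet_everPulls (i : Fin K) : MeasurableSet (A.EverPulls i) := by
  have : A.EverPulls i = ⋃ t, {ω | pullsOf (A.history ω.1 ω.2 t) i ≠ 0} := by
    ext ω; simp only [Set.mem_iUnion]; rfl
  rw [this]
  exact MeasurableSet.iUnion fun t => measurableSet_history_prop A t fun h => pullsOf h i ≠ 0

lemma sum_indicator_everPulls_le (ω : A.Seed × (Fin K × ℕ → Bool)) :
    ∑ i, (A.EverPulls i).indicator 1 ω ≤ A.pulls ω.1 ω.2 := by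
  classical
  let D : Finset (Fin K) := {i | ω ∈ A.EverPulls i}
  have hD : ∀ i, ∃ t, i ∈ D → pullsOf (A.history ω.1 ω.2 t) i ≠ 0 := by
    intro i
    by_cases hi : i ∈ D
    · obtain ⟨t, ht⟩ := (Finset.mem_filter.1 hi).2
      exact ⟨t, fun _ => ht⟩
    · exact ⟨0, fun h => absurd h hi⟩
  choose T hT using hD
  let t := Finset.univ.sup T
  have h1 : D.card ≤ (A.history ω.1 ω.2 t).length := by
    rw [length_eq_sum_pullsOf, Finset.card_eq_sum_ones]
    refine (Finset.sum_le_sum fun i hi => ?_).trans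
      (Finset.sum_le_sum_of_subset (Finset.subset_univ D))
    have := pullsOf_history_mono A ω.1 ω.2 i (Finset.le_sup (f := T) (Finset.mem_univ i))
    have h2 := hT i hi
    exact (Nat.one_le_iff_ne_zero.2 h2).trans this
  have h3 : ∑ i, (A.EverPulls i).indicator (fun _ => (1 : ℝ≥0∞)) ω = (D.card : ℝ≥0∞) := by
    simp only [Set.indicator_apply, Finset.sum_ite, Finset.sum_const_zero, add_zero,
      Finset.sum_const, nsmul_eq_mul, mul_one]
    rfl
  refine h3.le.trans ?_
  exact le_trans (by exact_mod_cast h1) (le_iSup (fun t => ((A.history ω.1 ω.2 t).length : ℝ≥0∞)) t)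

instance (μ : Fin K → ℝ) : IsProbabilityMeasure (A.runLaw μ) := by
  unfold PullAlgorithm.runLaw; infer_instance

/-- The rewards with those of arm `i` erased. -/
def eraseArm (i : Fin K) (y : Fin K × ℕ → Bool) (a : Fin K × ℕ) : Bool :=
  if a.1 = i then false else y a

lemma measurable_eraseArm (i : Fin K) : Measurable (eraseArm i) := by
  refine measurable_pi_lambda _ fun a => ?_
  by_cases h : a.1 = i
  · simp only [eraseArm, if_pos h]; exact measurable_const
  · simp only [eraseArm, if_neg h]; exact measurable_pi_apply a

lemma map_eraseArm {i : Fin K} {μ μ' : Fin K → ℝ} (h : ∀ j, j ≠ i → μ j = μ' j) :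
    (rewardLaw μ).map (eraseArm i) = (rewardLaw μ').map (eraseArm i) := by
  have h1 : ∀ ν : Fin K → ℝ, (rewardLaw ν).map (eraseArm i) = Measure.infinitePi
      fun a : Fin K × ℕ => (ber (ν a.1)).map fun b => if a.1 = i then false else b := fun ν =>
    Measure.infinitePi_map_pi (fun a : Fin K × ℕ => ber (ν a.1))
      (f := fun a b => if a.1 = i then false else b) fun _ => Measurable.of_discrete
  rw [h1, h1]
  congr 1
  funext a
  by_cases ha : a.1 = i
  · simp only [if_pos ha, Measure.map_const, measure_univ]
  · rw [h _ ha]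

lemma returns_unpulled_eraseArm_iff (i : Fin K) (B : Finset (Fin K))
    (ω : A.Seed × (Fin K × ℕ → Bool)) :
    (A.Returns ω.1 (eraseArm i ω.2) B ∧ (ω.1, eraseArm i ω.2) ∉ A.EverPulls i)
      ↔ (A.Returns ω.1 ω.2 B ∧ ω ∉ A.EverPulls i) := by
  have hag : ∀ a : Fin K × ℕ, a.1 ≠ i → ω.2 a = eraseArm i ω.2 a := fun a ha => by
    simp [eraseArm, ha]
  have hag' : ∀ a : Fin K × ℕ, a.1 ≠ i → eraseArm i ω.2 a = ω.2 a := fun a ha => (hag a ha).symm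
  have key : ∀ {y y' : Fin K × ℕ → Bool}, (∀ a : Fin K × ℕ, a.1 ≠ i → y a = y' a) →
      A.Returns ω.1 y B ∧ (ω.1, y) ∉ A.EverPulls i →
      A.Returns ω.1 y' B ∧ (ω.1, y') ∉ A.EverPulls i := by
    rintro y y' hyy ⟨⟨t, ht⟩, h2⟩
    have h3 : ∀ t, A.history ω.1 y' t = A.history ω.1 y t := fun t => by
      refine history_congr A ω.1 hyy t ?_
      by_contra hc
      exact h2 ⟨t, hc⟩
    refine ⟨⟨t, by rw [h3, ht]⟩, ?_⟩
    rintro ⟨t', ht'⟩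
    exact h2 ⟨t', by simpa only [h3] using ht'⟩
  exact ⟨key hag', key hag⟩

lemma runLaw_returns_unpulled {i : Fin K} {μ μ' : Fin K → ℝ} (h : ∀ j, j ≠ i → μ j = μ' j)
    (B : Finset (Fin K)) :
    A.runLaw μ ({ω | A.Returns ω.1 ω.2 B} \ A.EverPulls i)
      = A.runLaw μ' ({ω | A.Returns ω.1 ω.2 B} \ A.EverPulls i) := by
  have hF : MeasurableSet ({ω : A.Seed × (Fin K × ℕ → Bool) | A.Returns ω.1 ω.2 B} \ A.EverPulls i) :=
    (measurableSet_returns A B).diff (measurableSet_everPulls A i)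
  have hpre : ({ω : A.Seed × (Fin K × ℕ → Bool) | A.Returns ω.1 ω.2 B} \ A.EverPulls i)
      = Prod.map id (eraseArm i) ⁻¹'
        ({ω | A.Returns ω.1 ω.2 B} \ A.EverPulls i) := by
    ext ω
    exact (returns_unpulled_eraseArm_iff A i B ω).symm
  have key : ∀ ν : Fin K → ℝ, A.runLaw ν ({ω | A.Returns ω.1 ω.2 B} \ A.EverPulls i)
      = (A.law.prod ((rewardLaw ν).map (eraseArm i)))
        ({ω | A.Returns ω.1 ω.2 B} \ A.EverPulls i) := by
    intro ν
    conv_lhs => rw [hpre]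
    rw [← Measure.map_apply (measurable_id.prodMap (measurable_eraseArm i)) hF,
      PullAlgorithm.runLaw, ← Measure.map_prod_map _ _ measurable_id (measurable_eraseArm i),
      Measure.map_id]
  rw [key, key, map_eraseArm h]

/-- A correct pull-only algorithm pulls every arm with probability at least `1 - 2δ`. -/
lemma runLaw_everPulls_ge {δ : ℝ} (hδ : 0 ≤ δ) (hA : A.IsCorrect (1 / 2) δ) {μ : Fin K → ℝ}
    (hμ : ∀ i, μ i ∈ Set.Icc (0 : ℝ) 1) (hne : ∀ i, μ i ≠ 1 / 2) (i : Fin K) :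
    ENNReal.ofReal (1 - 2 * δ) ≤ A.runLaw μ (A.EverPulls i) := by
  classical
  let μ' : Fin K → ℝ := Function.update μ i (1 - μ i)
  have hμ' : ∀ j, μ' j ∈ Set.Icc (0 : ℝ) 1 := fun j => by
    by_cases hj : j = i
    · subst hj
      simp only [μ', Function.update_self]
      exact ⟨by linarith [(hμ j).2], by linarith [(hμ j).1]⟩
    · simp only [μ', Function.update_of_ne hj]; exact hμ j
  have hne' : ∀ j, μ' j ≠ 1 / 2 := fun j => by
    by_cases hj : j = i
    · subst hj
      simp only [μ', Function.update_self]
      intro h; exact hne j (by linarith)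
    · simp only [μ', Function.update_of_ne hj]; exact hne j
  set S := positiveSet (1 / 2) μ with hS
  set S' := positiveSet (1 / 2) μ' with hS'
  have hSS : S ≠ S' := by
    intro h
    have h1 : i ∈ S ↔ i ∈ S' := by rw [h]
    simp only [hS, hS', positiveSet, Finset.mem_filter, Finset.mem_univ, true_and, μ',
      Function.update_self] at h1
    rcases lt_or_gt_of_ne (hne i) with h2 | h2
    · linarith [h1.2 (by linarith)]
    · linarith [h1.1 h2.le]
  have h1 := hA μ hμ hne
  have h2 := hA μ' hμ' hne'
  have h3 : A.runLaw μ' {ω | A.Returns ω.1 ω.2 S} ≤ ENNReal.ofReal δ := by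
    have hsub : {ω : A.Seed × (Fin K × ℕ → Bool) | A.Returns ω.1 ω.2 S}
        ⊆ {ω | A.Returns ω.1 ω.2 S'}ᶜ := fun ω hω hω' => hSS (returns_unique A hω hω')
    refine (measure_mono hsub).trans ?_
    rw [prob_compl_eq_one_sub (measurableSet_returns A S')]
    refine (tsub_le_tsub_left h2 1).trans ?_
    rw [tsub_le_iff_right, ← ENNReal.ofReal_one]
    refine le_trans (ENNReal.ofReal_le_ofReal (by linarith : (1 : ℝ) ≤ δ + (1 - δ))) ?_
    exact ENNReal.ofReal_add_le
  have h4 : A.runLaw μ {ω | A.Returns ω.1 ω.2 S}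
      ≤ A.runLaw μ ({ω | A.Returns ω.1 ω.2 S} \ A.EverPulls i) + A.runLaw μ (A.EverPulls i) := by
    refine (measure_mono ?_).trans (measure_union_le _ _)
    intro ω hω
    by_cases h : ω ∈ A.EverPulls i
    · exact Or.inr h
    · exact Or.inl ⟨hω, h⟩
  have h5 : A.runLaw μ ({ω | A.Returns ω.1 ω.2 S} \ A.EverPulls i) ≤ ENNReal.ofReal δ := by
    rw [runLaw_returns_unpulled A (μ' := μ') (fun j hj => (Function.update_of_ne hj _ _).symm) S]
    exact (measure_mono Set.sdiff_subset).trans h3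
  have h6 : ENNReal.ofReal (1 - δ) ≤ ENNReal.ofReal δ + A.runLaw μ (A.EverPulls i) :=
    (h1.trans h4).trans (add_le_add h5 le_rfl)
  rw [show 1 - 2 * δ = (1 - δ) - δ by ring, ENNReal.ofReal_sub _ hδ, tsub_le_iff_left]
  exact h6

/-- A correct pull-only algorithm makes at least `(1 - 2δ) K` pulls in expectation. -/
theorem lintegral_pulls_ge {δ : ℝ} (hδ : 0 ≤ δ) (hA : A.IsCorrect (1 / 2) δ) {μ : Fin K → ℝ}
    (hμ : ∀ i, μ i ∈ Set.Icc (0 : ℝ) 1) (hne : ∀ i, μ i ≠ 1 / 2) :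
    ENNReal.ofReal ((1 - 2 * δ) * K) ≤ ∫⁻ ω, A.pulls ω.1 ω.2 ∂(A.runLaw μ) := by
  calc ENNReal.ofReal ((1 - 2 * δ) * K) = ∑ _i : Fin K, ENNReal.ofReal (1 - 2 * δ) := by
        rw [Finset.sum_const, Finset.card_univ, Fintype.card_fin, nsmul_eq_mul, mul_comm,
          ENNReal.ofReal_mul (Nat.cast_nonneg K), ENNReal.ofReal_natCast]
    _ ≤ ∑ i : Fin K, A.runLaw μ (A.EverPulls i) :=
        Finset.sum_le_sum fun i _ => runLaw_everPulls_ge A hδ hA hμ hne i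
    _ = ∑ i : Fin K, ∫⁻ ω, (A.EverPulls i).indicator 1 ω ∂(A.runLaw μ) :=
        Finset.sum_congr rfl fun i _ => (lintegral_indicator_one (measurableSet_everPulls A i)).symm
    _ = ∫⁻ ω, ∑ i : Fin K, (A.EverPulls i).indicator 1 ω ∂(A.runLaw μ) :=
        (lintegral_finsetSum _ fun i _ =>
          measurable_one.indicator (measurableSet_everPulls A i)).symm
    _ ≤ _ := lintegral_mono fun ω => sum_indicator_everPulls_le A ω

end History


/-! ### CLUCB -/

lemma tsum_ofReal_inv_sq_le {c : ℝ} (hc : 0 ≤ c) {f : ℕ → ℝ≥0∞}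
    (hf : ∀ n : ℕ, f n ≤ ENNReal.ofReal (c / ((n : ℝ) + 1) ^ 2)) :
    ∑' n, f n ≤ ENNReal.ofReal (2 * c) := by
  refine ENNReal.tsum_le_of_sum_range_le fun N => ?_
  have key : ∀ N : ℕ, ∑ n ∈ Finset.range (N + 1), c / ((n : ℝ) + 1) ^ 2
      ≤ c * (2 - 1 / ((N : ℝ) + 1)) := by
    intro N
    induction N with
    | zero => norm_num
    | succ N ih =>
      rw [Finset.sum_range_succ]
      have h1 : 1 / ((N : ℝ) + 1 + 1) ^ 2 ≤ 1 / ((N : ℝ) + 1) - 1 / ((N : ℝ) + 1 + 1) := by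
        rw [div_sub_div _ _ (by positivity) (by positivity),
          div_le_div_iff₀ (by positivity) (by positivity)]
        nlinarith [(Nat.cast_nonneg N : (0 : ℝ) ≤ N)]
      have h2 : c / ((N : ℝ) + 1 + 1) ^ 2
          ≤ c * (1 / ((N : ℝ) + 1) - 1 / ((N : ℝ) + 1 + 1)) := by
        rw [div_eq_mul_one_div]
        exact mul_le_mul_of_nonneg_left h1 hc
      push_cast
      linarith
  calc ∑ n ∈ Finset.range N, f n ≤ ∑ n ∈ Finset.range (N + 1), f n :=
        Finset.sum_le_sum_of_subset (Finset.range_mono (Nat.le_succ N))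
    _ ≤ ∑ n ∈ Finset.range (N + 1), ENNReal.ofReal (c / ((n : ℝ) + 1) ^ 2) :=
        Finset.sum_le_sum fun n _ => hf n
    _ = ENNReal.ofReal (∑ n ∈ Finset.range (N + 1), c / ((n : ℝ) + 1) ^ 2) :=
        (ENNReal.ofReal_sum_of_nonneg fun n _ => by positivity).symm
    _ ≤ _ := by
        refine ENNReal.ofReal_le_ofReal ((key N).trans ?_)
        have : 0 ≤ 1 / ((N : ℝ) + 1) := by positivity
        nlinarith

lemma ofReal_one_sub_le_of_compl {Ω : Type*} {mΩ : MeasurableSpace Ω} {P : Measure Ω}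
    [IsProbabilityMeasure P] {S B : Set Ω} {δ : ℝ} (hδ : 0 ≤ δ) (h : Bᶜ ⊆ S)
    (hB : P B ≤ ENNReal.ofReal δ) : ENNReal.ofReal (1 - δ) ≤ P S := by
  rw [ENNReal.ofReal_sub _ hδ, tsub_le_iff_right, ENNReal.ofReal_one, ← measure_univ (μ := P)]
  calc P Set.univ ≤ P (S ∪ B) := measure_mono fun ω _ => by
        by_cases hω : ω ∈ B
        · exact Or.inr hω
        · exact Or.inl (h hω)
    _ ≤ P S + P B := measure_union_le _ _
    _ ≤ _ := by gcongr

lemma countP_true_history {K : ℕ} (A : PullAlgorithm K) (s : A.Seed) (y : Fin K × ℕ → Bool)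
    (t : ℕ) (i : Fin K) :
    ((A.history s y t).countP fun a => a = (i, true) : ℝ)
      = ∑ m ∈ Finset.range (pullsOf (A.history s y t) i), bit (y (i, m)) := by
  induction t with
  | zero => simp [PullAlgorithm.history, pullsOf]
  | succ t ih =>
    cases h : A.next s (A.history s y t) with
    | inl j =>
      rw [history_succ_inl A h, pullsOf_append, List.countP_append, Nat.cast_add, ih]
      by_cases hj : j = i
      · subst hj
        simp only [if_true, Finset.sum_range_succ]
        congr 1
        cases hb : y (j, pullsOf (A.history s y t) j) <;> simp [bit]
      · simp [hj]
    | inr B => rw [history_succ_inr A h, ih]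

lemma histMean_history {K : ℕ} (A : PullAlgorithm K) (s : A.Seed) (y : Fin K × ℕ → Bool)
    (t : ℕ) (i : Fin K) :
    histMean (A.history s y t) i = avg y i (pullsOf (A.history s y t) i) := by
  rw [histMean, avg, countP_true_history]

section CLUCB

variable {K : ℕ} {R δ : ℝ}

lemma clucb_next_init {h : List (Fin K × Bool)} (hK : h.length < K) :
    clucbNext R (1 / 2) δ h = Sum.inl ⟨h.length, hK⟩ := by
  simp [clucbNext, hK]

lemma clucb_next_inl {h : List (Fin K × Bool)} (hK : K ≤ h.length) {i : Fin K}
    (hi : clucbNext R (1 / 2) δ h = Sum.inl i) :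
    |histMean h i - 1 / 2| < clucbRadius R δ h i := by
  rw [clucbNext, dif_neg (not_lt.2 hK)] at hi
  split_ifs at hi with ha
  have hm := (Finset.exists_max_image _ (clucbRadius R δ h) ha).choose_spec.1
  rw [Sum.inl.inj hi] at hm
  exact (Finset.mem_filter.1 hm).2

lemma clucb_next_inr {h : List (Fin K × Bool)} {B : Finset (Fin K)}
    (hB : clucbNext R (1 / 2) δ h = Sum.inr B) :
    K ≤ h.length ∧ (∀ i, clucbRadius R δ h i ≤ |histMean h i - 1 / 2|) ∧
      B = Finset.univ.filter fun i => 1 / 2 ≤ histMean h i := by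
  rw [clucbNext] at hB
  split_ifs at hB with hK ha
  refine ⟨not_lt.1 hK, fun i => ?_, (Sum.inr.inj hB).symm⟩
  by_contra hc
  exact ha ⟨i, Finset.mem_filter.2 ⟨Finset.mem_univ i, not_le.1 hc⟩⟩

/-- The history of CLUCB after `t` steps. -/
noncomputable def clucbHist (K : ℕ) (R δ : ℝ) (y : Fin K × ℕ → Bool) (t : ℕ) :
    List (Fin K × Bool) := (clucb K R (1 / 2) δ).history () y t

/-- The running means of all arms stay within their confidence radii. -/
def ClucbGood (R δ : ℝ) (μ : Fin K → ℝ) (y : Fin K × ℕ → Bool) : Prop :=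
  ∀ i, ∀ n : ℕ, 1 ≤ n →
    |avg y i n - μ i| < R * √(2 * Real.log (4 * K * (n : ℝ) ^ 3 / δ) / n)

lemma clucbHist_init (y : Fin K × ℕ → Bool) {t : ℕ} (ht : t ≤ K) :
    (clucbHist K R δ y t).length = t ∧
      ∀ i : Fin K, pullsOf (clucbHist K R δ y t) i = if (i : ℕ) < t then 1 else 0 := by
  induction t with
  | zero => exact ⟨rfl, fun i => rfl⟩
  | succ t ih =>
    obtain ⟨h1, h2⟩ := ih (by omega)
    have hlt : (clucbHist K R δ y t).length < K := by omega
    have hn := clucb_next_init (R := R) (δ := δ) hlt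
    have hs := history_succ_inl (clucb K R (1 / 2) δ) (s := ()) (y := y) (t := t) hn
    change clucbHist K R δ y (t + 1) = clucbHist K R δ y t ++ _ at hs
    rw [hs]
    refine ⟨by simp [h1], fun i => ?_⟩
    rw [pullsOf_append, h2]
    have : ((⟨(clucbHist K R δ y t).length, hlt⟩ : Fin K) = i) ↔ (i : ℕ) = t := by
      rw [Fin.ext_iff]; simp only [h1]; exact eq_comm
    simp only [this]
    split_ifs <;> omega

variable {μ : Fin K → ℝ} {y : Fin K × ℕ → Bool}

lemma clucb_pullsOf_pos {t : ℕ} (ht : K ≤ t) (i : Fin K) :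
    1 ≤ pullsOf (clucbHist K R δ y t) i := by
  have h1 := (clucbHist_init (R := R) (δ := δ) y le_rfl).2 i
  rw [if_pos i.2] at h1
  exact h1.ge.trans (pullsOf_history_mono (clucb K R (1 / 2) δ) () y i ht)

lemma clucb_le_length {t : ℕ} (ht : K ≤ t) : K ≤ (clucbHist K R δ y t).length := by
  rw [length_eq_sum_pullsOf]
  calc K = ∑ _i : Fin K, 1 := by simp
    _ ≤ _ := Finset.sum_le_sum fun i _ => clucb_pullsOf_pos ht i

lemma pullsOf_le_length (h : List (Fin K × Bool)) (i : Fin K) : pullsOf h i ≤ h.length :=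
  List.countP_le_length

lemma clucb_dev_lt (hR : 1 / 2 ≤ R) (hδ : 0 < δ) (hK : 1 ≤ K)
    (hgood : ClucbGood R δ μ y) {t : ℕ} (ht : K ≤ t) (i : Fin K) :
    |histMean (clucbHist K R δ y t) i - μ i| < clucbRadius R δ (clucbHist K R δ y t) i := by
  have h1 := clucb_pullsOf_pos (R := R) (δ := δ) (y := y) ht i
  have hm : histMean (clucbHist K R δ y t) i = avg y i (pullsOf (clucbHist K R δ y t) i) :=
    histMean_history (clucb K R (1 / 2) δ) () y t i
  rw [hm]
  refine (hgood i _ h1).trans_le ?_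
  have h2 : ((pullsOf (clucbHist K R δ y t) i : ℕ) : ℝ) ≤ (clucbHist K R δ y t).length := by
    exact_mod_cast pullsOf_le_length _ i
  have h0 : (0 : ℝ) < (pullsOf (clucbHist K R δ y t) i : ℕ) := by exact_mod_cast h1
  have hK' : (0 : ℝ) < K := by exact_mod_cast hK
  rw [clucbRadius]
  gcongr

lemma clucb_returns_eq (hR : 1 / 2 ≤ R) (hδ : 0 < δ) (hK : 1 ≤ K)
    (hgood : ClucbGood R δ μ y) {t : ℕ} {B : Finset (Fin K)}
    (hB : clucbNext R (1 / 2) δ (clucbHist K R δ y t) = Sum.inr B) :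
    B = positiveSet (1 / 2) μ := by
  obtain ⟨h1, h2, rfl⟩ := clucb_next_inr hB
  have ht : K ≤ t := by
    by_contra hc
    have := (clucbHist_init (R := R) (δ := δ) y (not_le.1 hc).le).1
    omega
  ext i
  simp only [positiveSet, Finset.mem_filter, Finset.mem_univ, true_and]
  have h3 := clucb_dev_lt hR hδ hK hgood ht i
  have h4 := h3.trans_le (h2 i)
  rw [abs_lt] at h4
  constructor
  · intro h
    rw [abs_of_nonneg (by linarith)] at h4
    linarith [h4.2]
  · intro h
    by_contra hc
    rw [abs_of_neg (by linarith)] at h4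
    linarith [h4.1]

lemma clucb_pullsOf_le (hR : 1 / 2 ≤ R) (hδ : 0 < δ) (hδ1 : δ < 1) (hK : 1 ≤ K)
    (hgood : ClucbGood R δ μ y) (hgap : ∀ i, 1 / 4 ≤ |μ i - 1 / 2|) {t : ℕ} (ht : K ≤ t)
    (i : Fin K) :
    (pullsOf (clucbHist K R δ y t) i : ℝ)
      ≤ 128 * R ^ 2 * Real.log (4 * K * ((clucbHist K R δ y t).length : ℝ) ^ 3 / δ) + 1 := by
  have hK' : (1 : ℝ) ≤ K := by exact_mod_cast hK
  have hlog : ∀ t, K ≤ t →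
      0 ≤ Real.log (4 * K * ((clucbHist K R δ y t).length : ℝ) ^ 3 / δ) := by
    intro t ht
    refine Real.log_nonneg ?_
    rw [le_div_iff₀ hδ]
    have h1 : (1 : ℝ) ≤ (clucbHist K R δ y t).length := by
      exact_mod_cast hK.trans (clucb_le_length ht)
    have h2 : (1 : ℝ) ≤ ((clucbHist K R δ y t).length : ℝ) ^ 3 := one_le_pow₀ h1
    nlinarith
  induction t, ht using Nat.le_induction with
  | base =>
    have h1 := (clucbHist_init (R := R) (δ := δ) y le_rfl).2 i
    rw [if_pos i.2] at h1
    rw [h1]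
    have := hlog K le_rfl
    have : 0 ≤ 128 * R ^ 2 * Real.log (4 * K * ((clucbHist K R δ y K).length : ℝ) ^ 3 / δ) := by
      positivity
    push_cast; linarith
  | succ t ht ih =>
    have hlen := clucb_le_length (R := R) (δ := δ) (y := y) ht
    cases hn : clucbNext R (1 / 2) δ (clucbHist K R δ y t) with
    | inr B =>
      have hs : clucbHist K R δ y (t + 1) = clucbHist K R δ y t :=
        history_succ_inr (clucb K R (1 / 2) δ) (s := ()) (y := y) (t := t) hn
      rw [hs]; exact ih
    | inl j =>
      have hs : clucbHist K R δ y (t + 1) = clucbHist K R δ y t ++ _ :=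
        history_succ_inl (clucb K R (1 / 2) δ) (s := ()) (y := y) (t := t) hn
      set h := clucbHist K R δ y t with hh
      have hmono : Real.log (4 * K * (h.length : ℝ) ^ 3 / δ)
          ≤ Real.log (4 * K * ((clucbHist K R δ y (t + 1)).length : ℝ) ^ 3 / δ) := by
        have h0 : (0 : ℝ) < h.length := by exact_mod_cast hK.trans hlen
        have h1 : (h.length : ℝ) ≤ (clucbHist K R δ y (t + 1)).length := by
          rw [hs]; simp
        have : (0 : ℝ) < K := by linarith
        gcongr
      by_cases hij : j = i
      · subst hij
        have h1 := clucb_next_inl hlen hn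
        have h2 := clucb_dev_lt hR hδ hK hgood ht j
        have h3 : 1 / 8 < clucbRadius R δ h j := by
          have h4 := hgap j
          have h5 : |μ j - 1 / 2| ≤ |histMean h j - μ j| + |histMean h j - 1 / 2| := by
            rw [abs_sub_comm (histMean h j) (μ j)]
            exact abs_sub_le _ _ _
          linarith
        have hp : (0 : ℝ) < pullsOf h j := by
          exact_mod_cast clucb_pullsOf_pos (R := R) (δ := δ) (y := y) ht j
        have h6 : (1 / 8) ^ 2 < clucbRadius R δ h j ^ 2 := by gcongr
        rw [clucbRadius, mul_pow, Real.sq_sqrt (by have := hlog t ht; positivity), ← mul_div_assoc,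
          lt_div_iff₀ hp] at h6
        have h7 : (pullsOf h j : ℝ) < 128 * R ^ 2 * Real.log (4 * K * (h.length : ℝ) ^ 3 / δ) := by
          linarith
        have h8 : (pullsOf (clucbHist K R δ y (t + 1)) j : ℝ) = pullsOf h j + 1 := by
          rw [hs, pullsOf_append]; simp
        rw [h8]
        have : 128 * R ^ 2 * Real.log (4 * K * (h.length : ℝ) ^ 3 / δ) ≤ 128 * R ^ 2 *
            Real.log (4 * K * ((clucbHist K R δ y (t + 1)).length : ℝ) ^ 3 / δ) := by gcongr
        linarith
      · have h8 : (pullsOf (clucbHist K R δ y (t + 1)) i : ℝ) = pullsOf h i := by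
          rw [hs, pullsOf_append]; simp [hij]
        rw [h8]
        refine ih.trans ?_
        gcongr

/-- The constant in the sample complexity of CLUCB. -/
noncomputable def clucbConst (R δ : ℝ) : ℝ :=
  2 * (2 + 128 * R ^ 2 * (2 * Real.log (4 / δ) + 4)) + 2 * (768 * R ^ 2 * Real.log (768 * R ^ 2))

lemma clucb_solve (hR : 1 / 2 ≤ R) (hδ : 0 < δ) (hδ1 : δ < 1) (hK : 2 ≤ K) {n : ℕ} (hn : 1 ≤ n)
    (h : (n : ℝ) ≤ K * (128 * R ^ 2 * Real.log (4 * K * (n : ℝ) ^ 3 / δ) + 1)) :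
    (n : ℝ) ≤ clucbConst R δ * K * Real.log K := by
  have hK0 : (0 : ℝ) < K := by exact_mod_cast (by omega : 0 < K)
  have hn0 : (0 : ℝ) < n := by exact_mod_cast hn
  set z : ℝ := n / K with hz
  have hz0 : 0 < z := by positivity
  have hnz : (n : ℝ) = z * K := by rw [hz]; field_simp
  set m : ℝ := 768 * R ^ 2 with hm
  have hm0 : 192 ≤ m := by rw [hm]; nlinarith
  have hlogz : Real.log z ≤ z / m - 1 + Real.log m := by
    have h1 := Real.log_le_sub_one_of_pos (show 0 < z / m by positivity)
    rw [Real.log_div hz0.ne' (by linarith)] at h1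
    linarith
  have hlog2 : 1 / 2 ≤ Real.log K := by
    have h1 : Real.log 2 ≤ Real.log K := Real.log_le_log (by norm_num) (by exact_mod_cast hK)
    linarith [Real.log_two_gt_d9]
  have hlogm : 1 ≤ Real.log m := by
    rw [Real.le_log_iff_exp_le (by linarith)]
    linarith [Real.exp_one_lt_d9]
  have hlogδ : 0 ≤ Real.log (4 / δ) := Real.log_nonneg (by rw [le_div_iff₀ hδ]; linarith)
  have hexp : Real.log (4 * K * (n : ℝ) ^ 3 / δ)
      = Real.log (4 / δ) + 4 * Real.log K + 3 * Real.log z := by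
    rw [hnz, show 4 * K * (z * K) ^ 3 / δ = 4 / δ * (K : ℝ) ^ 4 * z ^ 3 by ring,
      Real.log_mul (by positivity) (by positivity), Real.log_mul (by positivity) (by positivity),
      Real.log_pow, Real.log_pow]
    push_cast; ring
  rw [hexp] at h
  have h2 : z ≤ 128 * R ^ 2 * (Real.log (4 / δ) + 4 * Real.log K + 3 * Real.log z) + 1 := by
    rw [hz, div_le_iff₀ hK0]; linarith
  have h3 : 128 * R ^ 2 * (3 * Real.log z) ≤ z / 2 + m / 2 * (Real.log m - 1) := by
    have h4 : 128 * R ^ 2 * (3 * Real.log z) = m / 2 * Real.log z := by rw [hm]; ring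
    rw [h4]
    have h5 : m / 2 * Real.log z ≤ m / 2 * (z / m - 1 + Real.log m) := by
      apply mul_le_mul_of_nonneg_left hlogz; linarith
    have h6 : m / 2 * (z / m - 1 + Real.log m) = z / 2 + m / 2 * (Real.log m - 1) := by
      field_simp; ring
    linarith
  have hR2 : 0 ≤ R ^ 2 := sq_nonneg R
  have h7 : z ≤ clucbConst R δ * Real.log K := by
    have e1 : 1 ≤ 2 * Real.log K := by linarith
    have e2 : 128 * R ^ 2 * Real.log (4 / δ) ≤ 128 * R ^ 2 * Real.log (4 / δ) * (2 * Real.log K) :=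
      le_mul_of_one_le_right (by positivity) e1
    have e3 : m / 2 * (Real.log m - 1) ≤ m / 2 * Real.log m * (2 * Real.log K) := by
      have : m / 2 * (Real.log m - 1) ≤ m / 2 * Real.log m := by
        apply mul_le_mul_of_nonneg_left <;> linarith
      exact this.trans (le_mul_of_one_le_right (by positivity) e1)
    have e4 : clucbConst R δ * Real.log K = 2 * (2 * Real.log K
        + 128 * R ^ 2 * Real.log (4 / δ) * (2 * Real.log K) + 128 * R ^ 2 * (4 * Real.log K)
        + m / 2 * Real.log m * (2 * Real.log K)) := by
      rw [clucbConst, ← hm]; ring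
    rw [e4]
    nlinarith
  rw [hnz]
  calc z * K ≤ clucbConst R δ * Real.log K * K := by gcongr
    _ = _ := by ring

theorem clucb_of_good (hR : 1 / 2 ≤ R) (hδ : 0 < δ) (hδ1 : δ < 1) (hK : 2 ≤ K)
    (hgood : ClucbGood R δ μ y) (hgap : ∀ i, 1 / 4 ≤ |μ i - 1 / 2|) :
    (clucb K R (1 / 2) δ).Returns () y (positiveSet (1 / 2) μ) ∧
      (clucb K R (1 / 2) δ).pulls () y ≤ ENNReal.ofReal (clucbConst R δ * K * Real.log K) := by
  have hK1 : 1 ≤ K := by omega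
  have hbound : ∀ t, K ≤ t →
      ((clucbHist K R δ y t).length : ℝ) ≤ clucbConst R δ * K * Real.log K := by
    intro t ht
    have hl := clucb_le_length (R := R) (δ := δ) (y := y) ht
    refine clucb_solve hR hδ hδ1 hK (hK1.trans hl) ?_
    calc ((clucbHist K R δ y t).length : ℝ)
        = ∑ i, (pullsOf (clucbHist K R δ y t) i : ℝ) := by
          rw [length_eq_sum_pullsOf]; push_cast; rfl
      _ ≤ ∑ _i : Fin K, (128 * R ^ 2 *
            Real.log (4 * K * ((clucbHist K R δ y t).length : ℝ) ^ 3 / δ) + 1) :=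
          Finset.sum_le_sum fun i _ => clucb_pullsOf_le hR hδ hδ1 hK1 hgood hgap ht i
      _ = _ := by simp; ring
  constructor
  · by_contra hc
    have hlen : ∀ t, (clucbHist K R δ y t).length = t := by
      intro t
      induction t with
      | zero => rfl
      | succ t ih =>
        cases hn : clucbNext R (1 / 2) δ (clucbHist K R δ y t) with
        | inr B =>
          exact absurd ⟨t, hn.trans (by rw [clucb_returns_eq hR hδ hK1 hgood hn])⟩ hc
        | inl j =>
          have hs : clucbHist K R δ y (t + 1) = clucbHist K R δ y t ++ _ :=
            history_succ_inl (clucb K R (1 / 2) δ) (s := ()) (y := y) (t := t) hn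
          rw [hs]; simp [ih]
    obtain ⟨N, hN⟩ := exists_nat_gt (clucbConst R δ * K * Real.log K)
    have := hbound (max K N) (le_max_left _ _)
    rw [hlen] at this
    have h2 : (N : ℝ) ≤ (max K N : ℕ) := by exact_mod_cast le_max_right _ _
    linarith
  · refine iSup_le fun t => ?_
    rw [← ENNReal.ofReal_natCast]
    refine ENNReal.ofReal_le_ofReal ?_
    rcases le_total K t with ht | ht
    · exact hbound t ht
    · refine le_trans ?_ (hbound K le_rfl)
      have h1 := (clucbHist_init (R := R) (δ := δ) y ht).1
      have h2 := (clucbHist_init (R := R) (δ := δ) y le_rfl).1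
      rw [clucbHist] at h1
      rw [h1, h2]
      exact_mod_cast ht

lemma rewardLaw_not_clucbGood (hR : 1 / 2 ≤ R) (hδ : 0 < δ) (hδ1 : δ < 1) (hK : 1 ≤ K)
    (hμ : ∀ i, μ i ∈ Set.Icc (0 : ℝ) 1) :
    rewardLaw μ {y | ¬ ClucbGood R δ μ y} ≤ ENNReal.ofReal δ := by
  have hK' : (1 : ℝ) ≤ K := by exact_mod_cast hK
  let rad : ℕ → ℝ := fun n => R * √(2 * Real.log (4 * K * ((n + 1 : ℕ) : ℝ) ^ 3 / δ) / (n + 1 : ℕ))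
  let Bc : Fin K → ℕ → ℝ → Set (Fin K × ℕ → Bool) := fun i n c =>
    {y | ∃ m : ℕ, 1 ≤ m ∧ ((n + 1 : ℕ) : ℝ) ≤ m ∧ rad n ≤ c * (avg y i m - μ i)}
  have hsub : {y | ¬ ClucbGood R δ μ y} ⊆ ⋃ i, ⋃ n, (Bc i n 1 ∪ Bc i n (-1)) := by
    intro y hy
    have hy' : ¬ ClucbGood R δ μ y := hy
    simp only [ClucbGood, not_forall, not_lt] at hy'
    obtain ⟨i, n, hn, h⟩ := hy'
    refine Set.mem_iUnion.2 ⟨i, Set.mem_iUnion.2 ⟨n - 1, ?_⟩⟩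
    have hn1 : n - 1 + 1 = n := by omega
    have hr : rad (n - 1) ≤ |avg y i n - μ i| := by simp only [rad, hn1]; exact h
    have hnn : ((n - 1 + 1 : ℕ) : ℝ) ≤ n := by rw [hn1]
    rcases le_total 0 (avg y i n - μ i) with h0 | h0
    · rw [abs_of_nonneg h0] at hr
      exact Or.inl ⟨n, hn, hnn, by linarith⟩
    · rw [abs_of_nonpos h0] at hr
      exact Or.inr ⟨n, hn, hnn, by linarith⟩
  have hone : ∀ i n c, c ^ 2 = (1 : ℝ) →
      rewardLaw μ (Bc i n c) ≤ ENNReal.ofReal (δ / (4 * K) / ((n : ℝ) + 1) ^ 2) := by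
    intro i n c hc
    refine (rewardLaw_exists_dev_le μ i (hμ i) hc (by positivity)).trans ?_
    refine ENNReal.ofReal_le_ofReal ?_
    have hn1 : (1 : ℝ) ≤ ((n + 1 : ℕ) : ℝ) := by push_cast; linarith [(Nat.cast_nonneg n : (0:ℝ) ≤ n)]
    have hn3 : (1 : ℝ) ≤ ((n + 1 : ℕ) : ℝ) ^ 3 := one_le_pow₀ hn1
    have hA : 1 ≤ 4 * K * ((n + 1 : ℕ) : ℝ) ^ 3 / δ := by
      rw [le_div_iff₀ hδ]; nlinarith
    have hl := Real.log_nonneg hA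
    have h1 : 2 * ((n + 1 : ℕ) : ℝ) * rad n ^ 2
        = 4 * R ^ 2 * Real.log (4 * K * ((n + 1 : ℕ) : ℝ) ^ 3 / δ) := by
      simp only [rad]
      rw [mul_pow, Real.sq_sqrt (by positivity)]
      field_simp; ring
    have h2 : Real.log (4 * K * ((n + 1 : ℕ) : ℝ) ^ 3 / δ) ≤ 2 * ((n + 1 : ℕ) : ℝ) * rad n ^ 2 := by
      rw [h1]
      have : 1 ≤ 4 * R ^ 2 := by nlinarith
      nlinarith
    calc Real.exp (-(2 * ((n + 1 : ℕ) : ℝ) * rad n ^ 2))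
        ≤ Real.exp (-Real.log (4 * K * ((n + 1 : ℕ) : ℝ) ^ 3 / δ)) := by gcongr
      _ = δ / (4 * K) / ((n + 1 : ℕ) : ℝ) ^ 3 := by
          rw [Real.exp_neg, Real.exp_log (by linarith)]; field_simp
      _ ≤ δ / (4 * K) / ((n : ℝ) + 1) ^ 2 := by
          have : ((n : ℝ) + 1) ^ 2 ≤ ((n + 1 : ℕ) : ℝ) ^ 3 := by
            push_cast
            push_cast at hn1
            exact pow_le_pow_right₀ hn1 (by norm_num)
          gcongr
  refine (measure_mono hsub).trans ((measure_iUnion_fintype_le _ _).trans ?_)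
  calc ∑ i : Fin K, rewardLaw μ (⋃ n, (Bc i n 1 ∪ Bc i n (-1)))
      ≤ ∑ _i : Fin K, ENNReal.ofReal (2 * (δ / (2 * K))) := by
        refine Finset.sum_le_sum fun i _ => (measure_iUnion_le _).trans ?_
        refine tsum_ofReal_inv_sq_le (by positivity) fun n => ?_
        refine (measure_union_le _ _).trans ?_
        refine (add_le_add (hone i n 1 (by norm_num)) (hone i n (-1) (by norm_num))).trans ?_
        rw [← ENNReal.ofReal_add (by positivity) (by positivity)]
        refine ENNReal.ofReal_le_ofReal (le_of_eq ?_)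
        field_simp; ring
    _ = ENNReal.ofReal δ := by
        rw [Finset.sum_const, Finset.card_univ, Fintype.card_fin, nsmul_eq_mul,
          ← ENNReal.ofReal_natCast, ← ENNReal.ofReal_mul (by positivity)]
        congr 1; field_simp

/-- CLUCB is correct and needs order `K log K` pulls if all gaps are at least `1 / 4`. -/
theorem clucb_spec (hR : 1 / 2 ≤ R) (hδ : 0 < δ) (hδ1 : δ < 1) (hK : 2 ≤ K)
    (hμ : ∀ i, μ i ∈ Set.Icc (0 : ℝ) 1) (hgap : ∀ i, 1 / 4 ≤ |μ i - 1 / 2|) :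
    ENNReal.ofReal (1 - δ) ≤ (clucb K R (1 / 2) δ).runLaw μ
      {ω | (clucb K R (1 / 2) δ).Returns ω.1 ω.2 (positiveSet (1 / 2) μ) ∧
        (clucb K R (1 / 2) δ).pulls ω.1 ω.2
          ≤ ENNReal.ofReal (clucbConst R δ * K * Real.log K)} := by
  have hsub : (Set.univ ×ˢ {y | ¬ ClucbGood R δ μ y})ᶜ ⊆
      {ω : (clucb K R (1 / 2) δ).Seed × (Fin K × ℕ → Bool) |
        (clucb K R (1 / 2) δ).Returns ω.1 ω.2 (positiveSet (1 / 2) μ) ∧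
        (clucb K R (1 / 2) δ).pulls ω.1 ω.2
          ≤ ENNReal.ofReal (clucbConst R δ * K * Real.log K)} := by
    rintro ⟨s, y⟩ h
    have hy : ClucbGood R δ μ y := by
      by_contra hc
      exact h ⟨trivial, hc⟩
    exact clucb_of_good hR hδ hδ1 hK hy hgap
  refine ofReal_one_sub_le_of_compl hδ.le hsub ?_
  rw [PullAlgorithm.runLaw, Measure.prod_prod, measure_univ, one_mul]
  exact rewardLaw_not_clucbGood hR hδ hδ1 (by omega) hμ

end CLUCB


/-! ### Figure-Out-Label -/

/-- A bound for the number of pulls of Figure-Out-Label on an arm with gap at least `1 / 4`. -/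
noncomputable def folBound (R δ₁ : ℝ) : ℝ :=
  3 * ((2 ^ 20 * R ^ 4 + 256 * R ^ 2 + 128) * Real.log (40 / δ₁))

/-- Figure-Out-Label finds the label of arm `i` with few pulls. -/
def FolOK {K : ℕ} (R δ₁ : ℝ) (μ : Fin K → ℝ) (i : Fin K) (y : Fin K × ℕ → Bool) : Prop :=
  ∃ n : ℕ, figureOutLabel R (1 / 2) δ₁ (fun m => y (i, m)) = some (decide (1 / 2 ≤ μ i), n) ∧
    (n : ℝ) ≤ folBound R δ₁

section FOL

variable {K : ℕ} {R δ₁ : ℝ}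

lemma folMean_eq_avg (y : Fin K × ℕ → Bool) (i : Fin K) (t : ℕ) :
    folMean (fun m => y (i, m)) t = avg y i (folCount t) := rfl

lemma exists_fol_end (hR : 1 / 2 ≤ R) (hδ : 0 < δ₁) (hδ1 : δ₁ ≤ 3 / 10) :
    ∃ s : ℕ, folRadius R δ₁ s ≤ 1 / 8 ∧ (folCount s : ℝ) ≤ folBound R δ₁ ∧
      32 * Real.log (40 / δ₁) ≤ folCount s := by
  set Lg := Real.log (40 / δ₁) with hLg
  have hL1 : 1 ≤ Lg := by
    rw [hLg, Real.le_log_iff_exp_le (by positivity), le_div_iff₀ hδ]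
    nlinarith [Real.exp_one_lt_d9]
  set V := (2 ^ 20 * R ^ 4 + 256 * R ^ 2 + 128) * Lg with hV
  have hR4 : 0 ≤ R ^ 4 := by positivity
  have hR2 : 0 ≤ R ^ 2 := by positivity
  have hV1 : 2 ^ 20 * R ^ 4 ≤ V := by rw [hV]; nlinarith
  have hV2 : 256 * R ^ 2 * Lg ≤ V := by
    rw [hV]
    have : 256 * R ^ 2 ≤ 2 ^ 20 * R ^ 4 + 256 * R ^ 2 + 128 := by nlinarith
    exact mul_le_mul_of_nonneg_right this (by linarith)
  have hV3 : 128 * Lg ≤ V := by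
    rw [hV]
    have : 128 ≤ 2 ^ 20 * R ^ 4 + 256 * R ^ 2 + 128 := by nlinarith
    exact mul_le_mul_of_nonneg_right this (by linarith)
  obtain ⟨n, hn1, hn2⟩ := exists_nat_pow_near (by linarith : 1 ≤ V) (by norm_num : (1 : ℝ) < 2)
  set u : ℝ := 2 ^ (n + 1) with hu
  have hu2 : u ≤ 2 * V := by rw [hu, pow_succ]; linarith
  have hcnt : (folCount (n + 1) : ℝ) = u + 1 := by rw [folCount, hu]; push_cast; ring
  refine ⟨n + 1, ?_, ?_, ?_⟩
  · have hu0 : 0 < u := by positivity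
    have hlog : Real.log (4 * (((n + 1 : ℕ) : ℝ) + 1) ^ 2 / δ₁) ≤ Lg + 4 * √u := by
      have hs : (((n + 1 : ℕ) : ℝ) + 1) ≤ u := by
        have h := Nat.lt_two_pow_self (n := n + 1)
        have h' : (n + 1 + 1 : ℕ) ≤ 2 ^ (n + 1) := h
        rw [hu]; exact_mod_cast h'
      have hp : 0 < ((n + 1 : ℕ) : ℝ) + 1 := by positivity
      have h1 : Real.log (((n + 1 : ℕ) : ℝ) + 1) ≤ 2 * √u := by
        have h2 := Real.log_le_sub_one_of_pos (Real.sqrt_pos.2 hp)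
        rw [Real.log_sqrt hp.le] at h2
        have h3 := Real.sqrt_le_sqrt hs
        linarith
      rw [show 4 * (((n + 1 : ℕ) : ℝ) + 1) ^ 2 / δ₁ = 4 / δ₁ * (((n + 1 : ℕ) : ℝ) + 1) ^ 2 by ring,
        Real.log_mul (by positivity) (by positivity), Real.log_pow]
      have h4 : Real.log (4 / δ₁) ≤ Lg := Real.log_le_log (by positivity) (by gcongr; norm_num)
      push_cast at h1 ⊢
      linarith
    have hsq : √u * √u = u := Real.mul_self_sqrt hu0.le
    have hsu : 1024 * R ^ 2 ≤ √u := by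
      refine Real.le_sqrt_of_sq_le ?_
      nlinarith
    have hkey : 128 * R ^ 2 * Real.log (4 * (((n + 1 : ℕ) : ℝ) + 1) ^ 2 / δ₁) ≤ u := by
      have h1 : 128 * R ^ 2 * Real.log (4 * (((n + 1 : ℕ) : ℝ) + 1) ^ 2 / δ₁)
          ≤ 128 * R ^ 2 * (Lg + 4 * √u) := by gcongr
      have h2 : 1024 * R ^ 2 * √u ≤ √u * √u := by gcongr
      nlinarith
    rw [folRadius, hcnt]
    have h1 : R * √(2 * Real.log (4 * (((n + 1 : ℕ) : ℝ) + 1) ^ 2 / δ₁) / (u + 1))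
        ≤ R * √((1 / (8 * R)) ^ 2) := by
      have hR0 : 0 < R := by linarith
      gcongr
      rw [div_le_iff₀ (by positivity)]
      have h3 : (1 / (8 * R)) ^ 2 * (u + 1) = (u + 1) / (64 * R ^ 2) := by ring
      rw [h3, le_div_iff₀ (by positivity)]
      linarith
    refine h1.trans (le_of_eq ?_)
    have hR0 : 0 < R := by linarith
    rw [Real.sqrt_sq (by positivity)]
    field_simp
  · rw [hcnt, folBound]; linarith
  · rw [hcnt]; linarith

lemma fol_wrong_prob (hR : 1 / 2 ≤ R) (hδ : 0 < δ₁) (hδ1 : δ₁ ≤ 3 / 10) (s : ℕ) :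
    Real.exp (-(2 * (folCount s : ℝ) * (1 / 4 + folRadius R δ₁ s) ^ 2))
      ≤ δ₁ / 20 / ((s : ℝ) + 1) ^ 2 := by
  set l := Real.log (4 * ((s : ℝ) + 1) ^ 2 / δ₁) with hl
  set N : ℝ := (folCount s : ℝ) with hN
  have hN2 : 2 ≤ N := by
    rw [hN, folCount]; push_cast
    have : (1 : ℝ) ≤ 2 ^ s := one_le_pow₀ (by norm_num)
    linarith
  have hs1 : (1 : ℝ) ≤ ((s : ℝ) + 1) ^ 2 := one_le_pow₀ (by linarith [(Nat.cast_nonneg s : (0:ℝ) ≤ s)])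
  have hl94 : 9 / 4 ≤ l := by
    rw [hl, Real.le_log_iff_exp_le (by positivity)]
    have h1 : Real.exp (9 / 4) ≤ 40 / 3 := by
      have h2 : Real.exp (9 / 4) ^ 4 = Real.exp 1 ^ 9 := by
        rw [← Real.exp_nat_mul, ← Real.exp_nat_mul]; norm_num
      have h3 : Real.exp 1 ^ 9 ≤ (2.7182818286 : ℝ) ^ 9 := by
        gcongr; exact Real.exp_one_lt_d9.le
      refine le_of_pow_le_pow_left₀ (n := 4) (by norm_num) (by norm_num) ?_
      rw [h2]
      exact h3.trans (by norm_num)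
    refine h1.trans ?_
    rw [le_div_iff₀ hδ]
    nlinarith
  have hrad : folRadius R δ₁ s = R * √(2 * l / N) := rfl
  have hsq : √(2 * l / N) ^ 2 = 2 * l / N := Real.sq_sqrt (by positivity)
  have hr2 : N * (R * √(2 * l / N)) ^ 2 = 2 * R ^ 2 * l := by
    rw [mul_pow, hsq]; field_simp
  have hr1 : 3 / 2 ≤ N * (R * √(2 * l / N)) := by
    have h1 : 3 / N ≤ √(2 * l / N) := by
      refine Real.le_sqrt_of_sq_le ?_
      rw [div_pow, div_le_div_iff₀ (by positivity) (by positivity)]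
      nlinarith
    have h2 : N * (1 / 2 * (3 / N)) ≤ N * (R * √(2 * l / N)) := by gcongr
    have h3 : N * (1 / 2 * (3 / N)) = 3 / 2 := by field_simp
    linarith
  have hR4 : l ≤ 4 * R ^ 2 * l := by
    have : 1 ≤ 4 * R ^ 2 := by nlinarith
    exact le_mul_of_one_le_left (by linarith) this
  have hexp : l + 7 / 4 ≤ 2 * N * (1 / 4 + folRadius R δ₁ s) ^ 2 := by
    rw [hrad]
    have : 2 * N * (1 / 4 + R * √(2 * l / N)) ^ 2
        = N / 8 + N * (R * √(2 * l / N)) + 2 * (N * (R * √(2 * l / N)) ^ 2) := by ring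
    rw [this, hr2]
    linarith
  have h5 : (5 : ℝ) ≤ Real.exp (7 / 4) := by
    have := Real.sum_le_exp_of_nonneg (show (0 : ℝ) ≤ 7 / 4 by norm_num) 4
    refine le_trans ?_ this
    norm_num [Finset.sum_range_succ, Nat.factorial]
  calc Real.exp (-(2 * N * (1 / 4 + folRadius R δ₁ s) ^ 2))
      ≤ Real.exp (-(l + 7 / 4)) := by gcongr
    _ = δ₁ / (4 * ((s : ℝ) + 1) ^ 2) * (Real.exp (7 / 4))⁻¹ := by
        rw [neg_add, Real.exp_add, Real.exp_neg, Real.exp_neg, hl, Real.exp_log (by positivity),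
          inv_div]
    _ ≤ δ₁ / (4 * ((s : ℝ) + 1) ^ 2) * 5⁻¹ := by gcongr
    _ = δ₁ / 20 / ((s : ℝ) + 1) ^ 2 := by field_simp; norm_num

lemma folOK_of_dev {μ : Fin K → ℝ} {i : Fin K} (hgap : 1 / 4 ≤ |μ i - 1 / 2|) {c : ℝ}
    (hc : c = if 1 / 2 ≤ μ i then -1 else 1) {y : Fin K × ℕ → Bool} {s : ℕ}
    (hs : folRadius R δ₁ s ≤ 1 / 8) (hsB : (folCount s : ℝ) ≤ folBound R δ₁)
    (hR : 0 ≤ R)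
    (h1 : ∀ t, c * (avg y i (folCount t) - μ i) < 1 / 4 + folRadius R δ₁ t)
    (h2 : c * (avg y i (folCount s) - μ i) < 1 / 8) : FolOK R δ₁ μ i y := by
  have hsep : folRadius R δ₁ s < |folMean (fun m => y (i, m)) s - 1 / 2| := by
    rw [folMean_eq_avg]
    refine hs.trans_lt ?_
    by_cases hμ : 1 / 2 ≤ μ i
    · rw [if_pos hμ] at hc
      rw [abs_of_nonneg (by linarith)] at hgap
      rw [hc] at h2
      exact lt_of_lt_of_le (by linarith) (le_abs_self _)
    · rw [if_neg hμ] at hc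
      rw [abs_of_neg (by linarith)] at hgap
      rw [hc] at h2
      exact lt_of_lt_of_le (by linarith) (neg_le_abs _)
  have hex : ∃ t, folRadius R δ₁ t < |folMean (fun m => y (i, m)) t - 1 / 2| := ⟨s, hsep⟩
  classical
  have hfind : figureOutLabel R (1 / 2) δ₁ (fun m => y (i, m))
      = some (decide (1 / 2 < folMean (fun m => y (i, m)) (Nat.find hex)),
          folCount (Nat.find hex)) := by
    rw [figureOutLabel, dif_pos hex]
  refine ⟨folCount (Nat.find hex), ?_, ?_⟩
  · rw [hfind]
    congr 2
    rw [decide_eq_decide]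
    have h3 := Nat.find_spec hex
    have h4 := h1 (Nat.find hex)
    have h5 : 0 ≤ folRadius R δ₁ (Nat.find hex) := mul_nonneg hR (Real.sqrt_nonneg _)
    rw [folMean_eq_avg] at h3 ⊢
    by_cases hμ : 1 / 2 ≤ μ i
    · rw [if_pos hμ] at hc
      rw [abs_of_nonneg (by linarith)] at hgap
      rw [hc] at h4
      simp only [hμ, iff_true]
      by_contra hle
      rw [abs_of_nonpos (by linarith)] at h3
      linarith
    · rw [if_neg hμ] at hc
      rw [abs_of_neg (by linarith)] at hgap
      rw [hc] at h4
      simp only [hμ, iff_false]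
      intro hlt
      rw [abs_of_pos (by linarith)] at h3
      linarith
  · have h3 : Nat.find hex ≤ s := Nat.find_min' hex hsep
    refine le_trans ?_ hsB
    have : folCount (Nat.find hex) ≤ folCount s := by
      unfold folCount
      have := Nat.pow_le_pow_right (n := 2) (by norm_num) h3
      omega
    exact_mod_cast this

theorem rewardLaw_not_folOK (hR : 1 / 2 ≤ R) (hδ : 0 < δ₁) (hδ1 : δ₁ ≤ 3 / 10) {μ : Fin K → ℝ}
    {i : Fin K} (hμ : μ i ∈ Set.Icc (0 : ℝ) 1) (hgap : 1 / 4 ≤ |μ i - 1 / 2|) :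
    rewardLaw μ {y | ¬ FolOK R δ₁ μ i y} ≤ ENNReal.ofReal (δ₁ / 8) := by
  obtain ⟨s, hs, hsB, hs32⟩ := exists_fol_end hR hδ hδ1
  set c : ℝ := if 1 / 2 ≤ μ i then -1 else 1 with hc
  have hc2 : c ^ 2 = 1 := by rw [hc]; split_ifs <;> norm_num
  have hcount : ∀ t, 1 ≤ folCount t := fun t => Nat.le_add_left _ _
  let W : ℕ → Set (Fin K × ℕ → Bool) := fun t => {y | ∃ n : ℕ, 1 ≤ n ∧ (folCount t : ℝ) ≤ n ∧
    1 / 4 + folRadius R δ₁ t ≤ c * (avg y i n - μ i)}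
  let V : Set (Fin K × ℕ → Bool) := {y | ∃ n : ℕ, 1 ≤ n ∧ (folCount s : ℝ) ≤ n ∧
    1 / 8 ≤ c * (avg y i n - μ i)}
  have hsub : {y | ¬ FolOK R δ₁ μ i y} ⊆ (⋃ t, W t) ∪ V := by
    intro y hy
    by_contra hcon
    simp only [Set.mem_union, Set.mem_iUnion, not_or, not_exists] at hcon
    refine hy (folOK_of_dev hgap hc hs hsB (by linarith) (fun t => ?_) ?_)
    · by_contra h
      exact hcon.1 t ⟨folCount t, hcount t, le_rfl, not_lt.1 h⟩
    · by_contra h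
      exact hcon.2 ⟨folCount s, hcount s, le_rfl, not_lt.1 h⟩
  refine (measure_mono hsub).trans ((measure_union_le _ _).trans ?_)
  have h1 : rewardLaw μ (⋃ t, W t) ≤ ENNReal.ofReal (2 * (δ₁ / 20)) := by
    refine (measure_iUnion_le _).trans (tsum_ofReal_inv_sq_le (by positivity) fun t => ?_)
    refine (rewardLaw_exists_dev_le μ i hμ hc2 ?_).trans
      (ENNReal.ofReal_le_ofReal (fol_wrong_prob hR hδ hδ1 t))
    have : 0 ≤ folRadius R δ₁ t := mul_nonneg (by linarith) (Real.sqrt_nonneg _)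
    linarith
  have h2 : rewardLaw μ V ≤ ENNReal.ofReal (δ₁ / 40) := by
    refine (rewardLaw_exists_dev_le μ i hμ hc2 (by norm_num)).trans (ENNReal.ofReal_le_ofReal ?_)
    calc Real.exp (-(2 * (folCount s : ℝ) * (1 / 8) ^ 2)) ≤ Real.exp (-Real.log (40 / δ₁)) := by
          gcongr; linarith
      _ = δ₁ / 40 := by rw [Real.exp_neg, Real.exp_log (by positivity), inv_div]
  refine (add_le_add h1 h2).trans ?_
  rw [← ENNReal.ofReal_add (by positivity) (by positivity)]
  exact ENNReal.ofReal_le_ofReal (by linarith)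

end FOL


/-! ### Binary search with true labels -/

section BinarySearch

variable {K : ℕ}

lemma binarySearch_truth_spec (truth : Fin K → Bool) (seq : List (Fin K)) :
    ∀ d lo hi : ℕ, hi - lo = d → lo ≤ hi → hi ≤ seq.length →
    ∃ b T, binarySearch (fun i => some (truth i, 0)) seq lo hi = some (b, T, 0) ∧ lo ≤ b ∧ b ≤ hi ∧
      (b = lo ∨ ∃ i, seq[b - 1]? = some i ∧ (i, false) ∈ T) ∧
      (b = hi ∨ ∃ i, seq[b]? = some i ∧ (i, true) ∈ T) ∧
      (∀ a ∈ T, a.2 = truth a.1 ∧ a.1 ∈ seq) ∧ 2 ^ T.length ≤ max 1 (2 * (hi - lo)) ∧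
      (lo < hi → T ≠ []) := by
  intro d
  induction d using Nat.strong_induction_on with
  | _ d ih =>
    intro lo hi hd hle hlen
    rw [binarySearch]
    by_cases hlt : lo < hi
    · rw [if_pos hlt]
      set mid := (lo + hi + 1) / 2 with hmid
      have hm : mid - 1 < seq.length := by omega
      obtain ⟨i, hi'⟩ : ∃ i, seq[mid - 1]? = some i := ⟨_, List.getElem?_eq_getElem hm⟩
      have hmem : i ∈ seq := List.mem_of_getElem? hi'
      simp only [hi']
      cases hy : truth i with
      | true =>
        obtain ⟨b, T, h1, h2, h3, h4, h5, h6, h7, h8⟩ :=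
          ih (mid - 1 - lo) (by omega) lo (mid - 1) rfl (by omega) (by omega)
        refine ⟨b, (i, true) :: T, by simp [h1], h2, by omega, ?_, ?_, ?_, ?_, by simp⟩
        · exact h4.imp_right fun ⟨j, hj, hjT⟩ => ⟨j, hj, List.mem_cons_of_mem _ hjT⟩
        · right
          rcases h5 with rfl | ⟨j, hj, hjT⟩
          · exact ⟨i, hi', List.mem_cons_self⟩
          · exact ⟨j, hj, List.mem_cons_of_mem _ hjT⟩
        · intro a ha
          rcases List.mem_cons.1 ha with rfl | ha
          · exact ⟨hy.symm, hmem⟩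
          · exact h6 a ha
        · rw [List.length_cons, pow_succ]
          omega
      | false =>
        obtain ⟨b, T, h1, h2, h3, h4, h5, h6, h7, h8⟩ :=
          ih (hi - mid) (by omega) mid hi rfl (by omega) (by omega)
        refine ⟨b, (i, false) :: T, by simp [h1], by omega, h3, ?_, ?_, ?_, ?_, by simp⟩
        · right
          rcases h4 with rfl | ⟨j, hj, hjT⟩
          · exact ⟨i, hi', List.mem_cons_self⟩
          · exact ⟨j, hj, List.mem_cons_of_mem _ hjT⟩
        · exact h5.imp_right fun ⟨j, hj, hjT⟩ => ⟨j, hj, List.mem_cons_of_mem _ hjT⟩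
        · intro a ha
          rcases List.mem_cons.1 ha with rfl | ha
          · exact ⟨hy.symm, hmem⟩
          · exact h6 a ha
        · rw [List.length_cons, pow_succ]
          omega
    · rw [if_neg hlt]
      exact ⟨lo, [], rfl, le_rfl, hle, Or.inl rfl, Or.inl (by omega), by simp, by simp,
        fun h => absurd h hlt⟩

lemma binarySearch_eq_of_truth {truth : Fin K → Bool} {lab : Fin K → Option (Bool × ℕ)}
    {seq : List (Fin K)} {B : ℝ} :
    ∀ d lo hi b : ℕ, ∀ T k, hi - lo = d →
    binarySearch (fun i => some (truth i, 0)) seq lo hi = some (b, T, k) →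
    (∀ a ∈ T, ∃ n : ℕ, lab a.1 = some (truth a.1, n) ∧ (n : ℝ) ≤ B) →
    ∃ m : ℕ, binarySearch lab seq lo hi = some (b, T, m) ∧ (m : ℝ) ≤ T.length * B := by
  intro d
  induction d using Nat.strong_induction_on with
  | _ d ih =>
    intro lo hi b T k hd h hT
    rw [binarySearch] at h ⊢
    by_cases hlt : lo < hi
    · rw [if_pos hlt] at h ⊢
      set mid := (lo + hi + 1) / 2 with hmid
      cases hseq : seq[mid - 1]? with
      | none => simp [hseq] at h
      | some i =>
        simp only [hseq] at h ⊢
        have step : ∀ lo' hi' y, hi' - lo' < d → y = truth i →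
            (binarySearch (fun i => some (truth i, 0)) seq lo' hi').map
              (fun r => (r.1, (i, y) :: r.2.1, 0 + r.2.2)) = some (b, T, k) →
            ∃ n : ℕ, lab i = some (y, n) ∧ ∃ m : ℕ,
              (binarySearch lab seq lo' hi').map (fun r => (r.1, (i, y) :: r.2.1, n + r.2.2))
                = some (b, T, m) ∧ (m : ℝ) ≤ T.length * B := by
          intro lo' hi' y hd' hy hmap
          obtain ⟨⟨b', T', k'⟩, hr, hr2⟩ := Option.map_eq_some_iff.1 hmap
          simp only [Prod.mk.injEq] at hr2
          obtain ⟨rfl, rfl, rfl⟩ := hr2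
          obtain ⟨n, hn, hnB⟩ := hT (i, y) List.mem_cons_self
          obtain ⟨m, hm, hmB⟩ := ih _ hd' lo' hi' b' T' k' rfl hr
            fun a ha => hT a (List.mem_cons_of_mem _ ha)
          refine ⟨n, by rw [hy]; exact hn, n + m, by rw [hm]; rfl, ?_⟩
          rw [List.length_cons]
          push_cast
          linarith
        cases hy : truth i with
        | true =>
          simp only [hy, if_true] at h
          obtain ⟨n, hn, m, hm, hmB⟩ := step lo (mid - 1) true (by omega) hy.symm h
          exact ⟨m, by simp only [hn, if_true]; exact hm, hmB⟩
        | false =>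
          simp only [hy, Bool.false_eq_true, if_false] at h
          obtain ⟨n, hn, m, hm, hmB⟩ := step mid hi false (by omega) hy.symm h
          exact ⟨m, by simp only [hn, Bool.false_eq_true, if_false]; exact hm, hmB⟩
    · rw [if_neg hlt] at h ⊢
      simp only [Option.some.injEq, Prod.mk.injEq] at h
      obtain ⟨rfl, rfl, rfl⟩ := h
      exact ⟨0, rfl, by simp⟩

end BinarySearch

/-! ### Ranking -/

section Rank

variable {K : ℕ} (p : Fin K → ℝ) (S : Finset (Fin K))

lemma rankBy_perm : (rankBy p S).Perm (S.sort (· ≤ ·)) := by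
  unfold rankBy
  exact List.perm_insertionSort _ _

lemma mem_rankBy {i : Fin K} : i ∈ rankBy p S ↔ i ∈ S := by
  rw [(rankBy_perm p S).mem_iff, Finset.mem_sort]

lemma length_rankBy : (rankBy p S).length = S.card := by
  rw [(rankBy_perm p S).length_eq, Finset.length_sort]

lemma pairwise_rankBy : (rankBy p S).Pairwise fun i j => p i ≤ p j := by
  classical
  have : Std.Total fun i j : Fin K => p i ≤ p j := ⟨fun i j => le_total _ _⟩
  have : IsTrans (Fin K) fun i j => p i ≤ p j := ⟨fun _ _ _ => le_trans⟩
  unfold rankBy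
  convert List.pairwise_insertionSort (fun i j : Fin K => p i ≤ p j) _

lemma rankBy_mono {k m : ℕ} (hkm : k ≤ m) {i j : Fin K} (hi : (rankBy p S)[k]? = some i)
    (hj : (rankBy p S)[m]? = some j) : p i ≤ p j := by
  obtain ⟨hk, rfl⟩ := List.getElem?_eq_some_iff.1 hi
  obtain ⟨hm, rfl⟩ := List.getElem?_eq_some_iff.1 hj
  rcases hkm.eq_or_lt with rfl | hlt
  · exact le_rfl
  · exact List.pairwise_iff_getElem.1 (pairwise_rankBy p S) _ _ _ _ hlt

end Rank


/-! ### Rank-Search with true labels -/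

section IdealRun

variable {K : ℕ}

/-- The state after a round in which the binary search gives `r`. -/
noncomputable def afterRound (P : RSParams) (t : ℕ) (s : RSState K) (n : ℕ) (p : Fin K → ℝ)
    (r : ℕ × List (Fin K × Bool) × ℕ) : RSState K :=
  let seq := rankBy p s.active
  let up := upperSeparated p (P.γ t) s.active seq r.1
  let lo := lowerSeparated p (P.γ t) s.active seq r.1
  { active := ((s.active \ up) \ lo) \ (r.2.1.map Prod.fst).toFinset
    count := n
    label := fun i =>
      if i ∈ lo then false
      else if i ∈ up then true
      else if (i, true) ∈ r.2.1 then true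
      else if (i, false) ∈ r.2.1 then false
      else s.label i
    duels := s.duels + s.active.card * (n - s.count)
    pulls := s.pulls + r.2.2 }

/-- The result of the binary search when all labels are correct. -/
noncomputable def idealSearch (truth : Fin K → Bool) (p : Fin K → ℝ) (S : Finset (Fin K)) :
    ℕ × List (Fin K × Bool) × ℕ :=
  (binarySearch (fun i => some (truth i, 0)) (rankBy p S) 0 S.card).getD (0, [], 0)

/-- A round of Rank-Search with correct labels. -/
noncomputable def idealRound (P : RSParams) (truth : Fin K → Bool) (W : Fin K × ℕ → Bool) (t : ℕ)
    (s : RSState K) : RSState K :=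
  let n := P.newCount t s.active.card s.count
  let p := fun i => avg W i n
  afterRound P t s n p (idealSearch truth p s.active)

/-- The arms labelled by pulls in a round of Rank-Search with correct labels. -/
noncomputable def idealCalls (P : RSParams) (truth : Fin K → Bool) (W : Fin K × ℕ → Bool) (t : ℕ)
    (s : RSState K) : List (Fin K × Bool) :=
  (idealSearch truth (fun i => avg W i (P.newCount t s.active.card s.count)) s.active).2.1

/-- Rank-Search with correct labels. -/
noncomputable def idealRun (P : RSParams) (truth : Fin K → Bool) (W : Fin K × ℕ → Bool) :
    ℕ → RSState K
  | 0 => ⟨Finset.univ, 0, fun _ => false, 0, 0⟩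
  | t + 1 =>
    if (idealRun P truth W t).active = ∅ then idealRun P truth W t
    else idealRound P truth W t (idealRun P truth W t)

lemma idealSearch_spec (truth : Fin K → Bool) (p : Fin K → ℝ) (S : Finset (Fin K)) :
    ∃ b T, binarySearch (fun i => some (truth i, 0)) (rankBy p S) 0 S.card = some (b, T, 0) ∧
      idealSearch truth p S = (b, T, 0) ∧ b ≤ S.card ∧
      (b = 0 ∨ ∃ i, (rankBy p S)[b - 1]? = some i ∧ (i, false) ∈ T) ∧
      (b = S.card ∨ ∃ i, (rankBy p S)[b]? = some i ∧ (i, true) ∈ T) ∧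
      (∀ a ∈ T, a.2 = truth a.1 ∧ a.1 ∈ S) ∧ 2 ^ T.length ≤ max 1 (2 * S.card) ∧
      (S.Nonempty → T ≠ []) := by
  obtain ⟨b, T, h1, -, h3, h4, h5, h6, h7, h8⟩ := binarySearch_truth_spec truth (rankBy p S) S.card
    0 S.card (by omega) (Nat.zero_le _) (length_rankBy p S).ge
  refine ⟨b, T, h1, by rw [idealSearch, h1]; rfl, h3, h4, h5, fun a ha => ?_, by simpa using h7,
    fun h => h8 h.card_pos⟩
  exact ⟨(h6 a ha).1, (mem_rankBy p S).1 (h6 a ha).2⟩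

section Round

variable (P : RSParams) (truth : Fin K → Bool) (W : Fin K × ℕ → Bool) (t : ℕ) (s : RSState K)

lemma two_pow_length_idealCalls (hs : s.active.Nonempty) :
    2 ^ (idealCalls P truth W t s).length ≤ 2 * s.active.card := by
  obtain ⟨b, T, -, h2, -, -, -, -, h7, -⟩ := idealSearch_spec truth
    (fun i => avg W i (P.newCount t s.active.card s.count)) s.active
  rw [idealCalls, h2]
  have := hs.card_pos
  exact h7.trans (max_le (by omega) le_rfl)

lemma idealRound_active_subset : (idealRound P truth W t s).active ⊆ s.active := fun i hi => by
  simp only [idealRound, afterRound, Finset.mem_sdiff] at hi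
  exact hi.1.1.1

lemma notMem_idealRound_of_call {a : Fin K × Bool} (ha : a ∈ idealCalls P truth W t s) :
    a.1 ∉ (idealRound P truth W t s).active := by
  simp only [idealRound, afterRound, Finset.mem_sdiff, not_and, not_not]
  intro _
  rw [List.mem_toFinset, List.mem_map]
  exact ⟨a, ha, rfl⟩

lemma card_idealRound_lt (hs : s.active.Nonempty) :
    (idealRound P truth W t s).active.card < s.active.card := by
  obtain ⟨b, T, -, h2, -, -, -, h6, -, h8⟩ := idealSearch_spec truth
    (fun i => avg W i (P.newCount t s.active.card s.count)) s.active
  obtain ⟨a, ha⟩ := List.exists_mem_of_ne_nil _ (h8 hs)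
  have ha' : a ∈ idealCalls P truth W t s := by rw [idealCalls, h2]; exact ha
  refine Finset.card_lt_card ((Finset.ssubset_iff_of_subset
    (idealRound_active_subset P truth W t s)).2 ⟨a.1, (h6 a ha).2, ?_⟩)
  exact notMem_idealRound_of_call P truth W t s ha'

variable {P truth W t s}

lemma mem_upperSeparated {p : Fin K → ℝ} {g : ℝ} {S : Finset (Fin K)} {seq : List (Fin K)} {b : ℕ}
    {i : Fin K} : i ∈ upperSeparated p g S seq b ↔ i ∈ S ∧ ∃ j, seq[b]? = some j ∧
      2 * g < p i - p j := by
  unfold upperSeparated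
  cases h : seq[b]? <;> simp

lemma mem_lowerSeparated {p : Fin K → ℝ} {g : ℝ} {S : Finset (Fin K)} {seq : List (Fin K)} {b : ℕ}
    {i : Fin K} : i ∈ lowerSeparated p g S seq b ↔ i ∈ S ∧ b ≠ 0 ∧ ∃ j, seq[b - 1]? = some j ∧
      p i - p j < -(2 * g) := by
  unfold lowerSeparated
  by_cases hb : b = 0
  · simp [hb]
  · rw [if_neg hb]
    cases h : seq[b - 1]? <;> simp [hb]

/-- If no negative arm seems much better than a positive arm, then all new labels are correct. -/
lemma idealRound_label (hcross : ∀ i ∈ s.active, ∀ k ∈ s.active, truth i = true → truth k = false →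
      avg W k (P.newCount t s.active.card s.count) - avg W i (P.newCount t s.active.card s.count)
        ≤ 2 * P.γ t)
    (hlab : ∀ i, i ∉ s.active → s.label i = truth i) {i : Fin K}
    (hi : i ∉ (idealRound P truth W t s).active) : (idealRound P truth W t s).label i = truth i := by
  obtain ⟨b, T, -, h2, h3, h4, h5, h6, -, -⟩ := idealSearch_spec truth
    (fun i => avg W i (P.newCount t s.active.card s.count)) s.active
  set p := fun i => avg W i (P.newCount t s.active.card s.count) with hp
  have hround : idealRound P truth W t s =
      afterRound P t s (P.newCount t s.active.card s.count) p (b, T, 0) := by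
    rw [← h2]; rfl
  rw [hround] at hi ⊢
  simp only [afterRound, Finset.mem_sdiff, List.mem_toFinset, List.mem_map, not_and, not_not] at hi ⊢
  have hlen := length_rankBy p s.active
  split_ifs with c1 c2 c3 c4
  · rw [mem_lowerSeparated] at c1
    obtain ⟨hiS, hb, j, hj, hlt⟩ := c1
    obtain ⟨j', hj', hjT⟩ := h4.resolve_left hb
    obtain rfl : j = j' := by rw [hj] at hj'; exact Option.some.inj hj'
    have hjt := (h6 _ hjT)
    by_contra hne
    have := hcross i hiS j hjt.2 (by simpa using Ne.symm hne) hjt.1.symm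
    simp only [hp] at hlt
    linarith
  · rw [mem_upperSeparated] at c2
    obtain ⟨hiS, j, hj, hlt⟩ := c2
    have hb : b ≠ s.active.card := by
      rintro rfl
      rw [List.getElem?_eq_none (by omega)] at hj
      exact absurd hj (by simp)
    obtain ⟨j', hj', hjT⟩ := h5.resolve_left hb
    obtain rfl : j = j' := by rw [hj] at hj'; exact Option.some.inj hj'
    have hjt := (h6 _ hjT)
    by_contra hne
    have := hcross j hjt.2 i hiS hjt.1.symm (by simpa using Ne.symm hne)
    simp only [hp] at hlt
    linarith
  · exact (h6 _ c3).1
  · exact (h6 _ c4).1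
  · refine hlab i fun hiS => ?_
    obtain ⟨a, ha, rfl⟩ := hi ⟨⟨hiS, c2⟩, c1⟩
    rcases h : a.2 with _ | _
    · exact c4 (by rw [← h]; exact ha)
    · exact c3 (by rw [← h]; exact ha)

/-- The sign of a label. -/
def sgn (y : Bool) : ℝ := if y then 1 else -1

/-- If every active positive arm wins more often than every active negative arm, then each arm is
compared with the worst arm of its class. -/
lemma idealRound_separated (hγ : 0 ≤ P.γ t)
    (hsep : ∀ i ∈ s.active, ∀ k ∈ s.active, truth i = true → truth k = false →
      avg W k (P.newCount t s.active.card s.count) < avg W i (P.newCount t s.active.card s.count))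
    {i : Fin K} (hi : i ∈ s.active) :
    ∃ j ∈ s.active, truth j = truth i ∧ j ∉ (idealRound P truth W t s).active ∧
      (∀ k ∈ s.active, truth k = truth i →
        sgn (truth i) * avg W j (P.newCount t s.active.card s.count)
          ≤ sgn (truth i) * avg W k (P.newCount t s.active.card s.count)) ∧
      (2 * P.γ t < sgn (truth i) * avg W i (P.newCount t s.active.card s.count)
          - sgn (truth i) * avg W j (P.newCount t s.active.card s.count) →
        i ∉ (idealRound P truth W t s).active) ∧
      (i ∉ (idealRound P truth W t s).active →
        (i, truth i) ∈ idealCalls P truth W t s ∨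
        2 * P.γ t < sgn (truth i) * avg W i (P.newCount t s.active.card s.count)
          - sgn (truth i) * avg W j (P.newCount t s.active.card s.count)) := by
  obtain ⟨b, T, -, h2, h3, h4, h5, h6, -, -⟩ := idealSearch_spec truth
    (fun i => avg W i (P.newCount t s.active.card s.count)) s.active
  set p := fun i => avg W i (P.newCount t s.active.card s.count) with hp
  have hcalls : idealCalls P truth W t s = T := by rw [idealCalls, h2]
  have hround : idealRound P truth W t s =
      afterRound P t s (P.newCount t s.active.card s.count) p (b, T, 0) := by
    rw [← h2]; rfl
  have hlen := length_rankBy p s.active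
  have hmemT : ∀ a ∈ T, a.1 ∉ (idealRound P truth W t s).active := fun a ha =>
    notMem_idealRound_of_call P truth W t s (by rw [hcalls]; exact ha)
  have hidx : ∀ k ∈ s.active, ∃ m, (rankBy p s.active)[m]? = some k := fun k hk =>
    List.mem_iff_getElem?.1 ((mem_rankBy p _).2 hk)
  have hlt : ∀ {m k}, (rankBy p s.active)[m]? = some k → m < s.active.card := fun h => by
    rw [← hlen]; exact (List.getElem?_eq_some_iff.1 h).1
  have hact : ∀ k ∈ s.active, k ∉ (idealRound P truth W t s).active ↔
      k ∈ upperSeparated p (P.γ t) s.active (rankBy p s.active) b ∨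
      k ∈ lowerSeparated p (P.γ t) s.active (rankBy p s.active) b ∨ (k, truth k) ∈ T := by
    intro k hk
    rw [hround]
    simp only [afterRound, Finset.mem_sdiff, List.mem_toFinset, List.mem_map, hk, true_and]
    have : (∃ a ∈ T, a.1 = k) ↔ (k, truth k) ∈ T := by
      constructor
      · rintro ⟨a, ha, rfl⟩
        rw [← (h6 a ha).1]; exact ha
      · exact fun h => ⟨_, h, rfl⟩
    rw [this]
    tauto
  rw [hcalls, hact i hi, mem_upperSeparated, mem_lowerSeparated]
  cases hti : truth i with
  | true =>
    have hb : b ≠ s.active.card := by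
      rintro hb
      rcases h4 with h0 | ⟨j, hj, hjT⟩
      · exact Finset.card_ne_zero_of_mem hi (hb ▸ h0)
      · obtain ⟨m, hm⟩ := hidx i hi
        have h := rankBy_mono p s.active (by have := hlt hm; omega) hm hj
        exact absurd (hsep i hi j (h6 _ hjT).2 hti (h6 _ hjT).1.symm) (not_lt.2 h)
    obtain ⟨j, hj, hjT⟩ := h5.resolve_left hb
    have hmin : ∀ k ∈ s.active, truth k = true → p j ≤ p k := by
      intro k hk hkt
      obtain ⟨m, hm⟩ := hidx k hk
      by_cases hbm : b ≤ m
      · exact rankBy_mono p s.active hbm hj hm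
      · rcases h4 with h0 | ⟨j', hj', hjT'⟩
        · omega
        · have h := rankBy_mono p s.active (by omega) hm hj'
          exact absurd (hsep k hk j' (h6 _ hjT').2 hkt (h6 _ hjT').1.symm) (not_lt.2 h)
    refine ⟨j, (h6 _ hjT).2, (h6 _ hjT).1.symm, hmemT _ hjT, fun k hk hkt => ?_, fun h => ?_, ?_⟩
    · simpa [sgn] using hmin k hk hkt
    · left
      exact ⟨hi, j, hj, by simpa [sgn] using h⟩
    · rintro (⟨-, j', hj', h⟩ | ⟨-, hb0, j', hj', h⟩ | h)
      · right
        obtain rfl : j = j' := by rw [hj] at hj'; exact Option.some.inj hj'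
        simpa [sgn] using h
      · exfalso
        obtain ⟨j'', hj'', hjT''⟩ := h4.resolve_left hb0
        obtain rfl : j' = j'' := by rw [hj'] at hj''; exact Option.some.inj hj''
        have := hsep i hi j' (h6 _ hjT'').2 hti (h6 _ hjT'').1.symm
        simp only [hp] at h
        linarith
      · exact Or.inl h
  | false =>
    have hb : b ≠ 0 := by
      rintro hb
      rcases h5 with h0 | ⟨j, hj, hjT⟩
      · exact Finset.card_ne_zero_of_mem hi (h0 ▸ hb)
      · obtain ⟨m, hm⟩ := hidx i hi
        have h := rankBy_mono p s.active (by omega) hj hm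
        exact absurd (hsep j (h6 _ hjT).2 i hi (h6 _ hjT).1.symm hti) (not_lt.2 h)
    obtain ⟨j, hj, hjT⟩ := h4.resolve_left hb
    have hmin : ∀ k ∈ s.active, truth k = false → p k ≤ p j := by
      intro k hk hkt
      obtain ⟨m, hm⟩ := hidx k hk
      by_cases hbm : m < b
      · exact rankBy_mono p s.active (by omega) hm hj
      · rcases h5 with h0 | ⟨j', hj', hjT'⟩
        · have := hlt hm; omega
        · have h := rankBy_mono p s.active (not_lt.1 hbm) hj' hm
          exact absurd (hsep j' (h6 _ hjT').2 k hk (h6 _ hjT').1.symm hkt) (not_lt.2 h)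
    refine ⟨j, (h6 _ hjT).2, (h6 _ hjT).1.symm, hmemT _ hjT, fun k hk hkt => ?_, fun h => ?_, ?_⟩
    · simpa [sgn] using hmin k hk hkt
    · right; left
      refine ⟨hi, hb, j, hj, ?_⟩
      simp only [sgn, Bool.false_eq_true, if_false] at h
      simp only [hp]
      linarith
    · rintro (⟨-, j', hj', h⟩ | ⟨-, hb0, j', hj', h⟩ | h)
      · exfalso
        have hbc : b ≠ s.active.card := (hlt hj').ne
        obtain ⟨j'', hj'', hjT''⟩ := h5.resolve_left hbc
        obtain rfl : j' = j'' := by rw [hj'] at hj''; exact Option.some.inj hj''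
        have := hsep j' (h6 _ hjT'').2 i hi (h6 _ hjT'').1.symm hti
        simp only [hp] at h
        linarith
      · right
        obtain rfl : j = j' := by rw [hj] at hj'; exact Option.some.inj hj'
        simp only [sgn, Bool.false_eq_true, if_false]
        simp only [hp] at h
        linarith
      · exact Or.inl h

end Round

/-! ### Comparison of the two runs -/

/-- The confidence for the labels in round `t`. -/
noncomputable def roundConfidence (P : RSParams) (t : ℕ) (s : RSState K) : ℝ :=
  callConfidence (P.δ / (4 * ((t : ℝ) + 1) ^ 2)) s.active.card

lemma rsState_eq_idealRun (P : RSParams) (hτ : P.τ = 1 / 2) (μ : Fin K → ℝ) (ω : Samples K)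
    (h : ∀ t, (idealRun P (fun i => decide (1 / 2 ≤ μ i)) (winsOf ω.2) t).active.Nonempty →
      ∀ a ∈ idealCalls P (fun i => decide (1 / 2 ≤ μ i)) (winsOf ω.2) t
          (idealRun P (fun i => decide (1 / 2 ≤ μ i)) (winsOf ω.2) t),
        FolOK P.R (roundConfidence P t
          (idealRun P (fun i => decide (1 / 2 ≤ μ i)) (winsOf ω.2) t)) μ a.1 ω.1) (t : ℕ) :
    ∃ m : ℕ, rsState P ω t
        = some { idealRun P (fun i => decide (1 / 2 ≤ μ i)) (winsOf ω.2) t with pulls := m } ∧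
      (m : ℝ) ≤ ∑ k ∈ Finset.range t,
        if (idealRun P (fun i => decide (1 / 2 ≤ μ i)) (winsOf ω.2) k).active.Nonempty then
          (idealCalls P (fun i => decide (1 / 2 ≤ μ i)) (winsOf ω.2) k
            (idealRun P (fun i => decide (1 / 2 ≤ μ i)) (winsOf ω.2) k)).length *
          folBound P.R (roundConfidence P k
            (idealRun P (fun i => decide (1 / 2 ≤ μ i)) (winsOf ω.2) k))
        else 0 := by
  set truth : Fin K → Bool := fun i => decide (1 / 2 ≤ μ i) with htruth
  induction t with
  | zero => exact ⟨0, rfl, by simp⟩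
  | succ t ih =>
    obtain ⟨m, hm, hmB⟩ := ih
    rw [Finset.sum_range_succ]
    set s := idealRun P truth (winsOf ω.2) t with hs
    by_cases he : s.active = ∅
    · refine ⟨m, ?_, ?_⟩
      · rw [rsState, hm, idealRun, ← hs, if_pos he]
        simp only [Option.bind_some]
        rw [if_pos he]
      · rw [if_neg (by rw [he]; exact Finset.not_nonempty_empty)]
        simpa using hmB
    · have hne := Finset.nonempty_iff_ne_empty.2 he
      obtain ⟨b, T, h1, h2, -, -, -, h6, -, -⟩ := idealSearch_spec truth
        (fun i => avg (winsOf ω.2) i (P.newCount t s.active.card s.count)) s.active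
      have hcalls : idealCalls P truth (winsOf ω.2) t s = T := by rw [idealCalls, h2]
      obtain ⟨m', hm', hmB'⟩ := binarySearch_eq_of_truth (truth := truth)
        (lab := fun i => figureOutLabel P.R P.τ (roundConfidence P t s) fun m => ω.1 (i, m))
        (B := folBound P.R (roundConfidence P t s)) _ _ _ _ _ _ rfl h1 (by
          intro a ha
          obtain ⟨n, hn, hnB⟩ := h t hne a (by rw [← hs, hcalls]; exact ha)
          exact ⟨n, by rw [hτ]; exact hn, hnB⟩)
      refine ⟨m + m', ?_, ?_⟩
      · rw [rsState, hm, idealRun, ← hs, if_neg he]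
        simp only [Option.bind_some]
        rw [if_neg he]
        have hr : rsRound P ω t { s with pulls := m } = (binarySearch
            (fun i => figureOutLabel P.R P.τ (roundConfidence P t s) fun m => ω.1 (i, m))
            (rankBy (fun i => avg (winsOf ω.2) i (P.newCount t s.active.card s.count)) s.active)
            0 s.active.card).map (afterRound P t { s with pulls := m }
              (P.newCount t s.active.card s.count)
              fun i => avg (winsOf ω.2) i (P.newCount t s.active.card s.count)) := rfl
        rw [hr, hm', Option.map_some]
        congr 1
        simp only [idealRound, h2, afterRound]
      · rw [if_pos hne, hcalls]
        push_cast
        linarith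

lemma card_idealRun_le (P : RSParams) (truth : Fin K → Bool) (W : Fin K × ℕ → Bool) (t : ℕ) :
    (idealRun P truth W t).active.card ≤ K - t := by
  induction t with
  | zero => simp [idealRun]
  | succ t ih =>
    rw [idealRun]
    split_ifs with h
    · simp [h]
    · have := card_idealRound_lt P truth W t _ (Finset.nonempty_iff_ne_empty.2 h)
      omega

end IdealRun


/-! ### Measurability of the run with true labels -/

section Measurability

variable {K : ℕ}

instance : Countable (RSState K) := by
  have : Function.Injective fun s : RSState K => (s.active, s.count, s.label, s.duels, s.pulls) := by
    rintro ⟨⟩ ⟨⟩ h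
    simp only [Prod.mk.injEq] at h
    obtain ⟨rfl, rfl, rfl, rfl, rfl⟩ := h
    rfl
  exact this.countable

lemma measurableSet_of_avg {n : ℕ} (Q : (Fin K → ℝ) → Prop) :
    MeasurableSet {W : Fin K × ℕ → Bool | Q fun i => avg W i n} := by
  let F : (Fin K × Fin n → Bool) → Fin K × ℕ → Bool := fun v a =>
    if h : a.2 < n then v (a.1, ⟨a.2, h⟩) else false
  let G : (Fin K × ℕ → Bool) → Fin K × Fin n → Bool := fun W a => W (a.1, a.2)
  have hG : Measurable G := measurable_pi_lambda _ fun a => measurable_pi_apply _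
  have h : {W : Fin K × ℕ → Bool | Q fun i => avg W i n}
      = G ⁻¹' {v | Q fun i => avg (F v) i n} := by
    ext W
    have : (fun i => avg W i n) = fun i => avg (F (G W)) i n := by
      funext i
      unfold avg
      congr 1
      refine Finset.sum_congr rfl fun m hm => ?_
      simp only [F, G, Finset.mem_range.1 hm, dif_pos]
    change Q _ ↔ Q _
    rw [this]
  rw [h]
  exact hG (Set.toFinite _).measurableSet

variable (P : RSParams) (truth : Fin K → Bool)

lemma measurableSet_idealRun (t : ℕ) (s : RSState K) :
    MeasurableSet {W | idealRun P truth W t = s} := by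
  induction t generalizing s with
  | zero => simp [idealRun]
  | succ t ih =>
    have : {W | idealRun P truth W (t + 1) = s} = ⋃ s' : RSState K,
        {W | idealRun P truth W t = s'} ∩
          {W | (if s'.active = ∅ then s' else idealRound P truth W t s') = s} := by
      ext W
      simp only [Set.mem_iUnion, Set.mem_inter_iff, Set.mem_ofPred_eq, idealRun, exists_eq_left']
    rw [this]
    refine MeasurableSet.iUnion fun s' => (ih s').inter ?_
    by_cases he : s'.active = ∅
    · simp only [if_pos he, MeasurableSet.const]
    · obtain ⟨F, hF⟩ : ∃ F : (Fin K → ℝ) → RSState K, ∀ W, idealRound P truth W t s'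
          = F fun i => avg W i (P.newCount t s'.active.card s'.count) :=
        ⟨fun p => afterRound P t s' (P.newCount t s'.active.card s'.count) p
          (idealSearch truth p s'.active), fun W => rfl⟩
      simp only [if_neg he, hF]
      exact measurableSet_of_avg fun p => F p = s

lemma measurableSet_idealRun_calls (t : ℕ) (c : RSState K × List (Fin K × Bool)) :
    MeasurableSet {W | (idealRun P truth W t, idealCalls P truth W t (idealRun P truth W t)) = c} := by
  have : {W | (idealRun P truth W t, idealCalls P truth W t (idealRun P truth W t)) = c}
      = {W | idealRun P truth W t = c.1} ∩ {W | idealCalls P truth W t c.1 = c.2} := by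
    ext W
    simp only [Set.mem_inter_iff, Prod.ext_iff]
    change (_ ∧ _) ↔ (_ ∧ _)
    constructor
    · rintro ⟨h1, h2⟩
      refine ⟨h1, ?_⟩
      change idealCalls P truth W t c.1 = c.2
      rw [← h1]
      exact h2
    · rintro ⟨h1, h2⟩
      refine ⟨h1, ?_⟩
      rw [show idealRun P truth W t = c.1 from h1]
      exact h2
  rw [this]
  obtain ⟨F, hF⟩ : ∃ F : (Fin K → ℝ) → List (Fin K × Bool), ∀ W, idealCalls P truth W t c.1
      = F fun i => avg W i (P.newCount t c.1.active.card c.1.count) :=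
    ⟨fun p => (idealSearch truth p c.1.active).2.1, fun W => rfl⟩
  simp only [hF]
  exact (measurableSet_idealRun P truth t c.1).inter (measurableSet_of_avg fun p => F p = c.2)

lemma prod_fiber_le {α β ι : Type*} [MeasurableSpace α] [MeasurableSpace β] [Countable ι]
    (μ : Measure α) [SFinite μ] (ν : Measure β) [IsProbabilityMeasure ν] (X : β → ι)
    (hX : ∀ c, MeasurableSet {w | X w = c}) (B : ι → Set α) {ε : ℝ≥0∞}
    (hB : ∀ w, μ (B (X w)) ≤ ε) : (μ.prod ν) {ω | ω.1 ∈ B (X ω.2)} ≤ ε := by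
  have hsub : {ω : α × β | ω.1 ∈ B (X ω.2)} ⊆ ⋃ c, B c ×ˢ {w | X w = c} := by
    intro ω hω
    exact Set.mem_iUnion.2 ⟨X ω.2, hω, rfl⟩
  refine (measure_mono hsub).trans ((measure_iUnion_le _).trans ?_)
  have h1 : ∀ c, (μ.prod ν) (B c ×ˢ {w | X w = c}) ≤ ε * ν {w | X w = c} := by
    intro c
    rw [Measure.prod_prod]
    by_cases h : ∃ w, X w = c
    · obtain ⟨w, rfl⟩ := h
      gcongr
      exact hB w
    · have : {w | X w = c} = ∅ := by
        ext w; simp only [Set.mem_empty_iff_false, iff_false]; exact fun hw => h ⟨w, hw⟩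
      simp [this]
  refine (ENNReal.tsum_le_tsum h1).trans ?_
  rw [ENNReal.tsum_mul_left, ← measure_iUnion]
  · exact (mul_le_mul_right prob_le_one _).trans (mul_one _).le
  · intro c c' hne
    refine Set.disjoint_left.2 fun w hw hw' => hne ?_
    exact (show X w = c from hw).symm.trans hw'
  · exact hX

end Measurability

/-! ### Errors of the labels -/

section LabelErrors

variable {K : ℕ}

lemma callConfidence_pos {δ₀ : ℝ} (h : 0 < δ₀) (s : ℕ) : 0 < callConfidence δ₀ s := by
  unfold callConfidence
  split_ifs with hs
  · exact h
  · exact div_pos h (Real.log_pos (by exact_mod_cast not_le.1 hs))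

lemma callConfidence_le {δ₀ : ℝ} (h : 0 ≤ δ₀) (s : ℕ) : callConfidence δ₀ s ≤ 2 * δ₀ := by
  unfold callConfidence
  split_ifs with hs
  · linarith
  · have h2 : Real.log 2 ≤ Real.log s := Real.log_le_log (by norm_num) (by
      exact_mod_cast not_le.1 hs)
    have := Real.log_two_gt_d9
    rw [div_le_iff₀ (by linarith)]
    nlinarith

lemma length_mul_callConfidence_le {δ₀ : ℝ} (h : 0 ≤ δ₀) {s m : ℕ} (hs : 0 < s)
    (hm : 2 ^ m ≤ 2 * s) : (m : ℝ) * callConfidence δ₀ s ≤ 3 * δ₀ := by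
  unfold callConfidence
  have hl2 := Real.log_two_gt_d9
  split_ifs with h1
  · have : m < 2 := by
      by_contra hcon
      have := Nat.pow_le_pow_right (n := 2) (by norm_num) (not_lt.1 hcon)
      omega
    have : (m : ℝ) ≤ 1 := by exact_mod_cast Nat.lt_succ_iff.1 this
    nlinarith
  · have h2 : Real.log 2 ≤ Real.log s := Real.log_le_log (by norm_num) (by
      exact_mod_cast not_le.1 h1)
    have h3 : (m : ℝ) * Real.log 2 ≤ Real.log 2 + Real.log s := by
      rw [← Real.log_pow, ← Real.log_mul (by norm_num) (by positivity)]
      exact Real.log_le_log (by positivity) (by exact_mod_cast hm)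
    have h4 : (m : ℝ) ≤ 3 * Real.log s := by nlinarith
    rw [mul_div_assoc', div_le_iff₀ (by linarith)]
    nlinarith

/-- With high probability, the binary searches on the run with true labels make no mistakes. -/
lemma label_errors_le [NeZero K] {P : RSParams} {μ : Fin K → ℝ} (M : Fin K → Fin K → ℝ)
    (hR : 1 / 2 ≤ P.R) (hδ : 0 < P.δ) (hδ1 : P.δ ≤ 1 / 2) (hμ : ∀ i, μ i ∈ Set.Icc (0 : ℝ) 1)
    (hgap : ∀ i, 1 / 4 ≤ |μ i - 1 / 2|) :
    sampleLaw M μ {ω | ¬ ∀ t,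
      (idealRun P (fun i => decide (1 / 2 ≤ μ i)) (winsOf ω.2) t).active.Nonempty →
      ∀ a ∈ idealCalls P (fun i => decide (1 / 2 ≤ μ i)) (winsOf ω.2) t
          (idealRun P (fun i => decide (1 / 2 ≤ μ i)) (winsOf ω.2) t),
        FolOK P.R (roundConfidence P t
          (idealRun P (fun i => decide (1 / 2 ≤ μ i)) (winsOf ω.2) t)) μ a.1 ω.1}
      ≤ ENNReal.ofReal (3 * P.δ / 16) := by
  set truth : Fin K → Bool := fun i => decide (1 / 2 ≤ μ i) with htruth
  let X : ℕ → (Fin K × ℕ → Fin K) × (Fin K × Fin K × ℕ → Bool) → RSState K × List (Fin K × Bool) :=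
    fun t d => (idealRun P truth (winsOf d) t,
      idealCalls P truth (winsOf d) t (idealRun P truth (winsOf d) t))
  let B : ℕ → RSState K × List (Fin K × Bool) → Set (Fin K × ℕ → Bool) := fun t c =>
    {y | c.1.active.Nonempty ∧ ∃ a ∈ c.2, ¬ FolOK P.R (roundConfidence P t c.1) μ a.1 y}
  have hsub : {ω : Samples K | ¬ ∀ t, (idealRun P truth (winsOf ω.2) t).active.Nonempty →
      ∀ a ∈ idealCalls P truth (winsOf ω.2) t (idealRun P truth (winsOf ω.2) t),
        FolOK P.R (roundConfidence P t (idealRun P truth (winsOf ω.2) t)) μ a.1 ω.1}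
      ⊆ ⋃ t, {ω | ω.1 ∈ B t (X t ω.2)} := by
    intro ω hω
    replace hω := not_forall.1 hω
    obtain ⟨t, ht⟩ := hω
    rw [Classical.not_imp] at ht
    obtain ⟨h1, h2⟩ := ht
    push Not at h2
    exact Set.mem_iUnion.2 ⟨t, h1, h2⟩
  refine (measure_mono hsub).trans ((measure_iUnion_le _).trans ?_)
  have hround : ∀ t, sampleLaw M μ {ω | ω.1 ∈ B t (X t ω.2)}
      ≤ ENNReal.ofReal (3 * P.δ / 32 / ((t : ℝ) + 1) ^ 2) := by
    intro t
    have hδ₀ : 0 < P.δ / (4 * ((t : ℝ) + 1) ^ 2) := by positivity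
    have hδ₁ : P.δ / (4 * ((t : ℝ) + 1) ^ 2) ≤ 1 / 8 := by
      rw [div_le_iff₀ (by positivity)]
      have : (1 : ℝ) ≤ ((t : ℝ) + 1) ^ 2 :=
        one_le_pow₀ (by linarith [(Nat.cast_nonneg t : (0 : ℝ) ≤ t)])
      linarith
    refine prod_fiber_le _ _ (X t) (fun c => measurable_winsOf
      (measurableSet_idealRun_calls P truth t c)) (B t) fun d => ?_
    by_cases hne : (X t d).1.active.Nonempty
    · have hsub' : B t (X t d) ⊆ ⋃ a ∈ (X t d).2.toFinset,
          {y | ¬ FolOK P.R (roundConfidence P t (X t d).1) μ a.1 y} := by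
        rintro y ⟨-, a, ha, hy⟩
        exact Set.mem_biUnion (List.mem_toFinset.2 ha) hy
      refine (measure_mono hsub').trans ((measure_biUnion_finset_le _ _).trans ?_)
      have hc0 : 0 < roundConfidence P t (X t d).1 := callConfidence_pos hδ₀ _
      have hc1 : roundConfidence P t (X t d).1 ≤ 3 / 10 := by
        have := callConfidence_le hδ₀.le (X t d).1.active.card
        unfold roundConfidence
        linarith
      refine (Finset.sum_le_sum fun a _ => rewardLaw_not_folOK hR hc0 hc1 (hμ a.1)
        (hgap a.1)).trans ?_
      rw [Finset.sum_const, nsmul_eq_mul, ← ENNReal.ofReal_natCast,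
        ← ENNReal.ofReal_mul (Nat.cast_nonneg _)]
      refine ENNReal.ofReal_le_ofReal ?_
      have h1 : ((X t d).2.toFinset.card : ℝ) ≤ (X t d).2.length := by
        exact_mod_cast List.toFinset_card_le _
      have h2 := length_mul_callConfidence_le hδ₀.le hne.card_pos
        (two_pow_length_idealCalls P truth (winsOf d) t _ hne)
      calc ((X t d).2.toFinset.card : ℝ) * (roundConfidence P t (X t d).1 / 8)
          ≤ (X t d).2.length * (roundConfidence P t (X t d).1 / 8) := by gcongr
        _ = (X t d).2.length * roundConfidence P t (X t d).1 / 8 := by ring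
        _ ≤ 3 * (P.δ / (4 * ((t : ℝ) + 1) ^ 2)) / 8 := div_le_div_of_nonneg_right h2 (by norm_num)
        _ = 3 * P.δ / 32 / ((t : ℝ) + 1) ^ 2 := by field_simp; norm_num
    · have : B t (X t d) = ∅ := by
        ext y; simp only [Set.mem_empty_iff_false, iff_false]; exact fun h => hne h.1
      rw [this, measure_empty]
      exact zero_le
  refine (tsum_ofReal_inv_sq_le (by positivity) hround).trans ?_
  exact ENNReal.ofReal_le_ofReal (by linarith)

end LabelErrors


/-! ### From the run with true labels to Rank-Search -/

section Transfer

variable {K : ℕ}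

/-- A bound for the number of pulls of Rank-Search in round `t` if all labels are correct. -/
noncomputable def roundPulls (P : RSParams) (truth : Fin K → Bool) (W : Fin K × ℕ → Bool) (t : ℕ) :
    ℝ :=
  if (idealRun P truth W t).active.Nonempty then
    (idealCalls P truth W t (idealRun P truth W t)).length *
      folBound P.R (roundConfidence P t (idealRun P truth W t))
  else 0

lemma rankSearch_spec [NeZero K] {P : RSParams} {M : Fin K → Fin K → ℝ} {μ : Fin K → ℝ}
    (hM : ∀ i j, M i j ∈ Set.Icc (0 : ℝ) 1) (hτ : P.τ = 1 / 2) (hR : 1 / 2 ≤ P.R) (hδ : 0 < P.δ)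
    (hδ1 : P.δ ≤ 1 / 2) (hμ : ∀ i, μ i ∈ Set.Icc (0 : ℝ) 1) (hgap : ∀ i, 1 / 4 ≤ |μ i - 1 / 2|)
    (G : Set (Fin K × ℕ → Bool)) (hG : rewardLaw (meanScore M) Gᶜ ≤ ENNReal.ofReal (3 * P.δ / 4))
    {D N : ℝ}
    (hrun : ∀ W ∈ G, ∃ T, (idealRun P (fun i => decide (1 / 2 ≤ μ i)) W T).active = ∅ ∧
      (∀ i, (idealRun P (fun i => decide (1 / 2 ≤ μ i)) W T).label i = decide (1 / 2 ≤ μ i)) ∧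
      ((idealRun P (fun i => decide (1 / 2 ≤ μ i)) W T).duels : ℝ) ≤ D ∧
      ∑ t ∈ Finset.range T, roundPulls P (fun i => decide (1 / 2 ≤ μ i)) W t ≤ N) :
    ENNReal.ofReal (1 - P.δ) ≤
      sampleLaw M μ {ω | RSReturns P ω (positiveSet (1 / 2) μ) D N} := by
  set truth : Fin K → Bool := fun i => decide (1 / 2 ≤ μ i) with htruth
  have hprob : IsProbabilityMeasure (sampleLaw M μ) := by unfold sampleLaw; infer_instance
  let A : Set (Samples K) := {ω | winsOf ω.2 ∉ G}
  have hA : sampleLaw M μ A ≤ ENNReal.ofReal (3 * P.δ / 4) := by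
    have h1 : A = Set.univ ×ˢ (winsOf ⁻¹' Gᶜ) := by
      ext ω; simp [A]
    rw [h1, sampleLaw, Measure.prod_prod, measure_univ, one_mul]
    refine (Measure.le_map_apply measurable_winsOf.aemeasurable _).trans ?_
    rw [map_winsOf hM]
    exact hG
  let B : Set (Samples K) := {ω | ¬ ∀ t, (idealRun P truth (winsOf ω.2) t).active.Nonempty →
      ∀ a ∈ idealCalls P truth (winsOf ω.2) t (idealRun P truth (winsOf ω.2) t),
        FolOK P.R (roundConfidence P t (idealRun P truth (winsOf ω.2) t)) μ a.1 ω.1}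
  have hB : sampleLaw M μ B ≤ ENNReal.ofReal (3 * P.δ / 16) := label_errors_le M hR hδ hδ1 hμ hgap
  refine ofReal_one_sub_le_of_compl (B := A ∪ B) hδ.le ?_ ?_
  · intro ω hω
    rw [Set.mem_compl_iff, Set.mem_union, not_or] at hω
    obtain ⟨T, hT1, hT2, hT3, hT4⟩ := hrun (winsOf ω.2) (not_not.1 hω.1)
    obtain ⟨m, hm, hmB⟩ := rsState_eq_idealRun P hτ μ ω (not_not.1 hω.2) T
    refine ⟨T, _, hm, hT1, fun i => ?_, hT3, hmB.trans hT4⟩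
    change _ ↔ (idealRun P truth (winsOf ω.2) T).label i = true
    rw [hT2]
    simp [positiveSet]
  · refine (measure_union_le _ _).trans ((add_le_add hA hB).trans ?_)
    rw [← ENNReal.ofReal_add (by positivity) (by positivity)]
    exact ENNReal.ofReal_le_ofReal (by linarith)

end Transfer

/-! ### Bounds for the run with true labels -/

section Bounds

variable {K : ℕ} {P : RSParams} {truth : Fin K → Bool} {W : Fin K × ℕ → Bool}

/-- The common comparison count in the ranking of round `t`. -/
noncomputable def rankCount (P : RSParams) (truth : Fin K → Bool) (W : Fin K × ℕ → Bool) (t : ℕ) :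
    ℕ :=
  P.newCount t (idealRun P truth W t).active.card (idealRun P truth W t).count

lemma idealRun_succ_of_nonempty {t : ℕ} (h : (idealRun P truth W t).active.Nonempty) :
    idealRun P truth W (t + 1) = idealRound P truth W t (idealRun P truth W t) := by
  rw [idealRun, if_neg h.ne_empty]

lemma idealRun_succ_of_empty {t : ℕ} (h : (idealRun P truth W t).active = ∅) :
    idealRun P truth W (t + 1) = idealRun P truth W t := by
  rw [idealRun, if_pos h]

lemma idealRun_active_succ_subset (t : ℕ) :
    (idealRun P truth W (t + 1)).active ⊆ (idealRun P truth W t).active := by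
  rcases (idealRun P truth W t).active.eq_empty_or_nonempty with h | h
  · rw [idealRun_succ_of_empty h]
  · rw [idealRun_succ_of_nonempty h]
    exact idealRound_active_subset _ _ _ _ _

lemma idealRun_active_anti {t u : ℕ} (h : t ≤ u) :
    (idealRun P truth W u).active ⊆ (idealRun P truth W t).active := by
  induction u, h using Nat.le_induction with
  | base => exact subset_rfl
  | succ u _ ih => exact (idealRun_active_succ_subset u).trans ih

lemma idealRun_count_succ {t : ℕ} (h : (idealRun P truth W t).active.Nonempty) :
    (idealRun P truth W (t + 1)).count = rankCount P truth W t := by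
  rw [idealRun_succ_of_nonempty h]; rfl

lemma idealRun_count_le_rankCount (t : ℕ) : (idealRun P truth W t).count ≤ rankCount P truth W t :=
  le_max_left _ _

lemma idealRun_count_le_succ (t : ℕ) :
    (idealRun P truth W t).count ≤ (idealRun P truth W (t + 1)).count := by
  rcases (idealRun P truth W t).active.eq_empty_or_nonempty with h | h
  · rw [idealRun_succ_of_empty h]
  · rw [idealRun_count_succ h]
    exact idealRun_count_le_rankCount t

lemma idealRun_count_mono {t u : ℕ} (h : t ≤ u) :
    (idealRun P truth W t).count ≤ (idealRun P truth W u).count := by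
  induction u, h using Nat.le_induction with
  | base => exact le_rfl
  | succ u _ ih => exact ih.trans (idealRun_count_le_succ u)

lemma le_rankCount (t : ℕ) : 1 / P.γ t ^ 2 *
    Real.log (8 * (idealRun P truth W t).active.card * ((t : ℝ) + 1) ^ 2 / P.δ)
      ≤ rankCount P truth W t := by
  unfold rankCount RSParams.newCount
  refine (Nat.lt_floor_add_one _).le.trans ?_
  exact_mod_cast le_max_right _ _

lemma rankCount_mono {t u : ℕ} (h : t ≤ u) (hu : (idealRun P truth W u).active.Nonempty) :
    rankCount P truth W t ≤ rankCount P truth W u := by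
  rcases h.eq_or_lt with rfl | hlt
  · exact le_rfl
  · rw [← idealRun_count_succ (hu.mono (idealRun_active_anti h))]
    exact (idealRun_count_mono hlt).trans (idealRun_count_le_rankCount u)

/-- A bound for the number of comparisons of each arm in round `t`. -/
noncomputable def maxCount (P : RSParams) (K t : ℕ) : ℝ :=
  1 / P.γ t ^ 2 * Real.log (8 * K * ((t : ℝ) + 1) ^ 2 / P.δ) + 1

lemma gamma_pos (hγ : 0 < P.γ₀) (hκ : 1 < P.κ) (t : ℕ) : 0 < P.γ t :=
  div_pos hγ (pow_pos (by linarith) t)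

lemma gamma_anti (hγ : 0 < P.γ₀) (hκ : 1 < P.κ) {t u : ℕ} (h : t ≤ u) : P.γ u ≤ P.γ t := by
  unfold RSParams.γ
  exact div_le_div_of_nonneg_left hγ.le (pow_pos (by linarith) t) (pow_le_pow_right₀ hκ.le h)

lemma one_le_card_log_arg (hδ : 0 < P.δ) (hδ1 : P.δ ≤ 1 / 2) (hK : 1 ≤ K) (t : ℕ) :
    1 ≤ 8 * (K : ℝ) * ((t : ℝ) + 1) ^ 2 / P.δ := by
  rw [le_div_iff₀ hδ]
  have h1 : (1 : ℝ) ≤ K := by exact_mod_cast hK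
  have h2 : (1 : ℝ) ≤ ((t : ℝ) + 1) ^ 2 :=
    one_le_pow₀ (by linarith [(Nat.cast_nonneg t : (0 : ℝ) ≤ t)])
  nlinarith

lemma maxCount_mono (hγ : 0 < P.γ₀) (hκ : 1 < P.κ) (hδ : 0 < P.δ) (hδ1 : P.δ ≤ 1 / 2)
    {K' : ℕ} (hK : 1 ≤ K) (hKK : K ≤ K') {t u : ℕ} (h : t ≤ u) :
    maxCount P K t ≤ maxCount P K' u := by
  unfold maxCount
  have h1 := gamma_anti hγ hκ h
  have h2 := gamma_pos hγ hκ u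
  have h3 := one_le_card_log_arg hδ hδ1 hK t
  have h4 : (t : ℝ) ≤ u := by exact_mod_cast h
  have h5 : (K : ℝ) ≤ K' := by exact_mod_cast hKK
  have h6 := Real.log_nonneg h3
  have h7 : Real.log (8 * K * ((t : ℝ) + 1) ^ 2 / P.δ) ≤
      Real.log (8 * K' * ((u : ℝ) + 1) ^ 2 / P.δ) :=
    Real.log_le_log (by linarith) (by gcongr)
  have h8 : 1 / P.γ t ^ 2 ≤ 1 / P.γ u ^ 2 := by gcongr
  have := mul_le_mul h8 h7 h6 (by positivity)
  linarith

lemma maxCount_pos (hδ : 0 < P.δ) (hδ1 : P.δ ≤ 1 / 2)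
    (hK : 1 ≤ K) (t : ℕ) : 0 < maxCount P K t := by
  have := Real.log_nonneg (one_le_card_log_arg hδ hδ1 hK t)
  unfold maxCount
  positivity

lemma idealRun_count_le (hγ : 0 < P.γ₀) (hκ : 1 < P.κ) (hδ : 0 < P.δ) (hδ1 : P.δ ≤ 1 / 2)
    (hK : 1 ≤ K) (t : ℕ) : ((idealRun P truth W t).count : ℝ) ≤ maxCount P K t ∧
      ((idealRun P truth W (t + 1)).count : ℝ) ≤ maxCount P K t := by
  have key : ∀ t, ((idealRun P truth W t).count : ℝ) ≤ maxCount P K t →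
      ((idealRun P truth W (t + 1)).count : ℝ) ≤ maxCount P K t := by
    intro t h
    rcases (idealRun P truth W t).active.eq_empty_or_nonempty with he | he
    · rw [idealRun_succ_of_empty he]; exact h
    · rw [idealRun_count_succ he, rankCount, RSParams.newCount]
      push_cast
      refine max_le h ?_
      have hc : ((idealRun P truth W t).active.card : ℝ) ≤ K := by
        have := card_idealRun_le P truth W t
        exact_mod_cast this.trans (Nat.sub_le _ _)
      have h1 : (1 : ℕ) ≤ (idealRun P truth W t).active.card := he.card_pos
      have h3 := one_le_card_log_arg hδ hδ1 h1 t
      have h2 : Real.log (8 * (idealRun P truth W t).active.card * ((t : ℝ) + 1) ^ 2 / P.δ) ≤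
          Real.log (8 * K * ((t : ℝ) + 1) ^ 2 / P.δ) :=
        Real.log_le_log (by linarith) (by gcongr)
      have h4 := Real.log_nonneg h3
      refine (add_le_add_left (Nat.floor_le (by positivity)) 1).trans ?_
      unfold maxCount
      gcongr
  have h0 : ((idealRun P truth W t).count : ℝ) ≤ maxCount P K t := by
    induction t with
    | zero => simpa [idealRun] using (maxCount_pos hδ hδ1 hK 0).le
    | succ t ih => exact (key t ih).trans (maxCount_mono hγ hκ hδ hδ1 hK le_rfl t.le_succ)
  exact ⟨h0, key t h0⟩

lemma idealRun_duels_le {t₀ U : ℕ} (hU : ∀ t, t₀ ≤ t → (idealRun P truth W t).active.card ≤ U)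
    {t : ℕ} (ht : t₀ ≤ t) : (idealRun P truth W t).duels ≤
      K * (idealRun P truth W t₀).count +
        U * ((idealRun P truth W t).count - (idealRun P truth W t₀).count) := by
  have step : ∀ (t V : ℕ), (idealRun P truth W t).active.card ≤ V →
      (idealRun P truth W (t + 1)).duels ≤ (idealRun P truth W t).duels +
        V * ((idealRun P truth W (t + 1)).count - (idealRun P truth W t).count) := by
    intro t V hV
    rcases (idealRun P truth W t).active.eq_empty_or_nonempty with he | he
    · rw [idealRun_succ_of_empty he]; simp
    · rw [idealRun_count_succ he, idealRun_succ_of_nonempty he]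
      exact Nat.add_le_add_left (Nat.mul_le_mul_right _ hV) _
  have h0 : ∀ t, (idealRun P truth W t).duels ≤ K * (idealRun P truth W t).count := by
    intro t
    induction t with
    | zero => simp [idealRun]
    | succ t ih =>
      have h1 := step t K ((card_idealRun_le P truth W t).trans (Nat.sub_le _ _))
      have h2 := idealRun_count_le_succ (P := P) (truth := truth) (W := W) t
      have h3 : K * (idealRun P truth W t).count +
          K * ((idealRun P truth W (t + 1)).count - (idealRun P truth W t).count)
          = K * (idealRun P truth W (t + 1)).count := by rw [← Nat.mul_add]; congr 1; omega
      omega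
  induction t, ht using Nat.le_induction with
  | base => simpa using h0 t₀
  | succ t ht ih =>
    have h1 := step t U (hU t ht)
    have h2 := idealRun_count_le_succ (P := P) (truth := truth) (W := W) t
    have h4 := idealRun_count_mono (P := P) (truth := truth) (W := W) ht
    have h3 : U * ((idealRun P truth W t).count - (idealRun P truth W t₀).count) +
        U * ((idealRun P truth W (t + 1)).count - (idealRun P truth W t).count)
        = U * ((idealRun P truth W (t + 1)).count - (idealRun P truth W t₀).count) := by
      rw [← Nat.mul_add]; congr 1; omega
    omega

lemma idealRun_label {T : ℕ} (hcross : ∀ t < T, (idealRun P truth W t).active.Nonempty →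
      ∀ i k, truth i = true → truth k = false →
        avg W k (rankCount P truth W t) - avg W i (rankCount P truth W t) ≤ 2 * P.γ t) :
    ∀ i, i ∉ (idealRun P truth W T).active → (idealRun P truth W T).label i = truth i := by
  induction T with
  | zero => simp [idealRun]
  | succ T ih =>
    have ih' := ih fun t ht => hcross t (by omega)
    rcases (idealRun P truth W T).active.eq_empty_or_nonempty with he | he
    · rw [idealRun_succ_of_empty he]; exact ih'
    · rw [idealRun_succ_of_nonempty he]
      intro i hi
      exact idealRound_label (fun i _ k _ hit hkt => hcross T (by omega) he i k hit hkt) ih' hi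

lemma folBound_roundConfidence_le (hδ : 0 < P.δ) (hK : 1 ≤ K) {t : ℕ} (s : RSState K) :
    folBound P.R (roundConfidence P t s) ≤ 3 * (2 ^ 20 * P.R ^ 4 + 256 * P.R ^ 2 + 128) *
      (Real.log (160 / P.δ) + 2 * Real.log ((t : ℝ) + 1) + Real.log (1 + Real.log K)) := by
  have hK' : (1 : ℝ) ≤ K := by exact_mod_cast hK
  have hlK := Real.log_nonneg hK'
  have ht : (0 : ℝ) < (t : ℝ) + 1 := by positivity
  have hδ₀ : 0 < P.δ / (4 * ((t : ℝ) + 1) ^ 2) := by positivity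
  have hconf : P.δ / (4 * ((t : ℝ) + 1) ^ 2) / (1 + Real.log K) ≤ roundConfidence P t s := by
    unfold roundConfidence callConfidence
    split_ifs with hs
    · exact div_le_self hδ₀.le (by linarith)
    · have hs1 : (1 : ℝ) < s.active.card := by exact_mod_cast not_le.1 hs
      have hsK : (s.active.card : ℝ) ≤ K := by
        exact_mod_cast (Finset.card_le_univ s.active).trans (by simp)
      have := Real.log_le_log (by linarith) hsK
      exact div_le_div_of_nonneg_left hδ₀.le (Real.log_pos hs1) (by linarith)
  have hlog : Real.log (40 / roundConfidence P t s) ≤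
      Real.log (160 / P.δ) + 2 * Real.log ((t : ℝ) + 1) + Real.log (1 + Real.log K) := by
    have h1 : 40 / (P.δ / (4 * ((t : ℝ) + 1) ^ 2) / (1 + Real.log K))
        = 160 / P.δ * ((t : ℝ) + 1) ^ 2 * (1 + Real.log K) := by field_simp; norm_num
    have h2 : Real.log (160 / P.δ * ((t : ℝ) + 1) ^ 2 * (1 + Real.log K)) =
        Real.log (160 / P.δ) + 2 * Real.log ((t : ℝ) + 1) + Real.log (1 + Real.log K) := by
      rw [Real.log_mul (by positivity) (by positivity), Real.log_mul (by positivity) (by positivity),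
        Real.log_pow]
      push_cast; ring
    rw [← h2, ← h1]
    have h3 : 0 < P.δ / (4 * ((t : ℝ) + 1) ^ 2) / (1 + Real.log K) := by positivity
    exact Real.log_le_log (div_pos (by norm_num) (callConfidence_pos hδ₀ _)) (by gcongr)
  unfold folBound
  rw [mul_assoc]
  gcongr

lemma roundPulls_le (hδ : 0 < P.δ) (hδ1 : P.δ ≤ 1 / 2) (hK : 1 ≤ K) {t : ℕ} {U : ℝ} (hU1 : 1 ≤ U)
    (hU : ((idealRun P truth W t).active.card : ℝ) ≤ U) : roundPulls P truth W t ≤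
      2 * (1 + Real.log U) * (3 * (2 ^ 20 * P.R ^ 4 + 256 * P.R ^ 2 + 128) *
      (Real.log (160 / P.δ) + 2 * Real.log ((t : ℝ) + 1) + Real.log (1 + Real.log K))) := by
  have hlU := Real.log_nonneg hU1
  have hK' : (1 : ℝ) ≤ K := by exact_mod_cast hK
  have h1 : 0 ≤ Real.log (160 / P.δ) := Real.log_nonneg (by rw [le_div_iff₀ hδ]; linarith)
  have h2 : 0 ≤ Real.log ((t : ℝ) + 1) :=
    Real.log_nonneg (by linarith [(Nat.cast_nonneg t : (0 : ℝ) ≤ t)])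
  have h3 : 0 ≤ Real.log (1 + Real.log K) := Real.log_nonneg (by linarith [Real.log_nonneg hK'])
  unfold roundPulls
  split_ifs with hne
  · have h4 := two_pow_length_idealCalls P truth W t _ hne
    set m := (idealCalls P truth W t (idealRun P truth W t)).length
    have h5 : (m : ℝ) * Real.log 2 ≤ Real.log 2 + Real.log U := by
      rw [← Real.log_pow, ← Real.log_mul (by norm_num) (by positivity)]
      refine Real.log_le_log (by positivity) ?_
      have : (2 : ℝ) ^ m ≤ 2 * (idealRun P truth W t).active.card := by exact_mod_cast h4
      linarith
    have hl2 := Real.log_two_gt_d9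
    have h6 : (m : ℝ) ≤ 2 * (1 + Real.log U) := by
      have : (0 : ℝ) ≤ m := Nat.cast_nonneg m
      nlinarith
    refine (mul_le_mul_of_nonneg_left (folBound_roundConfidence_le hδ hK _)
      (Nat.cast_nonneg m)).trans ?_
    exact mul_le_mul_of_nonneg_right h6 (by positivity)
  · positivity

end Bounds


/-! ### Duels under the linear link -/

section Linear

variable {K : ℕ}

lemma linearLink_mem {μ : Fin K → ℝ} (hμ : ∀ i, μ i ∈ Set.Icc (0 : ℝ) 1) (i j : Fin K) :
    linearLink μ i j ∈ Set.Icc (0 : ℝ) 1 := by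
  have h1 := hμ i
  have h2 := hμ j
  unfold linearLink
  constructor <;> linarith [h1.1, h1.2, h2.1, h2.2]

/-- The win probability against a random opponent of an arm whose mean is the threshold. -/
noncomputable def midScore (μ : Fin K → ℝ) : ℝ := 1 / 2 + (1 / 2 - (∑ j, μ j) / K) / 2

lemma meanScore_linearLink [NeZero K] (μ : Fin K → ℝ) (i : Fin K) :
    meanScore (linearLink μ) i = midScore μ + (μ i - 1 / 2) / 2 := by
  have hK : (K : ℝ) ≠ 0 := NeZero.ne _
  have : ∑ j, linearLink μ i j = (K * (1 + μ i) - ∑ j, μ j) / 2 := by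
    unfold linearLink
    rw [← Finset.sum_div, Finset.sum_sub_distrib]
    simp
    ring
  rw [meanScore, midScore, this]
  field_simp
  ring

/-- The true labels for the threshold `1 / 2`. -/
noncomputable def isPos (μ : Fin K → ℝ) (i : Fin K) : Bool := decide (1 / 2 ≤ μ i)

/-- The excess of the win rate of an arm over `midScore`, counted towards the class of the arm. -/
noncomputable def adv (μ : Fin K → ℝ) (W : Fin K × ℕ → Bool) (n : ℕ) (i : Fin K) : ℝ :=
  sgn (isPos μ i) * (avg W i n - midScore μ)

lemma sgn_mul_sub (μ : Fin K → ℝ) (i : Fin K) :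
    sgn (isPos μ i) * (μ i - 1 / 2) = |μ i - 1 / 2| := by
  unfold sgn isPos
  by_cases h : 1 / 2 ≤ μ i
  · simp only [h, decide_true, if_true]
    rw [abs_of_nonneg (by linarith)]; ring
  · simp only [h, decide_false, Bool.false_eq_true, if_false]
    rw [abs_of_neg (by linarith)]; ring

lemma sgn_sq (y : Bool) : sgn y ^ 2 = 1 := by cases y <;> simp [sgn]

variable {μ : Fin K → ℝ} {W : Fin K × ℕ → Bool} {P : RSParams}

lemma avg_sub_avg_eq {n : ℕ} {i k : Fin K} (hi : isPos μ i = true) (hk : isPos μ k = false) :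
    avg W k n - avg W i n = -(adv μ W n k + adv μ W n i) := by
  unfold adv
  rw [hi, hk]
  simp only [sgn, Bool.false_eq_true, if_false, if_true]
  ring

lemma sixteen_log_le_rankCount {truth : Fin K → Bool} (hγ : P.γ₀ = 1 / 4) (t : ℕ)
    (h : (idealRun P truth W t).active.Nonempty) :
    16 * Real.log (8 * K / P.δ) ≤ rankCount P truth W t := by
  have h0 := le_rankCount (P := P) (truth := truth) (W := W) 0
  have h1 : (rankCount P truth W 0 : ℝ) ≤ rankCount P truth W t := by
    exact_mod_cast rankCount_mono (Nat.zero_le t) h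
  have h2 : (idealRun P truth W 0).active.card = K := by simp [idealRun]
  rw [h2] at h0
  simp only [RSParams.γ, hγ, pow_zero] at h0
  norm_num at h0
  linarith

variable [NeZero K]

lemma adv_low_prob (hμ : ∀ i, μ i ∈ Set.Icc (0 : ℝ) 1) (i : Fin K) {N ε : ℝ}
    (hε : 0 ≤ ε) : rewardLaw (meanScore (linearLink μ))
      {W | ∃ n : ℕ, 1 ≤ n ∧ N ≤ n ∧ adv μ W n i ≤ |μ i - 1 / 2| / 2 - ε}
      ≤ ENNReal.ofReal (Real.exp (-(2 * N * ε ^ 2))) := by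
  refine (measure_mono ?_).trans (rewardLaw_exists_dev_le (meanScore (linearLink μ)) i
    (meanScore_mem (linearLink_mem hμ) i) (c := -sgn (isPos μ i)) (by rw [neg_sq, sgn_sq]) hε)
  rintro W ⟨n, hn, hN, h⟩
  refine ⟨n, hn, hN, ?_⟩
  rw [meanScore_linearLink]
  have := sgn_mul_sub μ i
  unfold adv at h
  linarith

lemma adv_high_prob (hμ : ∀ i, μ i ∈ Set.Icc (0 : ℝ) 1) (i : Fin K) {N ε : ℝ}
    (hε : 0 ≤ ε) : rewardLaw (meanScore (linearLink μ))
      {W | ∃ n : ℕ, 1 ≤ n ∧ N ≤ n ∧ |μ i - 1 / 2| / 2 + ε ≤ adv μ W n i}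
      ≤ ENNReal.ofReal (Real.exp (-(2 * N * ε ^ 2))) := by
  refine (measure_mono ?_).trans (rewardLaw_exists_dev_le (meanScore (linearLink μ)) i
    (meanScore_mem (linearLink_mem hμ) i) (c := sgn (isPos μ i)) (by rw [sgn_sq]) hε)
  rintro W ⟨n, hn, hN, h⟩
  refine ⟨n, hn, hN, ?_⟩
  rw [meanScore_linearLink]
  have := sgn_mul_sub μ i
  unfold adv at h
  linarith

lemma measure_exists_le_ofReal_sum {α ι : Type*} [MeasurableSpace α] (m : Measure α)
    (s : Finset ι) (A : ι → Set α) (f : ι → ℝ) (hf : ∀ i ∈ s, 0 ≤ f i)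
    (h : ∀ i ∈ s, m (A i) ≤ ENNReal.ofReal (f i)) :
    m {a | ∃ i ∈ s, a ∈ A i} ≤ ENNReal.ofReal (∑ i ∈ s, f i) := by
  have : {a | ∃ i ∈ s, a ∈ A i} = ⋃ i ∈ s, A i := by ext a; simp
  rw [this, ENNReal.ofReal_sum_of_nonneg hf]
  exact (measure_biUnion_finset_le _ _).trans (Finset.sum_le_sum h)

/-- For few arms, no negative arm ever seems much better than a positive arm. -/
lemma class_correct_small (hγ : P.γ₀ = 1 / 4) (hκ : 1 < P.κ) (hδ : 0 < P.δ) (hδ1 : P.δ ≤ 1 / 2)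
    (hμ : ∀ i, μ i ∈ Set.Icc (0 : ℝ) 1) (hgap : ∀ i, 1 / 4 ≤ |μ i - 1 / 2|)
    (hK : Real.log (8 * K / P.δ) ≤ 10 * Real.log (8 / P.δ)) :
    rewardLaw (meanScore (linearLink μ)) {W | ¬ ∀ t, (idealRun P (isPos μ) W t).active.Nonempty →
      ∀ i k, isPos μ i = true → isPos μ k = false →
        avg W k (rankCount P (isPos μ) W t) - avg W i (rankCount P (isPos μ) W t) ≤ 2 * P.γ t}
      ≤ ENNReal.ofReal (P.δ / 4) := by
  set L := Real.log (8 * K / P.δ) with hL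
  have hK1 : (1 : ℝ) ≤ K := by exact_mod_cast NeZero.one_le
  have hLpos : 1 ≤ L := by
    rw [hL, Real.le_log_iff_exp_le (by positivity), le_div_iff₀ hδ]
    nlinarith [Real.exp_one_lt_d9]
  have hexpL : Real.exp (-L) = P.δ / (8 * K) := by
    rw [Real.exp_neg, hL, Real.exp_log (by positivity), inv_div]
  let A : Fin K → Set (Fin K × ℕ → Bool) := fun i =>
    {W | ∃ n : ℕ, 1 ≤ n ∧ 16 * L ≤ n ∧ adv μ W n i ≤ |μ i - 1 / 2| / 2 - 13 / 72}
  let B : Fin K → Set (Fin K × ℕ → Bool) := fun i =>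
    {W | ∃ n : ℕ, 1 ≤ n ∧ 32 * L ≤ n ∧ adv μ W n i ≤ |μ i - 1 / 2| / 2 - 1 / 8}
  have hsub : {W | ¬ ∀ t, (idealRun P (isPos μ) W t).active.Nonempty →
      ∀ i k, isPos μ i = true → isPos μ k = false →
        avg W k (rankCount P (isPos μ) W t) - avg W i (rankCount P (isPos μ) W t) ≤ 2 * P.γ t}
      ⊆ {W | ∃ i ∈ Finset.univ, W ∈ A i} ∪ {W | ∃ i ∈ Finset.univ, W ∈ B i} := by
    intro W hW
    by_contra hcon
    simp only [Set.mem_union, not_or] at hcon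
    obtain ⟨hA, hB⟩ := hcon
    refine hW fun t ht i k hi hk => ?_
    have h16 := sixteen_log_le_rankCount hγ t ht
    rw [← hL] at h16
    set n := rankCount P (isPos μ) W t with hn
    have hn1 : 1 ≤ n := by
      have : (0 : ℝ) < n := by linarith
      exact_mod_cast this
    rw [avg_sub_avg_eq hi hk]
    rcases le_or_gt (1 / 18) (P.γ t) with hγt | hγt
    · have hA' : ∀ j, |μ j - 1 / 2| / 2 - 13 / 72 < adv μ W n j := fun j => by
        by_contra h
        exact hA ⟨j, Finset.mem_univ j, n, hn1, h16, not_lt.1 h⟩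
      linarith [hA' i, hA' k, hgap i, hgap k]
    · have hγ0 := gamma_pos (P := P) (by rw [hγ]; norm_num) hκ t
      have h32 : 32 * L ≤ n := by
        refine le_trans ?_ (le_rankCount (P := P) (truth := isPos μ) (W := W) t)
        have h1 : 324 ≤ 1 / P.γ t ^ 2 := by
          rw [le_div_iff₀ (by positivity)]
          nlinarith
        have hc : (1 : ℝ) ≤ (idealRun P (isPos μ) W t).active.card := by exact_mod_cast ht.card_pos
        have ht1 : (1 : ℝ) ≤ ((t : ℝ) + 1) ^ 2 :=
          one_le_pow₀ (by linarith [(Nat.cast_nonneg t : (0 : ℝ) ≤ t)])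
        have h2 : Real.log (8 / P.δ) ≤
            Real.log (8 * (idealRun P (isPos μ) W t).active.card * ((t : ℝ) + 1) ^ 2 / P.δ) := by
          refine Real.log_le_log (by positivity) ?_
          gcongr
          nlinarith
        have h3 : 0 ≤ Real.log (8 / P.δ) := Real.log_nonneg (by rw [le_div_iff₀ hδ]; linarith)
        have h4 := mul_le_mul h1 h2 h3 (by positivity)
        linarith
      have hB' : ∀ j, |μ j - 1 / 2| / 2 - 1 / 8 < adv μ W n j := fun j => by
        by_contra h
        exact hB ⟨j, Finset.mem_univ j, n, hn1, h32, not_lt.1 h⟩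
      linarith [hB' i, hB' k, hgap i, hgap k]
  have hbound : ∀ c : ℝ, L ≤ c → ∑ _i : Fin K, Real.exp (-c) ≤ P.δ / 8 := by
    intro c hc
    rw [Finset.sum_const, Finset.card_univ, Fintype.card_fin, nsmul_eq_mul]
    calc (K : ℝ) * Real.exp (-c) ≤ K * Real.exp (-L) := by gcongr
      _ = P.δ / 8 := by rw [hexpL]; field_simp
  have h1 : rewardLaw (meanScore (linearLink μ)) {W | ∃ i ∈ Finset.univ, W ∈ A i}
      ≤ ENNReal.ofReal (P.δ / 8) := by
    refine (measure_exists_le_ofReal_sum _ _ A _ (fun _ _ => (Real.exp_pos _).le)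
      fun i _ => adv_low_prob hμ i (by norm_num)).trans (ENNReal.ofReal_le_ofReal (hbound _ ?_))
    linarith
  have h2 : rewardLaw (meanScore (linearLink μ)) {W | ∃ i ∈ Finset.univ, W ∈ B i}
      ≤ ENNReal.ofReal (P.δ / 8) := by
    refine (measure_exists_le_ofReal_sum _ _ B _ (fun _ _ => (Real.exp_pos _).le)
      fun i _ => adv_low_prob hμ i (by norm_num)).trans (ENNReal.ofReal_le_ofReal (hbound _ ?_))
    linarith
  refine (measure_mono hsub).trans ((measure_union_le _ _).trans ((add_le_add h1 h2).trans ?_))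
  rw [← ENNReal.ofReal_add (by positivity) (by positivity)]
  exact ENNReal.ofReal_le_ofReal (by linarith)

/-- The distance of an arm from the gap `1 / 4`, in units of win rate. -/
noncomputable def excess (μ : Fin K → ℝ) (i : Fin K) : ℝ := (|μ i - 1 / 2| - 1 / 4) / 2

/-- For many arms, all positive arms always seem better than all negative arms. -/
lemma class_correct_large {δ lam : ℝ} (hδ : 0 < δ) (hδ1 : δ ≤ 1 / 2)
    (hμ : ∀ i, μ i ∈ Set.Icc (0 : ℝ) 1) (hgap : ∀ i, 1 / 4 ≤ |μ i - 1 / 2|)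
    (hlam : lam ≤ 4 * Real.log (8 * K / δ)) (hlam0 : 0 ≤ lam)
    (hsum : ∑ i, Real.exp (-(2 * lam * excess μ i)) ≤ lam)
    (hK : 10 * Real.log (8 / δ) ≤ Real.log (8 * K / δ)) :
    rewardLaw (meanScore (linearLink μ))
      {W | ¬ ∀ i, ∀ n : ℕ, 1 ≤ n → 16 * Real.log (8 * K / δ) ≤ n → 0 < adv μ W n i}
      ≤ ENNReal.ofReal (δ / 4) := by
  set L := Real.log (8 * K / δ) with hL
  have hK1 : (1 : ℝ) ≤ K := by exact_mod_cast NeZero.one_le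
  let A : Fin K → Set (Fin K × ℕ → Bool) := fun i =>
    {W | ∃ n : ℕ, 1 ≤ n ∧ 16 * L ≤ n ∧ adv μ W n i ≤ |μ i - 1 / 2| / 2 - |μ i - 1 / 2| / 2}
  have hsub : {W | ¬ ∀ i, ∀ n : ℕ, 1 ≤ n → 16 * L ≤ n → 0 < adv μ W n i}
      ⊆ {W | ∃ i ∈ Finset.univ, W ∈ A i} := by
    intro W hW
    replace hW : ¬ ∀ i, ∀ n : ℕ, 1 ≤ n → 16 * L ≤ n → 0 < adv μ W n i := hW
    push Not at hW
    obtain ⟨i, n, hn, hnL, h⟩ := hW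
    exact ⟨i, Finset.mem_univ i, n, hn, hnL, by rw [sub_self]; exact h⟩
  refine (measure_mono hsub).trans ((measure_exists_le_ofReal_sum _ _ A _
    (fun _ _ => (Real.exp_pos _).le) fun i _ => adv_low_prob hμ i
      (by have := abs_nonneg (μ i - 1 / 2); positivity)).trans (ENNReal.ofReal_le_ofReal ?_))
  have hlog16 : 27 / 10 ≤ Real.log (8 / δ) := by
    have h1 : Real.log 16 ≤ Real.log (8 / δ) :=
      Real.log_le_log (by norm_num) (by rw [le_div_iff₀ hδ]; linarith)
    have h2 : Real.log 16 = 4 * Real.log 2 := by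
      rw [show (16 : ℝ) = 2 ^ 4 by norm_num, Real.log_pow]; norm_num
    linarith [Real.log_two_gt_d9]
  have hL27 : 27 ≤ L := by linarith
  have hterm : ∀ i, Real.exp (-(2 * (16 * L) * (|μ i - 1 / 2| / 2) ^ 2))
      ≤ Real.exp (-(L / 2)) * Real.exp (-(2 * lam * excess μ i)) := by
    intro i
    rw [← Real.exp_add]
    refine Real.exp_le_exp.2 ?_
    have hz : |μ i - 1 / 2| / 2 = 1 / 8 + excess μ i := by unfold excess; ring
    have hz0 : 0 ≤ excess μ i := by unfold excess; linarith [hgap i]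
    rw [hz]
    have h1 : lam * excess μ i ≤ 4 * L * excess μ i := mul_le_mul_of_nonneg_right hlam hz0
    nlinarith [sq_nonneg (excess μ i)]
  refine (Finset.sum_le_sum fun i _ => hterm i).trans ?_
  rw [← Finset.mul_sum]
  have hexp : Real.exp (-(L / 10)) ≤ δ / 8 := by
    calc Real.exp (-(L / 10)) ≤ Real.exp (-Real.log (8 / δ)) := by gcongr; linarith
      _ = δ / 8 := by rw [Real.exp_neg, Real.exp_log (by positivity), inv_div]
  have h2L : 2 * L ≤ Real.exp (2 / 5 * L) := by
    have := Real.quadratic_le_exp_of_nonneg (show 0 ≤ 2 / 5 * L by linarith)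
    nlinarith
  calc Real.exp (-(L / 2)) * ∑ i, Real.exp (-(2 * lam * excess μ i))
      ≤ Real.exp (-(L / 2)) * (4 * L) := by gcongr; exact hsum.trans hlam
    _ = 2 * (Real.exp (-(L / 2)) * (2 * L)) := by ring
    _ ≤ 2 * (Real.exp (-(L / 2)) * Real.exp (2 / 5 * L)) := by gcongr
    _ = 2 * Real.exp (-(L / 10)) := by rw [← Real.exp_add]; congr 2; ring
    _ ≤ δ / 4 := by linarith

end Linear


/-! ### Rank-Search on boundedly many arms -/

section FewArms

lemma rankSearch_few_arms {P : RSParams} (hτ : P.τ = 1 / 2) (hR : 1 / 2 ≤ P.R) (hδ : 0 < P.δ)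
    (hδ1 : P.δ ≤ 1 / 2) (hγ : P.γ₀ = 1 / 4) (hκ : 1 < P.κ) (K₀ : ℕ) :
    ∃ C : ℝ, ∀ (K : ℕ) [NeZero K], 2 ≤ K → K ≤ K₀ → ∀ μ : Fin K → ℝ,
      (∀ i, μ i ∈ Set.Icc (0 : ℝ) 1) → (∀ i, 1 / 4 ≤ |μ i - 1 / 2|) →
      rewardLaw (meanScore (linearLink μ)) {W | ¬ ∀ t, (idealRun P (isPos μ) W t).active.Nonempty →
        ∀ i k, isPos μ i = true → isPos μ k = false →
          avg W k (rankCount P (isPos μ) W t) - avg W i (rankCount P (isPos μ) W t) ≤ 2 * P.γ t}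
        ≤ ENNReal.ofReal (P.δ / 4) → ∀ C' ≥ C,
      ENNReal.ofReal (1 - P.δ) ≤ sampleLaw (linearLink μ) μ
        {ω | RSReturns P ω (positiveSet (1 / 2) μ) (C' * K * Real.log K ^ 3)
          (C' * Real.log K ^ 2)} := by
  set D := maxCount P K₀ K₀ with hD
  set b := 2 * (1 + Real.log K₀) * (3 * (2 ^ 20 * P.R ^ 4 + 256 * P.R ^ 2 + 128) *
      (Real.log (160 / P.δ) + 2 * Real.log ((K₀ : ℝ) + 1) + Real.log (1 + Real.log K₀))) with hb
  have hγ0 : 0 < P.γ₀ := by rw [hγ]; norm_num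
  refine ⟨(D + K₀ * b) / Real.log 2 ^ 3, fun K _ hK2 hK μ hμ hgap hcross C' hC' => ?_⟩
  have hK₀ : (2 : ℝ) ≤ K₀ := by exact_mod_cast hK2.trans hK
  have hK1 : (1 : ℝ) ≤ K := by exact_mod_cast (by omega : 1 ≤ K)
  have hKK : (K : ℝ) ≤ K₀ := by exact_mod_cast hK
  have hlK₀ := Real.log_nonneg (by linarith : (1 : ℝ) ≤ K₀)
  have hlK := Real.log_nonneg hK1
  have hl160 : 0 ≤ Real.log (160 / P.δ) := Real.log_nonneg (by rw [le_div_iff₀ hδ]; linarith)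
  have hb0 : 0 ≤ b := by
    have h1 : 0 ≤ Real.log ((K₀ : ℝ) + 1) := Real.log_nonneg (by linarith)
    have h2 : 0 ≤ Real.log (1 + Real.log K₀) := Real.log_nonneg (by linarith)
    positivity
  have hD0 : 0 ≤ D := (maxCount_pos hδ hδ1 (by omega) K₀).le
  have hl2 := Real.log_two_gt_d9
  have hl2' := Real.log_two_lt_d9
  have hlogK : Real.log 2 ≤ Real.log K := Real.log_le_log (by norm_num) (by exact_mod_cast hK2)
  have hl3 : Real.log 2 ^ 3 ≤ Real.log K ^ 3 := by gcongr
  have hl23 : Real.log 2 ^ 3 ≤ Real.log K ^ 2 := by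
    calc Real.log 2 ^ 3 ≤ Real.log 2 ^ 2 :=
          pow_le_pow_of_le_one (by linarith) (by linarith) (by norm_num)
      _ ≤ Real.log K ^ 2 := by gcongr
  rw [ge_iff_le, div_le_iff₀ (by positivity)] at hC'
  have hC0 : 0 ≤ C' := by
    by_contra h
    have : C' * Real.log 2 ^ 3 < 0 := mul_neg_of_neg_of_pos (not_le.1 h) (by positivity)
    have : 0 ≤ K₀ * b := by positivity
    linarith
  refine rankSearch_spec (linearLink_mem hμ) hτ hR hδ hδ1 hμ hgap {W | ∀ t,
    (idealRun P (isPos μ) W t).active.Nonempty → ∀ i k, isPos μ i = true → isPos μ k = false →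
      avg W k (rankCount P (isPos μ) W t) - avg W i (rankCount P (isPos μ) W t) ≤ 2 * P.γ t}
    (hcross.trans (ENNReal.ofReal_le_ofReal (by linarith))) fun W hW => ?_
  change ∃ T, (idealRun P (isPos μ) W T).active = ∅ ∧
    (∀ i, (idealRun P (isPos μ) W T).label i = isPos μ i) ∧ _ ∧ _
  have hempty : (idealRun P (isPos μ) W K).active = ∅ := by
    have := card_idealRun_le P (isPos μ) W K
    exact Finset.card_eq_zero.1 (by omega)
  refine ⟨K, hempty, fun i => idealRun_label (fun t _ => hW t) i (by simp [hempty]), ?_, ?_⟩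
  · have h1 := idealRun_duels_le (P := P) (truth := isPos μ) (W := W) (t₀ := K) (U := 0)
      (fun t ht => by have := card_idealRun_le P (isPos μ) W t; omega) le_rfl
    rw [zero_mul, add_zero] at h1
    have h2 := (idealRun_count_le (P := P) (truth := isPos μ) (W := W) hγ0 hκ hδ hδ1
      (by omega : 1 ≤ K) K).1.trans (maxCount_mono hγ0 hκ hδ hδ1 (by omega) hK hK)
    calc ((idealRun P (isPos μ) W K).duels : ℝ) ≤ K * (idealRun P (isPos μ) W K).count := by
          exact_mod_cast h1
      _ ≤ K * D := by gcongr
      _ ≤ K * (C' * Real.log 2 ^ 3) := by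
          gcongr
          have : 0 ≤ K₀ * b := by positivity
          linarith
      _ ≤ K * (C' * Real.log K ^ 3) := by gcongr
      _ = C' * K * Real.log K ^ 3 := by ring
  · have h1 : ∀ t ∈ Finset.range K, roundPulls P (isPos μ) W t ≤ b := by
      intro t ht
      have htK : (t : ℝ) ≤ K₀ := by
        exact_mod_cast (Finset.mem_range.1 ht).le.trans hK
      refine (roundPulls_le hδ hδ1 (by omega) hK1 (by
        exact_mod_cast (card_idealRun_le P (isPos μ) W t).trans (Nat.sub_le _ _))).trans ?_
      have h2 : 0 ≤ Real.log ((t : ℝ) + 1) :=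
        Real.log_nonneg (by linarith [(Nat.cast_nonneg t : (0 : ℝ) ≤ t)])
      have h3 : 0 ≤ Real.log (1 + Real.log K) := Real.log_nonneg (by linarith)
      have h4 : Real.log K ≤ Real.log K₀ := Real.log_le_log (by linarith) hKK
      rw [hb]
      gcongr
    calc ∑ t ∈ Finset.range K, roundPulls P (isPos μ) W t ≤ ∑ t ∈ Finset.range K, b :=
          Finset.sum_le_sum h1
      _ = K * b := by simp
      _ ≤ K₀ * b := by gcongr
      _ ≤ C' * Real.log 2 ^ 3 := by linarith
      _ ≤ C' * Real.log K ^ 2 := by gcongr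

end FewArms


/-! ### Course of Rank-Search on many arms -/

section ManyArms

variable {K : ℕ} {P : RSParams} {μ : Fin K → ℝ} {W : Fin K × ℕ → Bool}

/-- All arms are always on the correct side. -/
def Separated (μ : Fin K → ℝ) (W : Fin K × ℕ → Bool) (N : ℝ) : Prop :=
  ∀ i, ∀ n : ℕ, 1 ≤ n → N ≤ n → 0 < adv μ W n i

lemma Separated.rankCount (h : Separated μ W (16 * Real.log (8 * K / P.δ))) (hγ : P.γ₀ = 1 / 4)
    (hK : 0 < Real.log (8 * K / P.δ)) {t : ℕ}
    (ht : (idealRun P (isPos μ) W t).active.Nonempty) (i : Fin K) :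
    0 < adv μ W (rankCount P (isPos μ) W t) i := by
  have h16 := sixteen_log_le_rankCount (truth := isPos μ) (W := W) hγ t ht
  refine h i _ ?_ h16
  have : (0 : ℝ) < TBPDC.rankCount P (isPos μ) W t := by linarith
  exact_mod_cast this

/-- The comparison of an arm with the worst active arm of its class. -/
lemma exists_reference (h : Separated μ W (16 * Real.log (8 * K / P.δ))) (hγ : P.γ₀ = 1 / 4)
    (hκ : 1 < P.κ) (hK : 0 < Real.log (8 * K / P.δ)) {t : ℕ} {i : Fin K}
    (hi : i ∈ (idealRun P (isPos μ) W t).active) :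
    ∃ j ∈ (idealRun P (isPos μ) W t).active, isPos μ j = isPos μ i ∧
      j ∉ (idealRun P (isPos μ) W (t + 1)).active ∧
      (∀ k ∈ (idealRun P (isPos μ) W t).active, isPos μ k = isPos μ i →
        adv μ W (rankCount P (isPos μ) W t) j ≤ adv μ W (rankCount P (isPos μ) W t) k) ∧
      (2 * P.γ t < adv μ W (rankCount P (isPos μ) W t) i - adv μ W (rankCount P (isPos μ) W t) j →
        i ∉ (idealRun P (isPos μ) W (t + 1)).active) ∧
      (i ∉ (idealRun P (isPos μ) W (t + 1)).active →
        (i, isPos μ i) ∈ idealCalls P (isPos μ) W t (idealRun P (isPos μ) W t) ∨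
        2 * P.γ t < adv μ W (rankCount P (isPos μ) W t) i
          - adv μ W (rankCount P (isPos μ) W t) j) := by
  have hne : (idealRun P (isPos μ) W t).active.Nonempty := ⟨i, hi⟩
  have hpos := h.rankCount hγ hK hne
  obtain ⟨j, hj, hjt, hj', hmin, h1, h2⟩ := idealRound_separated (W := W)
    (gamma_pos (P := P) (by rw [hγ]; norm_num) hκ t).le (truth := isPos μ)
    (s := idealRun P (isPos μ) W t) (fun i _ k _ hit hkt => by
      have := avg_sub_avg_eq (W := W) (n := rankCount P (isPos μ) W t) hit hkt
      have h3 := hpos i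
      have h4 := hpos k
      unfold rankCount at this h3 h4
      linarith) hi
  rw [← idealRun_succ_of_nonempty hne] at hj' h1 h2
  have hadv : ∀ k, isPos μ k = isPos μ i → adv μ W (rankCount P (isPos μ) W t) k
      = sgn (isPos μ i) * avg W k (P.newCount t (idealRun P (isPos μ) W t).active.card
        (idealRun P (isPos μ) W t).count) - sgn (isPos μ i) * midScore μ := by
    intro k hk
    unfold adv rankCount
    rw [hk]; ring
  refine ⟨j, hj, hjt, hj', fun k hk hkt => ?_, ?_, ?_⟩
  · rw [hadv j hjt, hadv k hkt]
    linarith [hmin k hk hkt]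
  · rw [hadv j hjt, hadv i rfl]
    intro h
    exact h1 (by linarith)
  · rw [hadv j hjt, hadv i rfl]
    intro h
    exact (h2 h).imp_right fun h => by linarith

/-- The win rates needed in the first `tw + 1` rounds: arms with almost minimal gap are close to
`1 / 8`, and arms with larger gap are not below. -/
structure EarlyRounds (P : RSParams) (μ : Fin K → ℝ) (W : Fin K × ℕ → Bool) (N : ℕ → ℝ) (tw : ℕ) :
    Prop where
  lower : ∀ t ≤ tw, ∀ i, ∀ n : ℕ, 1 ≤ n → N t ≤ n → 1 / 8 - P.γ t < adv μ W n i
  upper : ∀ t ≤ tw, ∀ i, excess μ i ≤ P.γ t / 5 → ∀ n : ℕ, 1 ≤ n → N t ≤ n →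
    adv μ W n i < 1 / 8 + P.γ t
  large : ∀ i, 8 * P.γ tw ≤ excess μ i → ∀ n : ℕ, 1 ≤ n → N tw ≤ n → 1 / 8 + 3 * P.γ tw < adv μ W n i

/-- There are so many arms with almost minimal gap that the comparison counts of the first `tw + 1`
rounds are at least `N`. -/
structure ManyClose (P : RSParams) (μ : Fin K → ℝ) (N : ℕ → ℝ) (tw : ℕ) (c : ℕ → ℕ) : Prop where
  count_pos : ∀ t ≤ tw, 0 < c t
  count_le : ∀ t ≤ tw, ∀ y, c t + (t + 1) * Nat.log 2 (2 * K) ≤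
    (Finset.univ.filter fun i => excess μ i ≤ P.γ t / 5 ∧ isPos μ i = y).card
  le_log : ∀ t ≤ tw, ∀ s : ℕ, c t ≤ s →
    N t ≤ 1 / P.γ t ^ 2 * Real.log (8 * s * ((t : ℝ) + 1) ^ 2 / P.δ)

section

variable {N : ℕ → ℝ} {tw : ℕ} {c : ℕ → ℕ}

lemma ManyClose.exists_mem (hM : ManyClose P μ N tw c) {t : ℕ} (ht : t ≤ tw) {Q : Finset (Fin K)}
    (hQ : Q.card ≤ t * Nat.log 2 (2 * K))
    (hF : ∀ i, excess μ i ≤ P.γ t / 5 → i ∈ (idealRun P (isPos μ) W t).active ∨ i ∈ Q) :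
    (∀ y, ∃ i ∈ (idealRun P (isPos μ) W t).active, excess μ i ≤ P.γ t / 5 ∧ isPos μ i = y) ∧
      N t ≤ rankCount P (isPos μ) W t := by
  have hcard : ∀ y, c t ≤ (((idealRun P (isPos μ) W t).active.filter fun i =>
      excess μ i ≤ P.γ t / 5 ∧ isPos μ i = y)).card := by
    intro y
    have h1 := hM.count_le t ht y
    have h2 : (Finset.univ.filter fun i => excess μ i ≤ P.γ t / 5 ∧ isPos μ i = y) ⊆
        ((idealRun P (isPos μ) W t).active.filter fun i =>
          excess μ i ≤ P.γ t / 5 ∧ isPos μ i = y) ∪ Q := by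
      intro i hi
      rw [Finset.mem_filter] at hi
      rw [Finset.mem_union, Finset.mem_filter]
      exact (hF i hi.2.1).imp_left fun h => ⟨h, hi.2⟩
    have h3 := (Finset.card_le_card h2).trans (Finset.card_union_le _ _)
    rw [Nat.add_mul] at h1
    omega
  refine ⟨fun y => ?_, ?_⟩
  · obtain ⟨i, hi⟩ := Finset.card_pos.1 ((hM.count_pos t ht).trans_le (hcard y))
    rw [Finset.mem_filter] at hi
    exact ⟨i, hi⟩
  · exact (hM.le_log t ht _ ((hcard true).trans (Finset.card_filter_le _ _))).trans (le_rankCount t)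

lemma close_arms_survive (h : Separated μ W (16 * Real.log (8 * K / P.δ))) (hγ : P.γ₀ = 1 / 4)
    (hκ : 1 < P.κ) (hK : 0 < Real.log (8 * K / P.δ)) (hE : EarlyRounds P μ W N tw)
    (hM : ManyClose P μ N tw c) {t : ℕ} (ht : t ≤ tw + 1) : ∃ Q : Finset (Fin K),
      Q.card ≤ t * Nat.log 2 (2 * K) ∧
      ∀ i, excess μ i ≤ P.γ t / 5 → i ∈ (idealRun P (isPos μ) W t).active ∨ i ∈ Q := by
  induction t with
  | zero => exact ⟨∅, by simp, fun i _ => Or.inl (by simp [idealRun])⟩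
  | succ t ih =>
    obtain ⟨Q, hQ, hF⟩ := ih (by omega)
    have htw : t ≤ tw := by omega
    obtain ⟨hex, hN⟩ := hM.exists_mem htw hQ hF
    obtain ⟨f, hf, -⟩ := hex true
    have hne : (idealRun P (isPos μ) W t).active.Nonempty := ⟨f, hf⟩
    have hn1 : 1 ≤ rankCount P (isPos μ) W t := le_max_of_le_right (Nat.le_add_left _ _)
    set T := idealCalls P (isPos μ) W t (idealRun P (isPos μ) W t) with hT
    refine ⟨Q ∪ (T.map Prod.fst).toFinset, ?_, fun i hi => ?_⟩
    · have h1 := two_pow_length_idealCalls P (isPos μ) W t _ hne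
      have h2 : (idealRun P (isPos μ) W t).active.card ≤ K :=
        (card_idealRun_le P (isPos μ) W t).trans (Nat.sub_le _ _)
      have h3 : T.length ≤ Nat.log 2 (2 * K) :=
        Nat.le_log_of_pow_le (by norm_num) (h1.trans (Nat.mul_le_mul_left 2 h2))
      have h4 := List.toFinset_card_le (T.map Prod.fst)
      rw [List.length_map] at h4
      have h5 := Finset.card_union_le Q (T.map Prod.fst).toFinset
      rw [Nat.add_mul]
      omega
    · have hγγ := gamma_anti (P := P) (by rw [hγ]; norm_num) hκ (Nat.le_succ t)
      have hi' : excess μ i ≤ P.γ t / 5 := by linarith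
      by_contra hcon
      simp only [Finset.mem_union, not_or] at hcon
      obtain ⟨hiS, hiQ, hiT⟩ := hcon
      have hiA := (hF i hi').resolve_right hiQ
      obtain ⟨j, hj, -, -, -, -, hrem⟩ := exists_reference h hγ hκ hK hiA
      rcases hrem hiS with hc | hc
      · exact hiT (List.mem_toFinset.2 (List.mem_map.2 ⟨_, hc, rfl⟩))
      · have h1 := hE.lower t htw j _ hn1 hN
        have h2 := hE.upper t htw i hi' _ hn1 hN
        linarith

lemma survivors_close (h : Separated μ W (16 * Real.log (8 * K / P.δ))) (hγ : P.γ₀ = 1 / 4)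
    (hκ : 1 < P.κ) (hK : 0 < Real.log (8 * K / P.δ)) (hE : EarlyRounds P μ W N tw)
    (hM : ManyClose P μ N tw c) {t : ℕ} (ht : tw < t) {i : Fin K}
    (hi : i ∈ (idealRun P (isPos μ) W t).active) : excess μ i < 8 * P.γ tw := by
  by_contra hcon
  obtain ⟨Q, hQ, hF⟩ := close_arms_survive h hγ hκ hK hE hM (Nat.le_succ tw)
  obtain ⟨hex, hN⟩ := hM.exists_mem le_rfl hQ hF
  have hn1 : 1 ≤ rankCount P (isPos μ) W tw := le_max_of_le_right (Nat.le_add_left _ _)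
  have hi1 := idealRun_active_anti (Nat.succ_le_of_lt ht) hi
  have hi0 := idealRun_active_succ_subset tw hi1
  obtain ⟨j, hj, hjt, -, hmin, hrem, -⟩ := exists_reference h hγ hκ hK hi0
  obtain ⟨f, hf, hfc, hft⟩ := hex (isPos μ i)
  have h1 := hmin f hf hft
  have h2 := hE.upper tw le_rfl f hfc _ hn1 hN
  have h3 := hE.large i (not_lt.1 hcon) _ hn1 hN
  exact hrem (by linarith) hi1

lemma idealRun_finished (h : Separated μ W (16 * Real.log (8 * K / P.δ))) (hγ : P.γ₀ = 1 / 4)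
    (hκ : 1 < P.κ) (hK : 0 < Real.log (8 * K / P.δ)) (hδ : 0 < P.δ)
    (hE : EarlyRounds P μ W N tw)
    (hM : ManyClose P μ N tw c) {T : ℕ} (hT : tw < T) {g N' : ℝ}
    (hg : ∀ i j, i ≠ j → isPos μ i = isPos μ j → excess μ i < 8 * P.γ tw →
      excess μ j < 8 * P.γ tw → g / 2 < |excess μ i - excess μ j|)
    (hdev : ∀ i, ∀ n : ℕ, 1 ≤ n → N' ≤ n → |adv μ W n i - (1 / 8 + excess μ i)| < g / 16)
    (hN' : N' ≤ 1 / P.γ T ^ 2 * Real.log (8 / P.δ)) (hγT : P.γ T ≤ g / 8) :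
    (idealRun P (isPos μ) W (T + 1)).active = ∅ := by
  by_contra hcon
  obtain ⟨i, hi1⟩ := Finset.nonempty_iff_ne_empty.2 hcon
  have hi := idealRun_active_succ_subset T hi1
  obtain ⟨j, hj, hjt, hj1, hmin, hrem, -⟩ := exists_reference h hγ hκ hK hi
  have hij : i ≠ j := fun h => hj1 (h ▸ hi1)
  have hn1 : 1 ≤ rankCount P (isPos μ) W T := le_max_of_le_right (Nat.le_add_left _ _)
  have hN : N' ≤ rankCount P (isPos μ) W T := by
    refine hN'.trans (le_trans ?_ (le_rankCount T))
    have hc : (1 : ℝ) ≤ (idealRun P (isPos μ) W T).active.card := by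
      exact_mod_cast Finset.card_pos.2 ⟨i, hi⟩
    have ht1 : (1 : ℝ) ≤ ((T : ℝ) + 1) ^ 2 :=
      one_le_pow₀ (by linarith [(Nat.cast_nonneg T : (0 : ℝ) ≤ T)])
    gcongr
    nlinarith
  have h1 := hg i j hij hjt.symm (survivors_close h hγ hκ hK hE hM hT hi)
    (survivors_close h hγ hκ hK hE hM hT hj)
  have h2 := abs_lt.1 (hdev i _ hn1 hN)
  have h3 := abs_lt.1 (hdev j _ hn1 hN)
  have h4 := hmin i hi rfl
  refine hrem ?_ hi1
  rcases le_or_gt 0 (excess μ i - excess μ j) with hs | hs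
  · rw [abs_of_nonneg hs] at h1
    linarith [h2.1, h2.2, h3.1, h3.2]
  · rw [abs_of_neg hs] at h1
    linarith [h2.1, h2.2, h3.1, h3.2]

end

end ManyArms


/-! ### Probability of the typical course -/

section Typical

variable {K : ℕ} [NeZero K] {P : RSParams} {μ : Fin K → ℝ}

lemma early_rounds_prob {lam : ℝ} (hlam : 0 ≤ lam) (hγ : 0 < P.γ₀) (hκ : 1 < P.κ)
    (hμ : ∀ i, μ i ∈ Set.Icc (0 : ℝ) 1) (hgap : ∀ i, 1 / 4 ≤ |μ i - 1 / 2|)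
    (hsum : ∑ i, Real.exp (-(2 * lam * excess μ i)) ≤ lam) (tw : ℕ) :
    rewardLaw (meanScore (linearLink μ))
      {W | ¬ EarlyRounds P μ W (fun t => 3 / 8 * lam / P.γ t) tw}
      ≤ ENNReal.ofReal (3 * ((tw : ℝ) + 1) * (lam * Real.exp (-(2 / 25 * lam * P.γ tw)))) := by
  set m := rewardLaw (meanScore (linearLink μ)) with hm
  set e := lam * Real.exp (-(2 / 25 * lam * P.γ tw)) with he
  have hz : ∀ i, 0 ≤ excess μ i := fun i => by unfold excess; linarith [hgap i]
  have hρ : ∀ i, |μ i - 1 / 2| / 2 = 1 / 8 + excess μ i := fun i => by unfold excess; ring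
  have hγt : ∀ t, 0 < P.γ t := gamma_pos hγ hκ
  have hbound : ∀ t ≤ tw, ∀ s : Finset (Fin K), ∀ f : Fin K → ℝ,
      (∀ i ∈ s, 2 * excess μ i * P.γ t + 2 / 25 * P.γ t ^ 2 ≤ 3 / 4 * f i ^ 2) →
      ∑ i ∈ s, Real.exp (-(2 * (3 / 8 * lam / P.γ t) * f i ^ 2)) ≤ e := by
    intro t ht s f hf
    have h1 : ∀ i ∈ s, Real.exp (-(2 * (3 / 8 * lam / P.γ t) * f i ^ 2)) ≤
        Real.exp (-(2 / 25 * lam * P.γ tw)) * Real.exp (-(2 * lam * excess μ i)) := by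
      intro i hi
      rw [← Real.exp_add]
      refine Real.exp_le_exp.2 ?_
      have h2 : 2 * (3 / 8 * lam / P.γ t) * f i ^ 2 = lam / P.γ t * (3 / 4 * f i ^ 2) := by ring
      have h3 : lam / P.γ t * (2 * excess μ i * P.γ t + 2 / 25 * P.γ t ^ 2)
          = 2 * lam * excess μ i + 2 / 25 * lam * P.γ t := by
        have := (hγt t).ne'
        field_simp
      have h4 : lam / P.γ t * (2 * excess μ i * P.γ t + 2 / 25 * P.γ t ^ 2) ≤
          lam / P.γ t * (3 / 4 * f i ^ 2) :=
        mul_le_mul_of_nonneg_left (hf i hi) (div_nonneg hlam (hγt t).le)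
      have h5 : lam * P.γ tw ≤ lam * P.γ t :=
        mul_le_mul_of_nonneg_left (gamma_anti hγ hκ ht) hlam
      rw [h2]
      linarith
    refine (Finset.sum_le_sum h1).trans ?_
    rw [← Finset.mul_sum, he, mul_comm]
    gcongr
    refine le_trans (Finset.sum_le_univ_sum_of_nonneg fun i => (Real.exp_pos _).le) hsum
  have he0 : 0 ≤ e := by positivity
  have hpos : ∀ (s : Finset (Fin K)) (g : Fin K → ℝ), ∀ i ∈ s, 0 ≤ Real.exp (g i) :=
    fun s g i _ => (Real.exp_pos _).le
  have hA : ∀ t ≤ tw, m {W | ∃ i ∈ Finset.univ, W ∈ {W : Fin K × ℕ → Bool | ∃ n : ℕ, 1 ≤ n ∧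
      3 / 8 * lam / P.γ t ≤ n ∧ adv μ W n i ≤ |μ i - 1 / 2| / 2 - (excess μ i + P.γ t)}}
      ≤ ENNReal.ofReal e := by
    intro t ht
    refine (measure_exists_le_ofReal_sum _ _ _ _ (hpos _ _) fun i _ =>
      adv_low_prob hμ i (add_nonneg (hz i) (hγt t).le)).trans (ENNReal.ofReal_le_ofReal
      (hbound t ht _ (fun i => excess μ i + P.γ t) fun i _ => ?_))
    nlinarith [sq_nonneg (excess μ i - P.γ t / 2), hz i, hγt t, mul_nonneg (hz i) (hγt t).le]
  have hB : ∀ t ≤ tw, m {W | ∃ i ∈ Finset.univ.filter fun i => excess μ i ≤ P.γ t / 5,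
      W ∈ {W : Fin K × ℕ → Bool | ∃ n : ℕ, 1 ≤ n ∧
      3 / 8 * lam / P.γ t ≤ n ∧ |μ i - 1 / 2| / 2 + (P.γ t - excess μ i) ≤ adv μ W n i}}
      ≤ ENNReal.ofReal e := by
    intro t ht
    refine (measure_exists_le_ofReal_sum _ _ _ _ (hpos _ _) fun i hi =>
      adv_high_prob hμ i ?_).trans (ENNReal.ofReal_le_ofReal
      (hbound t ht _ (fun i => P.γ t - excess μ i) fun i hi => ?_))
    · have := (Finset.mem_filter.1 hi).2
      linarith [hγt t]
    · have h1 := (Finset.mem_filter.1 hi).2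
      have h2 : 4 / 5 * P.γ t ≤ P.γ t - excess μ i := by linarith
      have h3 := hγt t
      have h4 : excess μ i * P.γ t ≤ P.γ t / 5 * P.γ t := mul_le_mul_of_nonneg_right h1 h3.le
      have h5 : (4 / 5 * P.γ t) ^ 2 ≤ (P.γ t - excess μ i) ^ 2 := by gcongr
      linarith [h5, h4]
  have hC : m {W | ∃ i ∈ Finset.univ.filter fun i => 8 * P.γ tw ≤ excess μ i,
      W ∈ {W : Fin K × ℕ → Bool | ∃ n : ℕ, 1 ≤ n ∧
      3 / 8 * lam / P.γ tw ≤ n ∧ adv μ W n i ≤ |μ i - 1 / 2| / 2 - (excess μ i - 3 * P.γ tw)}}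
      ≤ ENNReal.ofReal e := by
    refine (measure_exists_le_ofReal_sum _ _ _ _ (hpos _ _) fun i hi =>
      adv_low_prob hμ i ?_).trans (ENNReal.ofReal_le_ofReal
      (hbound tw le_rfl _ (fun i => excess μ i - 3 * P.γ tw) fun i hi => ?_))
    · have := (Finset.mem_filter.1 hi).2
      linarith [hγt tw]
    · have h1 := (Finset.mem_filter.1 hi).2
      nlinarith [hγt tw]
  set A : ℕ → Set (Fin K × ℕ → Bool) := fun t => {W | ∃ i ∈ Finset.univ, W ∈
    {W : Fin K × ℕ → Bool | ∃ n : ℕ, 1 ≤ n ∧ 3 / 8 * lam / P.γ t ≤ n ∧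
      adv μ W n i ≤ |μ i - 1 / 2| / 2 - (excess μ i + P.γ t)}} with hAdef
  set B : ℕ → Set (Fin K × ℕ → Bool) := fun t =>
    {W | ∃ i ∈ Finset.univ.filter fun i => excess μ i ≤ P.γ t / 5,
      W ∈ {W : Fin K × ℕ → Bool | ∃ n : ℕ, 1 ≤ n ∧
      3 / 8 * lam / P.γ t ≤ n ∧ |μ i - 1 / 2| / 2 + (P.γ t - excess μ i) ≤ adv μ W n i}} with hBdef
  set C : Set (Fin K × ℕ → Bool) :=
    {W | ∃ i ∈ Finset.univ.filter fun i => 8 * P.γ tw ≤ excess μ i,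
      W ∈ {W : Fin K × ℕ → Bool | ∃ n : ℕ, 1 ≤ n ∧
      3 / 8 * lam / P.γ tw ≤ n ∧ adv μ W n i ≤ |μ i - 1 / 2| / 2 - (excess μ i - 3 * P.γ tw)}}
    with hCdef
  have hsub : {W | ¬ EarlyRounds P μ W (fun t => 3 / 8 * lam / P.γ t) tw} ⊆
      (⋃ t ∈ Finset.range (tw + 1), (A t ∪ B t)) ∪ C := by
    intro W hW
    by_contra hcon
    simp only [Set.mem_union, Set.mem_iUnion, not_or, not_exists] at hcon
    obtain ⟨h1, h2⟩ := hcon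
    have h1' : ∀ t ≤ tw, W ∉ A t ∧ W ∉ B t := fun t ht =>
      h1 t (Finset.mem_range.2 (Nat.lt_succ_of_le ht))
    refine hW ⟨fun t ht i n hn hN => ?_, fun t ht i hi n hn hN => ?_, fun i hi n hn hN => ?_⟩
    · by_contra h
      exact (h1' t ht).1 ⟨i, Finset.mem_univ i, n, hn, hN, by rw [hρ]; linarith⟩
    · by_contra h
      exact (h1' t ht).2 ⟨i, Finset.mem_filter.2 ⟨Finset.mem_univ i, hi⟩, n, hn, hN, by
        rw [hρ]; linarith⟩
    · by_contra h
      exact h2 ⟨i, Finset.mem_filter.2 ⟨Finset.mem_univ i, hi⟩, n, hn, hN, by rw [hρ]; linarith⟩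
  refine (measure_mono hsub).trans ((measure_union_le _ _).trans ?_)
  have hAB : m (⋃ t ∈ Finset.range (tw + 1), (A t ∪ B t)) ≤
      ENNReal.ofReal (∑ _t ∈ Finset.range (tw + 1), (e + e)) := by
    rw [ENNReal.ofReal_sum_of_nonneg fun _ _ => by positivity]
    refine (measure_biUnion_finset_le _ _).trans (Finset.sum_le_sum fun t ht => ?_)
    have ht' : t ≤ tw := Nat.lt_succ_iff.1 (Finset.mem_range.1 ht)
    rw [ENNReal.ofReal_add he0 he0]
    exact (measure_union_le _ _).trans (add_le_add (hA t ht') (hB t ht'))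
  refine (add_le_add hAB hC).trans ?_
  rw [← ENNReal.ofReal_add (Finset.sum_nonneg fun _ _ => by positivity) he0]
  refine ENNReal.ofReal_le_ofReal ?_
  rw [Finset.sum_const, Finset.card_range, nsmul_eq_mul]
  push_cast
  nlinarith [mul_nonneg (Nat.cast_nonneg tw : (0 : ℝ) ≤ tw) he0]

lemma deviation_prob (hμ : ∀ i, μ i ∈ Set.Icc (0 : ℝ) 1) {ε : ℝ} (hε : 0 ≤ ε) (N : ℝ) :
    rewardLaw (meanScore (linearLink μ))
      {W | ¬ ∀ i, ∀ n : ℕ, 1 ≤ n → N ≤ n → |adv μ W n i - (1 / 8 + excess μ i)| < ε}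
      ≤ ENNReal.ofReal (2 * (K * Real.exp (-(2 * N * ε ^ 2)))) := by
  have hρ : ∀ i, |μ i - 1 / 2| / 2 = 1 / 8 + excess μ i := fun i => by unfold excess; ring
  have hsub : {W | ¬ ∀ i, ∀ n : ℕ, 1 ≤ n → N ≤ n → |adv μ W n i - (1 / 8 + excess μ i)| < ε} ⊆
      {W | ∃ i ∈ Finset.univ, W ∈ {W : Fin K × ℕ → Bool | ∃ n : ℕ, 1 ≤ n ∧ N ≤ n ∧
        adv μ W n i ≤ |μ i - 1 / 2| / 2 - ε}} ∪
      {W | ∃ i ∈ Finset.univ, W ∈ {W : Fin K × ℕ → Bool | ∃ n : ℕ, 1 ≤ n ∧ N ≤ n ∧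
        |μ i - 1 / 2| / 2 + ε ≤ adv μ W n i}} := by
    intro W hW
    by_contra hcon
    simp only [Set.mem_union, not_or] at hcon
    refine hW fun i n hn hN => abs_lt.2 ⟨?_, ?_⟩
    · by_contra h
      exact hcon.1 ⟨i, Finset.mem_univ i, n, hn, hN, by rw [hρ]; linarith⟩
    · by_contra h
      exact hcon.2 ⟨i, Finset.mem_univ i, n, hn, hN, by rw [hρ]; linarith⟩
  have hs : ∑ _i : Fin K, Real.exp (-(2 * N * ε ^ 2)) = K * Real.exp (-(2 * N * ε ^ 2)) := by simp
  have h1 := measure_exists_le_ofReal_sum (rewardLaw (meanScore (linearLink μ))) Finset.univ _ _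
    (fun _ _ => (Real.exp_pos _).le) fun i _ => adv_low_prob hμ i hε (N := N)
  have h2 := measure_exists_le_ofReal_sum (rewardLaw (meanScore (linearLink μ))) Finset.univ _ _
    (fun _ _ => (Real.exp_pos _).le) fun i _ => adv_high_prob hμ i hε (N := N)
  rw [hs] at h1 h2
  refine (measure_mono hsub).trans ((measure_union_le _ _).trans ((add_le_add h1 h2).trans ?_))
  rw [← ENNReal.ofReal_add (by positivity) (by positivity)]
  exact ENNReal.ofReal_le_ofReal (by linarith)

end Typical


/-! ### Rank-Search on many arms -/

/-- The rate `λ` in terms of `r = √(log K)`. -/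
noncomputable def rateOf (δ r : ℝ) : ℝ := 4 * r ^ 2 + 4 * Real.log (2 / δ)

/-- A bound for the number of rounds per unit of `r`. -/
noncomputable def roundConst (κ : ℝ) : ℝ := 1 + 1 / Real.log κ

/-- The inequalities that hold for a large number `K = exp (r ^ 2)` of arms. -/
structure ManyArms (δ κ r : ℝ) : Prop where
  four_le : 4 ≤ r
  rounds : κ * r < Real.exp (400 * r)
  deviation : 2 * (Real.exp (r ^ 2) * Real.exp (-(Real.exp (400 * r) / 128))) ≤ δ / 8
  early : 3 * (roundConst κ * r + 1) * (rateOf δ r * Real.exp (-(8 / 25 * (r / κ)))) ≤ δ / 8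
  two_le : 2 ≤ Real.exp (1 / 10 * (r / κ))
  close : 1 + (roundConst κ * r + 1) * (2 * r ^ 2 + 2) ≤ δ / 8 * Real.exp (3 / 2 * (r / κ))
  late : rateOf δ r * Real.exp (16 * (rateOf δ r / r)) * (κ ^ 2 * Real.exp (800 * r) *
    (r ^ 2 + Real.log (8 / δ) + 2 * (400 * roundConst κ * r)) + 1) ≤ Real.exp (r ^ 2)
  classes : 10 * Real.log (8 / δ) ≤ r ^ 2
  count : 2 * (roundConst κ * r + 1) * Real.exp (-(δ / 32 * Real.exp (8 / 5 * (r / κ)))) ≤ δ / 16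
  pairs : δ ^ 2 / 4 * (2 * Real.exp (-(200 * r)) * rateOf δ r *
    Real.exp (rateOf δ r * Real.exp (-(200 * r))) * Real.exp (32 * (rateOf δ r / r))) ≤ δ / 16

/-- The properties of a typical instance with many arms; the early rounds end with round `tw`. -/
structure TypicalInstance {K : ℕ} (P : RSParams) (r : ℝ) (tw : ℕ) (μ : Fin K → ℝ) : Prop where
  sum_exp : ∑ i, Real.exp (-(2 * rateOf P.δ r * excess μ i)) ≤ rateOf P.δ r
  count : ∀ t ≤ tw, ∀ y, P.δ / 8 * Real.exp (2 / 5 * (rateOf P.δ r * P.γ t)) ≤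
    (Finset.univ.filter fun i => excess μ i ≤ P.γ t / 5 ∧ isPos μ i = y).card
  pairs : ∀ i j, i ≠ j → isPos μ i = isPos μ j → excess μ i < 8 * P.γ tw →
    excess μ j < 8 * P.γ tw → Real.exp (-(200 * r)) / 2 < |excess μ i - excess μ j|

section Geometric

lemma one_le_roundConst {κ : ℝ} (hκ : 1 < κ) : 1 ≤ roundConst κ := by
  have := Real.log_pos hκ
  unfold roundConst
  have : 0 < 1 / Real.log κ := by positivity
  linarith

/-- The first round with confidence level below `1 / (4 v)`. -/
lemma exists_round {κ : ℝ} (hκ : 1 < κ) {v : ℝ} (hv : 1 ≤ v) :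
    ∃ t : ℕ, v < κ ^ t ∧ κ ^ t ≤ κ * v ∧ (t : ℝ) ≤ 1 + Real.log v / Real.log κ := by
  obtain ⟨n, h1, h2⟩ := exists_nat_pow_near hv hκ
  refine ⟨n + 1, h2, ?_, ?_⟩
  · rw [pow_succ, mul_comm]
    gcongr
  · have h3 : (n : ℝ) * Real.log κ ≤ Real.log v := by
      rw [← Real.log_pow]
      exact Real.log_le_log (by positivity) h1
    rw [← le_div_iff₀ (Real.log_pos hκ)] at h3
    push_cast
    linarith

end Geometric

section ManyArmsRun

variable {K : ℕ} {P : RSParams} {μ : Fin K → ℝ} {r : ℝ} {tw : ℕ}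

lemma rateOf_nonneg {δ r : ℝ} (hδ : 0 < δ) (hδ1 : δ ≤ 1 / 2) : 4 * r ^ 2 ≤ rateOf δ r := by
  have : 0 ≤ Real.log (2 / δ) := Real.log_nonneg (by rw [le_div_iff₀ hδ]; linarith)
  unfold rateOf
  linarith

lemma four_mul_le_rate {δ κ r γ : ℝ} (hδ : 0 < δ) (hδ1 : δ ≤ 1 / 2) (hκ : 1 < κ) (hr : 0 < r)
    (h : 1 / (κ * r) ≤ γ) : 4 * (r / κ) ≤ rateOf δ r * γ := by
  have h1 := rateOf_nonneg (r := r) hδ hδ1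
  have h2 : 4 * r ^ 2 * (1 / (κ * r)) = 4 * (r / κ) := by
    have : κ ≠ 0 := by linarith
    field_simp
  rw [← h2]
  exact mul_le_mul h1 h (by positivity) (by nlinarith [sq_nonneg r])

lemma natLog_le {K : ℕ} (hK : 1 ≤ K) : (Nat.log 2 (2 * K) : ℝ) ≤ 2 * Real.log K + 2 := by
  have h1 : 2 ^ Nat.log 2 (2 * K) ≤ 2 * K := Nat.pow_log_le_self 2 (by omega)
  have h2 : (Nat.log 2 (2 * K) : ℝ) * Real.log 2 ≤ Real.log 2 + Real.log K := by
    rw [← Real.log_pow, ← Real.log_mul (by norm_num) (by positivity)]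
    exact Real.log_le_log (by positivity) (by exact_mod_cast h1)
  have h3 := Real.log_two_gt_d9
  have h4 : (0 : ℝ) ≤ Real.log K := Real.log_nonneg (by exact_mod_cast hK)
  have h5 : (0 : ℝ) ≤ Nat.log 2 (2 * K) := Nat.cast_nonneg _
  nlinarith

lemma TypicalInstance.manyClose (hT : TypicalInstance P r tw μ) (hB : ManyArms P.δ P.κ r)
    (hδ : 0 < P.δ) (hδ1 : P.δ ≤ 1 / 2) (hγ : 0 < P.γ₀) (hκ : 1 < P.κ) (hK : 1 ≤ K)
    (hr : r ^ 2 = Real.log K) (htw : 1 / (P.κ * r) ≤ P.γ tw) (htw' : (tw : ℝ) ≤ roundConst P.κ * r) :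
    ManyClose P μ (fun t => 3 / 8 * rateOf P.δ r / P.γ t) tw
      (fun t => ⌈P.δ / 8 * Real.exp (3 / 8 * (rateOf P.δ r * P.γ t))⌉₊) := by
  have hr4 := hB.four_le
  have hlam := rateOf_nonneg (r := r) hδ hδ1
  refine ⟨fun t _ => Nat.ceil_pos.2 (by positivity), fun t ht y => ?_, fun t ht s hs => ?_⟩
  · have hv : 4 * (r / P.κ) ≤ rateOf P.δ r * P.γ t := by
      refine four_mul_le_rate hδ hδ1 hκ (by linarith) (htw.trans (gamma_anti hγ hκ ht))
    set v := rateOf P.δ r * P.γ t with hvdef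
    have h1 := hT.count t ht y
    rw [← hvdef] at h1
    have h2 := (Nat.ceil_lt_add_one (by positivity : 0 ≤ P.δ / 8 * Real.exp (3 / 8 * v))).le
    have h3 : ((t : ℝ) + 1) * Nat.log 2 (2 * K) ≤ (roundConst P.κ * r + 1) * (2 * r ^ 2 + 2) := by
      have h4 : (t : ℝ) ≤ tw := by exact_mod_cast ht
      have h5 := natLog_le hK
      rw [← hr] at h5
      have h6 : (t : ℝ) + 1 ≤ roundConst P.κ * r + 1 := by linarith
      exact mul_le_mul h6 h5 (Nat.cast_nonneg _) (le_trans (by positivity) h6)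
    have h4 : 2 * (P.δ / 8 * Real.exp (3 / 8 * v)) ≤ P.δ / 8 * Real.exp (2 / 5 * v) := by
      have : Real.exp (2 / 5 * v) = Real.exp (1 / 40 * v) * Real.exp (3 / 8 * v) := by
        rw [← Real.exp_add]; congr 1; ring
      rw [this]
      have h5 : 2 ≤ Real.exp (1 / 40 * v) := hB.two_le.trans (Real.exp_le_exp.2 (by linarith))
      have h6 := mul_le_mul_of_nonneg_right h5
        (by positivity : 0 ≤ P.δ / 8 * Real.exp (3 / 8 * v))
      linarith
    have h5 : P.δ / 8 * Real.exp (3 / 2 * (r / P.κ)) ≤ P.δ / 8 * Real.exp (3 / 8 * v) :=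
      mul_le_mul_of_nonneg_left (Real.exp_le_exp.2 (by linarith)) (by linarith)
    have h6 := hB.close
    have : ((⌈P.δ / 8 * Real.exp (3 / 8 * v)⌉₊ + (t + 1) * Nat.log 2 (2 * K) : ℕ) : ℝ) ≤
        (Finset.univ.filter fun i => excess μ i ≤ P.γ t / 5 ∧ isPos μ i = y).card := by
      push_cast
      linarith
    exact_mod_cast this
  · have h1 := Nat.ceil_le.1 hs
    have hγt := gamma_pos hγ hκ (P := P) t
    have hs0 : (0 : ℝ) < s := lt_of_lt_of_le (by positivity) h1
    have ht1 : (1 : ℝ) ≤ ((t : ℝ) + 1) ^ 2 :=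
      one_le_pow₀ (by linarith [(Nat.cast_nonneg t : (0 : ℝ) ≤ t)])
    have h2 : 3 / 8 * (rateOf P.δ r * P.γ t) ≤ Real.log (8 * s * ((t : ℝ) + 1) ^ 2 / P.δ) := by
      rw [Real.le_log_iff_exp_le (by positivity), le_div_iff₀ hδ]
      nlinarith
    calc 3 / 8 * rateOf P.δ r / P.γ t
        = 1 / P.γ t ^ 2 * (3 / 8 * (rateOf P.δ r * P.γ t)) := by field_simp
      _ ≤ _ := by gcongr

lemma maxCount_le {v γ : ℝ} {t : ℕ} (hK : 1 ≤ K) (hδ : 0 < P.δ) (hδ1 : P.δ ≤ 1 / 2)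
    (hγ0 : 0 < γ) (hγ : γ ≤ P.γ t) (ht : (t : ℝ) ≤ v) : maxCount P K t ≤
      1 / γ ^ 2 * (Real.log K + Real.log (8 / P.δ) + 2 * v) + 1 := by
  have h1 := Real.log_nonneg (one_le_card_log_arg hδ hδ1 hK t)
  have ht0 : (0 : ℝ) < (t : ℝ) + 1 := by positivity
  have hK' : (0 : ℝ) < K := by exact_mod_cast hK
  have h2 : Real.log (8 * K * ((t : ℝ) + 1) ^ 2 / P.δ) ≤
      Real.log K + Real.log (8 / P.δ) + 2 * v := by
    rw [show 8 * (K : ℝ) * ((t : ℝ) + 1) ^ 2 / P.δ = K * (8 / P.δ) * ((t : ℝ) + 1) ^ 2 by ring,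
      Real.log_mul (by positivity) (by positivity), Real.log_mul (by positivity) (by positivity),
      Real.log_pow]
    have := Real.log_le_sub_one_of_pos ht0
    push_cast
    linarith
  unfold maxCount
  gcongr

/-- A constant for the complexity of Rank-Search on many arms. -/
noncomputable def pullsConst (P : RSParams) : ℝ :=
  401 * roundConst P.κ * (4 * (3 * (2 ^ 20 * P.R ^ 4 + 256 * P.R ^ 2 + 128) *
    (Real.log (160 / P.δ) + 802 * roundConst P.κ + 2)))

lemma sum_roundPulls_le {truth : Fin K → Bool} {W : Fin K × ℕ → Bool} (hδ : 0 < P.δ)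
    (hδ1 : P.δ ≤ 1 / 2) (hK : 1 ≤ K) (hκ : 1 < P.κ) (hr4 : 4 ≤ r) (hr : r ^ 2 = Real.log K) {T : ℕ}
    (hT : (T : ℝ) ≤ 400 * roundConst P.κ * r) :
    ∑ t ∈ Finset.range (T + 1), roundPulls P truth W t ≤ pullsConst P * r ^ 4 := by
  have ha := one_le_roundConst hκ
  set a := roundConst P.κ with hadef
  set cR := 3 * (2 ^ 20 * P.R ^ 4 + 256 * P.R ^ 2 + 128) with hcR
  have hcR0 : 0 ≤ cR := by positivity
  have h160 : 0 ≤ Real.log (160 / P.δ) := Real.log_nonneg (by rw [le_div_iff₀ hδ]; linarith)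
  have har : 1 ≤ a * r := by nlinarith
  have hterm : ∀ t ∈ Finset.range (T + 1), roundPulls P truth W t ≤
      4 * r ^ 2 * (cR * ((Real.log (160 / P.δ) + 802 * a + 2) * r)) := by
    intro t ht
    have htT : (t : ℝ) ≤ T := by exact_mod_cast Nat.lt_succ_iff.1 (Finset.mem_range.1 ht)
    have hcard : ((idealRun P truth W t).active.card : ℝ) ≤ K := by
      exact_mod_cast (card_idealRun_le P truth W t).trans (Nat.sub_le _ _)
    refine (roundPulls_le hδ hδ1 hK (by exact_mod_cast hK) hcard).trans ?_
    rw [← hr]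
    have h1 : Real.log ((t : ℝ) + 1) ≤ 400 * a * r := by
      have := Real.log_le_sub_one_of_pos (by positivity : (0 : ℝ) < (t : ℝ) + 1)
      linarith
    have h2 : Real.log (1 + r ^ 2) ≤ 2 * r := by
      have h3 : Real.log (1 + r ^ 2) ≤ Real.log ((1 + r) ^ 2) :=
        Real.log_le_log (by positivity) (by nlinarith)
      rw [Real.log_pow] at h3
      have := Real.log_le_sub_one_of_pos (by linarith : 0 < 1 + r)
      push_cast at h3
      linarith
    have h4 : Real.log (160 / P.δ) + 2 * Real.log ((t : ℝ) + 1) + Real.log (1 + r ^ 2) ≤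
        (Real.log (160 / P.δ) + 802 * a + 2) * r := by
      nlinarith [mul_nonneg h160 (by linarith : 0 ≤ r - 1)]
    have h5 : 2 * (1 + r ^ 2) ≤ 4 * r ^ 2 := by nlinarith
    have h6 : 0 ≤ (Real.log (160 / P.δ) + 802 * a + 2) * r := by positivity
    calc 2 * (1 + r ^ 2) * (cR * (Real.log (160 / P.δ) + 2 * Real.log ((t : ℝ) + 1) +
          Real.log (1 + r ^ 2)))
        ≤ 2 * (1 + r ^ 2) * (cR * ((Real.log (160 / P.δ) + 802 * a + 2) * r)) := by gcongr
      _ ≤ 4 * r ^ 2 * (cR * ((Real.log (160 / P.δ) + 802 * a + 2) * r)) := by gcongr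
  refine (Finset.sum_le_sum hterm).trans ?_
  rw [Finset.sum_const, Finset.card_range, nsmul_eq_mul]
  push_cast
  have hT1 : (T : ℝ) + 1 ≤ 401 * a * r := by linarith
  have h7 : 0 ≤ 4 * r ^ 2 * (cR * ((Real.log (160 / P.δ) + 802 * a + 2) * r)) := by positivity
  calc ((T : ℝ) + 1) * (4 * r ^ 2 * (cR * ((Real.log (160 / P.δ) + 802 * a + 2) * r)))
      ≤ 401 * a * r * (4 * r ^ 2 * (cR * ((Real.log (160 / P.δ) + 802 * a + 2) * r))) :=
        mul_le_mul_of_nonneg_right hT1 h7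
    _ = pullsConst P * r ^ 4 := by unfold pullsConst; rw [← hadef, ← hcR]; ring

/-- A constant for the number of duels of Rank-Search on many arms. -/
noncomputable def duelsConst (P : RSParams) : ℝ :=
  P.κ ^ 2 * (1 + Real.log (8 / P.δ) + 2 * roundConst P.κ) + 2

lemma duels_le {truth : Fin K → Bool} {W : Fin K × ℕ → Bool} (hB : ManyArms P.δ P.κ r)
    (hδ : 0 < P.δ) (hδ1 : P.δ ≤ 1 / 2) (hγ : P.γ₀ = 1 / 4) (hK : 1 ≤ K)
    (hκ : 1 < P.κ) (hr : r ^ 2 = Real.log K) (htw : 1 / (P.κ * r) ≤ P.γ tw)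
    (htw' : (tw : ℝ) ≤ roundConst P.κ * r) {T : ℕ} (htT : tw ≤ T)
    (hT : (T : ℝ) ≤ 400 * roundConst P.κ * r)
    (hγT : Real.exp (-(400 * r)) / P.κ ≤ P.γ T)
    (hU : ∀ t, tw < t → ((idealRun P truth W t).active.card : ℝ) ≤
      rateOf P.δ r * Real.exp (16 * (rateOf P.δ r / r))) :
    ((idealRun P truth W (T + 1)).duels : ℝ) ≤ duelsConst P * K * r ^ 4 := by
  have hr4 := hB.four_le
  have hγ0 : 0 < P.γ₀ := by rw [hγ]; norm_num
  have hlam := rateOf_nonneg (r := r) hδ hδ1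
  have ha := one_le_roundConst hκ
  set a := roundConst P.κ with hadef
  set U := rateOf P.δ r * Real.exp (16 * (rateOf P.δ r / r)) with hUdef
  have hU0 : 0 ≤ U := mul_nonneg (by nlinarith [sq_nonneg r]) (Real.exp_pos _).le
  have h8 : 0 ≤ Real.log (8 / P.δ) := Real.log_nonneg (by rw [le_div_iff₀ hδ]; linarith)
  have h1 := idealRun_duels_le (P := P) (truth := truth) (W := W) (t₀ := tw + 1) (U := ⌊U⌋₊)
    (fun t ht => Nat.le_floor (hU t ht)) (Nat.succ_le_succ htT)
  have h2 : ((idealRun P truth W (T + 1)).duels : ℝ) ≤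
      K * (idealRun P truth W (tw + 1)).count + ⌊U⌋₊ * (idealRun P truth W (T + 1)).count := by
    have h3 := h1.trans (Nat.add_le_add_left (Nat.mul_le_mul_left _ (Nat.sub_le _ _)) _)
    exact_mod_cast h3
  have h3 : ((idealRun P truth W (tw + 1)).count : ℝ) ≤
      P.κ ^ 2 * r ^ 2 * (r ^ 2 + Real.log (8 / P.δ) + 2 * (a * r)) + 1 := by
    refine (idealRun_count_le hγ0 hκ hδ hδ1 hK tw).2.trans
      ((maxCount_le hK hδ hδ1 (by positivity) htw htw').trans (le_of_eq ?_))
    rw [← hr]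
    have : P.κ ≠ 0 := by linarith
    field_simp
  have h4 : ((idealRun P truth W (T + 1)).count : ℝ) ≤
      P.κ ^ 2 * Real.exp (800 * r) * (r ^ 2 + Real.log (8 / P.δ) + 2 * (400 * a * r)) + 1 := by
    refine (idealRun_count_le hγ0 hκ hδ hδ1 hK T).2.trans
      ((maxCount_le hK hδ hδ1 (by positivity) hγT hT).trans (le_of_eq ?_))
    rw [← hr, div_pow, ← Real.exp_nat_mul, one_div_div, Nat.cast_ofNat]
    rw [show (2 : ℝ) * -(400 * r) = -(800 * r) by ring, Real.exp_neg, div_inv_eq_mul]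
  have hK' : (K : ℝ) = Real.exp (r ^ 2) := by
    rw [hr, Real.exp_log (by exact_mod_cast hK)]
  have h5 : (⌊U⌋₊ : ℝ) * (idealRun P truth W (T + 1)).count ≤ K := by
    calc (⌊U⌋₊ : ℝ) * (idealRun P truth W (T + 1)).count ≤ U * (P.κ ^ 2 * Real.exp (800 * r) *
          (r ^ 2 + Real.log (8 / P.δ) + 2 * (400 * a * r)) + 1) := by
          gcongr
          exact Nat.floor_le hU0
      _ ≤ K := by rw [hK']; exact hB.late
  have h6 : P.κ ^ 2 * r ^ 2 * (r ^ 2 + Real.log (8 / P.δ) + 2 * (a * r)) + 2 ≤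
      duelsConst P * r ^ 4 := by
    have hr1 : 1 ≤ r ^ 2 := by nlinarith
    have h7 : r ^ 2 + Real.log (8 / P.δ) + 2 * (a * r) ≤
        (1 + Real.log (8 / P.δ) + 2 * a) * r ^ 2 := by
      have : a * r ≤ a * r ^ 2 := by gcongr; nlinarith
      nlinarith [mul_nonneg h8 (by linarith : 0 ≤ r ^ 2 - 1)]
    have h9 : P.κ ^ 2 * r ^ 2 * (r ^ 2 + Real.log (8 / P.δ) + 2 * (a * r)) ≤
        P.κ ^ 2 * r ^ 2 * ((1 + Real.log (8 / P.δ) + 2 * a) * r ^ 2) := by gcongr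
    have h10 : 1 ≤ r ^ 4 := one_le_pow₀ (by linarith)
    unfold duelsConst
    rw [← hadef]
    linarith
  calc ((idealRun P truth W (T + 1)).duels : ℝ)
      ≤ K * (P.κ ^ 2 * r ^ 2 * (r ^ 2 + Real.log (8 / P.δ) + 2 * (a * r)) + 1) + K := by
        refine h2.trans (add_le_add ?_ h5)
        gcongr
    _ = K * (P.κ ^ 2 * r ^ 2 * (r ^ 2 + Real.log (8 / P.δ) + 2 * (a * r)) + 2) := by ring
    _ ≤ K * (duelsConst P * r ^ 4) := by gcongr
    _ = duelsConst P * K * r ^ 4 := by ring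

lemma card_close_le {lam v : ℝ} (hlam : 0 ≤ lam)
    (hsum : ∑ i, Real.exp (-(2 * lam * excess μ i)) ≤ lam) {S : Finset (Fin K)}
    (hS : ∀ i ∈ S, excess μ i ≤ v) : (S.card : ℝ) ≤ lam * Real.exp (2 * lam * v) := by
  have h1 : (S.card : ℝ) * Real.exp (-(2 * lam * v)) ≤ lam := by
    calc (S.card : ℝ) * Real.exp (-(2 * lam * v)) = ∑ _i ∈ S, Real.exp (-(2 * lam * v)) := by simp
      _ ≤ ∑ i ∈ S, Real.exp (-(2 * lam * excess μ i)) := by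
          refine Finset.sum_le_sum fun i hi => Real.exp_le_exp.2 ?_
          have := mul_le_mul_of_nonneg_left (hS i hi) (by linarith : 0 ≤ 2 * lam)
          linarith
      _ ≤ ∑ i, Real.exp (-(2 * lam * excess μ i)) :=
          Finset.sum_le_univ_sum_of_nonneg fun i => (Real.exp_pos _).le
      _ ≤ lam := hsum
  rw [Real.exp_neg, ← div_eq_mul_inv, div_le_iff₀ (Real.exp_pos _)] at h1
  exact h1

/-- Rank-Search on a typical instance with many arms. -/
lemma rankSearch_many_arms [NeZero K] (hτ : P.τ = 1 / 2) (hR : 1 / 2 ≤ P.R) (hδ : 0 < P.δ)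
    (hδ1 : P.δ ≤ 1 / 2) (hγ : P.γ₀ = 1 / 4) (hκ : 1 < P.κ) (hB : ManyArms P.δ P.κ r)
    (hr : r ^ 2 = Real.log K) (htw : 1 / (P.κ * r) ≤ P.γ tw) (htw1 : P.γ tw ≤ 1 / r)
    (htw' : (tw : ℝ) ≤ roundConst P.κ * r) (hμ : ∀ i, μ i ∈ Set.Icc (0 : ℝ) 1)
    (hgap : ∀ i, 1 / 4 ≤ |μ i - 1 / 2|) (hT : TypicalInstance P r tw μ) {C : ℝ}
    (hC : duelsConst P ≤ C) (hC' : pullsConst P ≤ C) :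
    ENNReal.ofReal (1 - P.δ) ≤ sampleLaw (linearLink μ) μ
      {ω | RSReturns P ω (positiveSet (1 / 2) μ) (C * K * Real.log K ^ 3)
        (C * Real.log K ^ 2)} := by
  have hr4 := hB.four_le
  have hγ0 : 0 < P.γ₀ := by rw [hγ]; norm_num
  have hlam := rateOf_nonneg (r := r) hδ hδ1
  have hlam0 : 0 ≤ rateOf P.δ r := by nlinarith [sq_nonneg r]
  have hK : 1 ≤ K := NeZero.one_le
  have hK' : (K : ℝ) = Real.exp (r ^ 2) := by
    rw [hr, Real.exp_log (by exact_mod_cast hK)]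
  have hκ0 : 0 < P.κ := by linarith
  have hκr : 0 < P.κ * r := by positivity
  have ha := one_le_roundConst hκ
  have hlog : Real.log (8 * K / P.δ) = r ^ 2 + Real.log (8 / P.δ) := by
    rw [show 8 * (K : ℝ) / P.δ = K * (8 / P.δ) by ring, Real.log_mul (by positivity)
      (by positivity), hr]
  have h8 : 1 ≤ Real.log (8 / P.δ) := by
    rw [Real.le_log_iff_exp_le (by positivity), le_div_iff₀ hδ]
    nlinarith [Real.exp_one_lt_d9]
  have hL : 0 < Real.log (8 * K / P.δ) := by rw [hlog]; positivity
  set g := Real.exp (-(200 * r)) with hg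
  have hg0 : 0 < g := Real.exp_pos _
  have hg2 : g ^ 2 = Real.exp (-(400 * r)) := by
    rw [hg, ← Real.exp_nat_mul]; congr 1; push_cast; ring
  have hg8 : g ≤ 1 / 8 := by
    rw [hg, Real.exp_neg, ← one_div]
    refine one_div_le_one_div_of_le (by norm_num) ?_
    have := Real.add_one_le_exp (200 * r)
    linarith
  obtain ⟨T, hT1, hT2, hT3⟩ := exists_round hκ (v := 1 / (4 * g ^ 2)) (by
    rw [le_div_iff₀ (by positivity)]; nlinarith)
  have hγT : P.γ T < g ^ 2 := by
    rw [RSParams.γ, hγ, div_lt_iff₀ (by positivity)]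
    rw [div_lt_iff₀ (by positivity)] at hT1
    linarith
  have hγT' : Real.exp (-(400 * r)) / P.κ ≤ P.γ T := by
    rw [← hg2, RSParams.γ, hγ, div_le_div_iff₀ hκ0 (by positivity)]
    rw [mul_one_div, le_div_iff₀ (by positivity)] at hT2
    linarith
  have hTr : (T : ℝ) ≤ 400 * roundConst P.κ * r := by
    have h1 : Real.log (1 / (4 * g ^ 2)) ≤ 400 * r - 1 := by
      rw [one_div, Real.log_inv, Real.log_mul (by norm_num) (by positivity), hg2, Real.log_exp]
      have : 1 ≤ Real.log 4 := by
        rw [show (4 : ℝ) = 2 ^ 2 by norm_num, Real.log_pow]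
        push_cast
        linarith [Real.log_two_gt_d9]
      linarith
    have h2 := Real.log_pos hκ
    have h3 : Real.log (1 / (4 * g ^ 2)) / Real.log P.κ ≤ 400 * r / Real.log P.κ := by
      gcongr; linarith
    have h4 : 400 * roundConst P.κ * r = 400 * r + 400 * r / Real.log P.κ := by
      unfold roundConst; ring
    linarith
  have htT : tw < T := by
    by_contra h
    have h1 := gamma_anti (P := P) hγ0 hκ (not_lt.1 h)
    have h2 : g ^ 2 < 1 / (P.κ * r) := by
      rw [hg2, Real.exp_neg, ← one_div]
      exact one_div_lt_one_div_of_lt hκr hB.rounds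
    linarith
  set N' := 1 / P.γ T ^ 2 * Real.log (8 / P.δ) with hN'
  have hγT0 := gamma_pos (P := P) hγ0 hκ T
  have hM := hT.manyClose hB hδ hδ1 hγ0 hκ hK hr htw htw'
  set N : ℕ → ℝ := fun t => 3 / 8 * rateOf P.δ r / P.γ t with hN
  have hrate : rateOf P.δ r ≤ 4 * Real.log (8 * K / P.δ) := by
    rw [hlog]
    unfold rateOf
    have : Real.log (2 / P.δ) ≤ Real.log (8 / P.δ) :=
      Real.log_le_log (by positivity) (by gcongr; norm_num)
    linarith
  have p1 := class_correct_large hδ hδ1 hμ hgap hrate hlam0 hT.sum_exp (by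
    rw [hlog]; linarith [hB.classes])
  have p2 := early_rounds_prob hlam0 hγ0 hκ hμ hgap hT.sum_exp tw
  have p3 := deviation_prob hμ (by positivity : 0 ≤ g / 16) N'
  have q2 : 3 * ((tw : ℝ) + 1) * (rateOf P.δ r * Real.exp (-(2 / 25 * rateOf P.δ r * P.γ tw)))
      ≤ P.δ / 8 := by
    refine le_trans ?_ hB.early
    have h1 := four_mul_le_rate hδ hδ1 hκ (by linarith : 0 < r) htw
    have h2 : Real.exp (-(2 / 25 * rateOf P.δ r * P.γ tw)) ≤ Real.exp (-(8 / 25 * (r / P.κ))) :=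
      Real.exp_le_exp.2 (by linarith)
    have h3 : 3 * ((tw : ℝ) + 1) ≤ 3 * (roundConst P.κ * r + 1) := by linarith
    exact mul_le_mul h3 (mul_le_mul_of_nonneg_left h2 hlam0)
      (mul_nonneg hlam0 (Real.exp_pos _).le) (le_trans (by positivity) h3)
  have q3 : 2 * (K * Real.exp (-(2 * N' * (g / 16) ^ 2))) ≤ P.δ / 8 := by
    refine le_trans ?_ hB.deviation
    rw [hK']
    gcongr
    have h1 : 1 / (g ^ 2) ^ 2 ≤ 1 / P.γ T ^ 2 := by gcongr
    have h2 : 1 / (g ^ 2) ^ 2 ≤ N' := by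
      refine h1.trans (le_mul_of_one_le_right (by positivity) h8)
    have h3 : Real.exp (400 * r) = 1 / g ^ 2 := by rw [hg2, Real.exp_neg, one_div, inv_inv]
    have h4 : 2 * (1 / (g ^ 2) ^ 2) * (g / 16) ^ 2 = 1 / g ^ 2 / 128 := by
      field_simp; norm_num
    rw [h3, ← h4]
    gcongr
  refine rankSearch_spec (linearLink_mem hμ) hτ hR hδ hδ1 hμ hgap
    {W | Separated μ W (16 * Real.log (8 * K / P.δ)) ∧ EarlyRounds P μ W N tw ∧
      ∀ i, ∀ n : ℕ, 1 ≤ n → N' ≤ n → |adv μ W n i - (1 / 8 + excess μ i)| < g / 16} ?_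
      fun W hW => ?_
  · have hsub : {W | Separated μ W (16 * Real.log (8 * K / P.δ)) ∧ EarlyRounds P μ W N tw ∧
        ∀ i, ∀ n : ℕ, 1 ≤ n → N' ≤ n → |adv μ W n i - (1 / 8 + excess μ i)| < g / 16}ᶜ ⊆
        {W | ¬ Separated μ W (16 * Real.log (8 * K / P.δ))} ∪ {W | ¬ EarlyRounds P μ W N tw} ∪
        {W | ¬ ∀ i, ∀ n : ℕ, 1 ≤ n → N' ≤ n → |adv μ W n i - (1 / 8 + excess μ i)| < g / 16} := by
      intro W hW
      by_contra hcon
      simp only [Set.mem_union, not_or] at hcon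
      exact hW ⟨not_not.1 hcon.1.1, not_not.1 hcon.1.2, not_not.1 hcon.2⟩
    refine (measure_mono hsub).trans ((measure_union_le _ _).trans
      ((add_le_add (measure_union_le _ _) le_rfl).trans ((add_le_add (add_le_add p1 (p2.trans
        (ENNReal.ofReal_le_ofReal q2))) (p3.trans (ENNReal.ofReal_le_ofReal q3))).trans ?_)))
    rw [← ENNReal.ofReal_add (by positivity) (by positivity),
      ← ENNReal.ofReal_add (by positivity) (by positivity)]
    exact ENNReal.ofReal_le_ofReal (by linarith)
  · obtain ⟨hsep, hE, hdev⟩ := hW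
    change ∃ T, (idealRun P (isPos μ) W T).active = ∅ ∧
      (∀ i, (idealRun P (isPos μ) W T).label i = isPos μ i) ∧ _ ∧ _
    have hempty := idealRun_finished hsep hγ hκ hL hδ hE hM htT hT.pairs hdev le_rfl (by nlinarith)
    refine ⟨T + 1, hempty, fun i => idealRun_label (fun t _ hne i k hi hk => ?_) i
      (by simp [hempty]), ?_, ?_⟩
    · rw [avg_sub_avg_eq hi hk]
      have h1 := hsep.rankCount hγ hL hne i
      have h2 := hsep.rankCount hγ hL hne k
      have h3 := gamma_pos (P := P) hγ0 hκ t
      linarith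
    · refine (duels_le hB hδ hδ1 hγ hK hκ hr htw htw' htT.le hTr hγT' fun t ht => ?_).trans ?_
      · refine (card_close_le hlam0 hT.sum_exp (v := 8 * P.γ tw) fun i hi =>
          (survivors_close hsep hγ hκ hL hE hM ht hi).le).trans ?_
        have h1 : rateOf P.δ r * P.γ tw ≤ rateOf P.δ r * (1 / r) :=
          mul_le_mul_of_nonneg_left htw1 hlam0
        refine mul_le_mul_of_nonneg_left (Real.exp_le_exp.2 ?_) hlam0
        rw [mul_one_div] at h1
        linarith
      · rw [← hr]
        have h0 : 0 ≤ duelsConst P := by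
          unfold duelsConst; positivity
        have h1 : r ^ 4 ≤ (r ^ 2) ^ 3 := by
          rw [← pow_mul]; exact pow_le_pow_right₀ (by linarith) (by norm_num)
        have h2 : 0 ≤ C := h0.trans hC
        gcongr
    · refine (sum_roundPulls_le hδ hδ1 hK hκ hr4 hr hTr).trans ?_
      rw [← hr, ← pow_mul]
      gcongr

end ManyArmsRun


/-! ### The complexity of the instance -/

section Complexity

variable {K : ℕ}

lemma borda_linearLink (hK : 2 ≤ K) (μ : Fin K → ℝ) (i : Fin K) :
    borda (linearLink μ) i =
      K / (2 * ((K : ℝ) - 1)) * μ i + (K - 1 - ∑ j, μ j) / (2 * ((K : ℝ) - 1)) := by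
  have hK' : (2 : ℝ) ≤ K := by exact_mod_cast hK
  have h1 : ∑ j ∈ Finset.univ.erase i, linearLink μ i j
      = (K * (1 + μ i) - ∑ j, μ j) / 2 - 1 / 2 := by
    have h2 : ∑ j, linearLink μ i j = (K * (1 + μ i) - ∑ j, μ j) / 2 := by
      unfold linearLink
      rw [← Finset.sum_div, Finset.sum_sub_distrib]
      simp
      ring
    have h3 := Finset.sum_erase_add Finset.univ (linearLink μ i) (Finset.mem_univ i)
    rw [h2] at h3
    have h4 : linearLink μ i i = 1 / 2 := by unfold linearLink; ring
    linarith
  rw [borda, h1]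
  have : (K : ℝ) - 1 ≠ 0 := by linarith
  field_simp
  ring

/-- The duel gaps of an instance with mean gaps at least `1 / 4`. -/
lemma duel_complexity (hK : 2 ≤ K) {μ : Fin K → ℝ} (hμ : ∀ i, μ i ∈ Set.Icc (0 : ℝ) 1)
    (hgap : ∀ i, 1 / 4 ≤ |μ i - 1 / 2|) (hpos : ∃ i, isPos μ i = true)
    (hneg : ∃ i, isPos μ i = false) {g : ℝ} (hg : 0 < g)
    (htop : ∀ u, (∀ j, isPos μ j = isPos μ u → |μ u - 1 / 2| ≤ |μ j - 1 / 2|) →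
      ∀ j, j ≠ u → isPos μ j = isPos μ u → g ≤ |μ u - μ j|) :
    ∃ u v : Fin K,
      IsWorstPositive (borda (linearLink μ)) (positiveSet (1 / 2) μ) u ∧
      IsBestNegative (borda (linearLink μ)) (positiveSet (1 / 2) μ) v ∧
      hc2 (borda (linearLink μ)) (positiveSet (1 / 2) μ) u v =
        hc1 (borda (linearLink μ)) (positiveSet (1 / 2) μ) u v ∧
      hc2 (borda (linearLink μ)) (positiveSet (1 / 2) μ) u v ≤
        ENNReal.ofReal (K * (2 / g) ^ 2) := by
  have hK' : (2 : ℝ) ≤ K := by exact_mod_cast hK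
  set p := borda (linearLink μ) with hp
  set S := positiveSet (1 / 2) μ with hS
  set a : ℝ := K / (2 * ((K : ℝ) - 1)) with ha
  have ha2 : 1 / 2 ≤ a := by
    rw [ha, div_le_div_iff₀ (by norm_num) (by linarith)]
    linarith
  have hpd : ∀ i j, p i - p j = a * (μ i - μ j) := by
    intro i j
    rw [hp, borda_linearLink hK, borda_linearLink hK]
    ring
  have hle : ∀ i j, p i ≤ p j ↔ μ i ≤ μ j := by
    intro i j
    have := hpd j i
    constructor
    · intro h
      by_contra hcon
      have : a * (μ j - μ i) < 0 := mul_neg_of_pos_of_neg (by linarith) (by linarith)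
      linarith
    · intro h
      have : 0 ≤ a * (μ j - μ i) := mul_nonneg (by linarith) (by linarith)
      linarith
  have hmem : ∀ i, i ∈ S ↔ isPos μ i = true := by
    intro i; simp [hS, positiveSet, isPos]
  have hmem' : ∀ i, i ∉ S ↔ isPos μ i = false := by
    intro i; rw [hmem]; simp
  have hposμ : ∀ i, i ∈ S → 3 / 4 ≤ μ i := by
    intro i hi
    have h1 : 1 / 2 ≤ μ i := by simpa [hS, positiveSet] using hi
    have := hgap i
    rw [abs_of_nonneg (by linarith)] at this
    linarith
  have hnegμ : ∀ i, i ∉ S → μ i ≤ 1 / 4 := by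
    intro i hi
    have h1 : μ i < 1 / 2 := by simpa [hS, positiveSet] using hi
    have := hgap i
    rw [abs_of_neg (by linarith)] at this
    linarith
  obtain ⟨i₁, hi₁⟩ := hpos
  obtain ⟨i₀, hi₀⟩ := hneg
  obtain ⟨u, huS, hu⟩ := Finset.exists_min_image S p ⟨i₁, (hmem i₁).2 hi₁⟩
  obtain ⟨v, hvS, hv⟩ := Finset.exists_max_image Sᶜ p
    ⟨i₀, Finset.mem_compl.2 ((hmem' i₀).2 hi₀)⟩
  have hvS' := Finset.mem_compl.1 hvS
  have hbar : ∀ i, duelGapBar p S u v i = duelGap p S u v i := by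
    intro i
    unfold duelGapBar duelGap
    by_cases hi : i ∈ S
    · rw [dif_pos hi, if_pos hi]
      refine le_antisymm (Finset.sup'_le _ _ fun j hj => ?_) ?_
      · exact (min_le_right _ _).trans (by linarith [hu j hj])
      · refine le_trans ?_ (Finset.le_sup' _ huS)
        refine le_min ?_ le_rfl
        rw [hpd, hpd]
        have := hposμ u huS
        have := hnegμ v hvS'
        have := (hμ i).2
        exact mul_le_mul_of_nonneg_left (by linarith) (by linarith)
    · rw [dif_neg hi, if_neg hi]
      refine le_antisymm (Finset.sup'_le _ _ fun j hj => ?_) ?_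
      · exact (min_le_left _ _).trans (by linarith [hv j hj])
      · refine le_trans ?_ (Finset.le_sup' _ hvS)
        refine le_min le_rfl ?_
        rw [hpd, hpd]
        have := hposμ u huS
        have := hnegμ v hvS'
        have := (hμ i).1
        exact mul_le_mul_of_nonneg_left (by linarith) (by linarith)
  have heq : hc2 p S u v = hc1 p S u v := by
    unfold hc2 hc1
    simp only [hbar]
  have hgaps : ∀ i ∈ Finset.univ \ {u, v}, g / 2 ≤ duelGap p S u v i := by
    intro i hi
    simp only [Finset.mem_sdiff, Finset.mem_univ, true_and, Finset.mem_insert,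
      Finset.mem_singleton, not_or] at hi
    unfold duelGap
    by_cases hiS : i ∈ S
    · rw [if_pos hiS, hpd]
      have hle' := (hle u i).1 (hu i hiS)
      have h1 := htop u (fun j hj => by
        have hjS : j ∈ S := (hmem j).2 (hj.trans ((hmem u).1 huS))
        have h2 := (hle u j).1 (hu j hjS)
        have h3 := hposμ u huS
        rw [abs_of_nonneg (by linarith), abs_of_nonneg (by linarith)]
        linarith) i hi.1 (((hmem i).1 hiS).trans ((hmem u).1 huS).symm)
      rw [abs_of_nonpos (by linarith)] at h1
      nlinarith
    · rw [if_neg hiS, hpd]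
      have hle' := (hle i v).1 (hv i (Finset.mem_compl.2 hiS))
      have h1 := htop v (fun j hj => by
        have hjS : j ∉ S := (hmem' j).2 (hj.trans ((hmem' v).1 hvS'))
        have h2 := (hle j v).1 (hv j (Finset.mem_compl.2 hjS))
        have h3 := hnegμ v hvS'
        rw [abs_of_nonpos (by linarith), abs_of_nonpos (by linarith)]
        linarith) i hi.2 (((hmem' i).1 hiS).trans ((hmem' v).1 hvS').symm)
      rw [abs_of_nonneg (by linarith)] at h1
      nlinarith
  refine ⟨u, v, ⟨huS, hu⟩, ⟨hvS, hv⟩, heq, ?_⟩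
  rw [heq, hc1]
  calc ∑ i ∈ Finset.univ \ {u, v}, (ENNReal.ofReal (duelGap p S u v i) ^ 2)⁻¹
      ≤ ∑ _i ∈ Finset.univ \ {u, v}, ENNReal.ofReal ((2 / g) ^ 2) := by
        refine Finset.sum_le_sum fun i hi => ?_
        have h1 := hgaps i hi
        have h0 : 0 < duelGap p S u v i := by linarith
        rw [← ENNReal.ofReal_pow (by linarith), ← ENNReal.ofReal_inv_of_pos (by positivity)]
        refine ENNReal.ofReal_le_ofReal ?_
        rw [show (2 / g) ^ 2 = ((g / 2) ^ 2)⁻¹ by rw [← inv_pow, inv_div]]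
        gcongr
    _ ≤ ∑ _i : Fin K, ENNReal.ofReal ((2 / g) ^ 2) :=
        Finset.sum_le_sum_of_subset Finset.sdiff_subset
    _ = ENNReal.ofReal (K * (2 / g) ^ 2) := by
        rw [Finset.sum_const, Finset.card_univ, Fintype.card_fin, nsmul_eq_mul,
          ENNReal.ofReal_mul (Nat.cast_nonneg _), ENNReal.ofReal_natCast]

end Complexity

/-! ### Exponential means -/

section ExpMeans

variable {l : ℕ} {x : Fin (2 * l) → ℝ}

lemma isPos_armMeans (hx : ∀ i, x i ≤ 1 / 4) (i : Fin (2 * l)) :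
    isPos (armMeans x) i = decide (l ≤ (i : ℕ)) := by
  have := hx i
  unfold isPos armMeans
  rw [decide_eq_decide]
  split_ifs with h
  · constructor
    · intro h'; linarith
    · intro h'; omega
  · constructor
    · intro _; omega
    · intro _; linarith

lemma abs_armMeans_sub (hx : ∀ i, x i ≤ 1 / 4) (i : Fin (2 * l)) :
    |armMeans x i - 1 / 2| = 1 / 2 - x i := by
  have := hx i
  unfold armMeans
  split_ifs
  · rw [abs_of_neg (by linarith)]; ring
  · rw [abs_of_nonneg (by linarith)]; ring

lemma excess_armMeans (hx : ∀ i, x i ≤ 1 / 4) (i : Fin (2 * l)) :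
    excess (armMeans x) i = (1 / 4 - x i) / 2 := by
  rw [excess, abs_armMeans_sub hx]; ring

lemma abs_armMeans_sub_armMeans {i j : Fin (2 * l)}
    (h : decide (l ≤ (i : ℕ)) = decide (l ≤ (j : ℕ))) :
    |armMeans x i - armMeans x j| = |x i - x j| := by
  rw [decide_eq_decide] at h
  unfold armMeans
  by_cases hi : (i : ℕ) < l
  · rw [if_pos hi, if_pos (by omega)]
  · rw [if_neg hi, if_neg (by omega), abs_sub_comm]
    congr 1; ring

lemma card_class (b : Bool) :
    (Finset.univ.filter fun i : Fin (2 * l) => decide (l ≤ (i : ℕ)) = b).card = l := by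
  have h1 : (Finset.univ.filter fun i : Fin (2 * l) => (i : ℕ) < l).card = l := by
    rw [Fin.card_filter_val_lt]; omega
  cases b with
  | false => simpa using h1
  | true =>
    have h2 := Finset.card_filter_add_card_filter_not (s := (Finset.univ : Finset (Fin (2 * l))))
      fun i => (i : ℕ) < l
    rw [h1, Finset.card_univ, Fintype.card_fin] at h2
    simp only [not_lt] at h2
    simp only [decide_eq_true_eq]
    omega

end ExpMeans


/-! ### Typical samples of the means -/

section TypicalSample

variable {l : ℕ} {δ : ℝ}

/-- The arms of one class. -/
def armClass (l : ℕ) (b : Bool) : Finset (Fin (2 * l)) :=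
  Finset.univ.filter fun i => decide (l ≤ (i : ℕ)) = b

lemma card_armClass (b : Bool) : (armClass l b).card = l := card_class b

lemma mem_armClass {b : Bool} {i : Fin (2 * l)} :
    i ∈ armClass l b ↔ decide (l ≤ (i : ℕ)) = b := by simp [armClass]

lemma expRate_pos (hl : 1 ≤ l) (hδ : 0 < δ) (hδ1 : δ ≤ 1 / 2) : 0 < expRate l δ := by
  have : (1 : ℝ) ≤ l := by exact_mod_cast hl
  refine mul_pos (by norm_num) (Real.log_pos ?_)
  rw [lt_div_iff₀ hδ]
  linarith

lemma exp_neg_expRate (hl : 1 ≤ l) (hδ : 0 < δ) :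
    Real.exp (-(expRate l δ * (1 / 4))) = δ / (4 * l) := by
  have : (1 : ℝ) ≤ l := by exact_mod_cast hl
  rw [expRate, show 4 * Real.log (4 * l / δ) * (1 / 4) = Real.log (4 * l / δ) by ring,
    Real.exp_neg, Real.exp_log (by positivity), inv_div]

/-- All values are in `[0, 1/4]`. -/
def InRange (x : Fin (2 * l) → ℝ) : Prop := ∀ i, 0 ≤ x i ∧ x i ≤ 1 / 4

lemma inRange_prob (hl : 1 ≤ l) (hδ : 0 < δ) (hδ1 : δ ≤ 1 / 2) :
    sampleXLaw l δ {x | ¬ InRange x} ≤ ENNReal.ofReal (δ / 2) := by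
  have hr := expRate_pos hl hδ hδ1
  have hsub : {x : Fin (2 * l) → ℝ | ¬ InRange x} ⊆ {x | ∃ i, 1 / 4 < x i} ∪ {x | ∃ i, x i < 0} := by
    intro x hx
    by_contra hcon
    simp only [Set.mem_union, not_or] at hcon
    refine hx fun i => ⟨not_lt.1 fun h => hcon.2 ⟨i, h⟩, not_lt.1 fun h => hcon.1 ⟨i, h⟩⟩
  refine (measure_mono hsub).trans ((measure_union_le _ _).trans ?_)
  have h2 : sampleXLaw l δ {x | ∃ i, x i < 0} = 0 := expSample_exists_neg hr
  have h1 : sampleXLaw l δ {x | ∃ i, 1 / 4 < x i} ≤ _ := expSample_exists_gt hr (1 / 4)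
  rw [h2, add_zero]
  refine h1.trans (ENNReal.ofReal_le_ofReal ?_)
  have : (1 : ℝ) ≤ l := by exact_mod_cast hl
  rw [exp_neg_expRate hl hδ]
  push_cast
  refine le_of_eq ?_
  field_simp
  norm_num

/-- The bound for the exponential sum that controls the number of arms with small gap. -/
def SumBounded (δ : ℝ) (x : Fin (2 * l) → ℝ) : Prop :=
  InRange x → ∑ i, Real.exp (expRate l δ * x i) < 4 * l * expRate l δ / δ

lemma sumBounded_prob (hl : 1 ≤ l) (hδ : 0 < δ) (hδ1 : δ ≤ 1 / 2) :
    sampleXLaw l δ {x | ¬ SumBounded δ x} ≤ ENNReal.ofReal (δ / 8) := by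
  have hr := expRate_pos hl hδ hδ1
  have hl' : (1 : ℝ) ≤ l := by exact_mod_cast hl
  have hA : 0 < 4 * l * expRate l δ / δ := by positivity
  have hsub : {x : Fin (2 * l) → ℝ | ¬ SumBounded δ x} ⊆ {x | (∀ i, x i ≤ 1 / 4) ∧
      4 * l * expRate l δ / δ ≤ ∑ i, Real.exp (expRate l δ * x i)} := by
    intro x hx
    replace hx : ¬ SumBounded δ x := hx
    unfold SumBounded at hx
    push Not at hx
    exact ⟨fun i => (hx.1 i).2, hx.2⟩
  have h1 : sampleXLaw l δ {x | (∀ i, x i ≤ 1 / 4) ∧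
      4 * l * expRate l δ / δ ≤ ∑ i, Real.exp (expRate l δ * x i)} ≤ _ :=
    expSample_sum_exp hr (1 / 4) hA
  refine (measure_mono hsub).trans (h1.trans (ENNReal.ofReal_le_ofReal (le_of_eq ?_)))
  push_cast
  field_simp
  norm_num

/-- The largest value of each class is isolated. -/
def TopIsolated (g : ℝ) (x : Fin (2 * l) → ℝ) : Prop :=
  InRange x → ∀ b, ∀ u ∈ armClass l b, (∀ j ∈ armClass l b, x j ≤ x u) →
    ∀ j, j ≠ u → g < |x u - x j|

lemma topIsolated_prob (hδ : 0 < δ) (hδ1 : δ ≤ 1 / 2) : ∃ c : ℝ, 0 < c ∧ ∀ l : ℕ, 1 ≤ l →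
    sampleXLaw l δ {x | ¬ TopIsolated (c / expRate l δ) x} ≤ ENNReal.ofReal (δ / 8) := by
  set m := 8 * Real.log (32 / δ) with hm
  have hm1 : 1 ≤ m := by
    have : 1 ≤ Real.log (32 / δ) := by
      rw [Real.le_log_iff_exp_le (by positivity), le_div_iff₀ hδ]
      nlinarith [Real.exp_one_lt_d9]
    linarith
  set c := δ / (3072 * m ^ 2) with hc
  have hc0 : 0 < c := by positivity
  have hc1 : c ≤ 1 := by
    rw [hc, div_le_one (by positivity)]
    nlinarith
  refine ⟨c, hc0, fun l hl => ?_⟩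
  have hr := expRate_pos hl hδ hδ1
  have hl' : (1 : ℝ) ≤ l := by exact_mod_cast hl
  set lam := expRate l δ with hlam
  have hg0 : 0 ≤ c / lam := by positivity
  have hlg : lam * (c / lam) = c := by field_simp
  have hec : Real.exp c ≤ 3 := (Real.exp_le_exp.2 hc1).trans (by linarith [Real.exp_one_lt_d9])
  have hclose : ∀ y : ℝ, (l : ℝ) ^ 2 * Real.exp (-(2 * lam * y)) ≤ 8 * m ^ 2 →
      sampleXLaw l δ {x | ∃ i j, i ≠ j ∧ y < x i ∧ |x i - x j| ≤ c / lam}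
        ≤ ENNReal.ofReal (δ / 16) := by
    intro y hy
    have h1 : sampleXLaw l δ {x | ∃ i j, i ≠ j ∧ y < x i ∧ |x i - x j| ≤ c / lam} ≤ _ :=
      expSample_exists_close hr y hg0
    refine h1.trans (ENNReal.ofReal_le_ofReal ?_)
    rw [hlg]
    push_cast
    calc (2 * (l : ℝ)) ^ 2 * (2 * (c / lam) * lam * Real.exp c * Real.exp (-(2 * lam * y)))
        = 8 * (lam * (c / lam)) * Real.exp c * (l ^ 2 * Real.exp (-(2 * lam * y))) := by ring
      _ ≤ 8 * c * 3 * (8 * m ^ 2) := by rw [hlg]; gcongr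
      _ = δ / 16 := by rw [hc]; field_simp; norm_num
  rcases le_or_gt m l with hml | hml
  · set y := Real.log (l / m) / lam with hy
    have hy0 : 0 ≤ y := div_nonneg (Real.log_nonneg (by rwa [le_div_iff₀ (by linarith), one_mul])) hr.le
    have hly : lam * y = Real.log (l / m) := by rw [hy]; field_simp
    have hey : Real.exp (-(lam * y)) = m / l := by
      rw [hly, Real.exp_neg, Real.exp_log (by positivity), inv_div]
    have hcard : ∀ b, sampleXLaw l δ
        {x | (((armClass l b).filter fun i => y < x i).card : ℝ) ≤ m / 2}
        ≤ ENNReal.ofReal (δ / 32) := by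
      intro b
      have h1 : sampleXLaw l δ _ ≤ _ := expSample_card_le hr hy0 (armClass l b)
      rw [card_armClass, hey, show (l : ℝ) * (m / l) = m by field_simp] at h1
      refine h1.trans (ENNReal.ofReal_le_ofReal (le_of_eq ?_))
      rw [hm, mul_div_cancel_left₀ _ (by norm_num : (8 : ℝ) ≠ 0), Real.exp_neg,
        Real.exp_log (by positivity), inv_div]
    have hsub : {x : Fin (2 * l) → ℝ | ¬ TopIsolated (c / lam) x} ⊆
        ({x | (((armClass l true).filter fun i => y < x i).card : ℝ) ≤ m / 2} ∪
        {x | (((armClass l false).filter fun i => y < x i).card : ℝ) ≤ m / 2}) ∪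
        {x | ∃ i j, i ≠ j ∧ y < x i ∧ |x i - x j| ≤ c / lam} := by
      intro x hx
      by_contra hcon
      simp only [Set.mem_union, not_or] at hcon
      obtain ⟨⟨h1, h2⟩, h3⟩ := hcon
      refine hx fun _ b u hu hmax j hj => ?_
      have h4 : m / 2 < (((armClass l b).filter fun i => y < x i).card : ℝ) := by
        cases b
        · exact not_le.1 h2
        · exact not_le.1 h1
      have h5 : 0 < ((armClass l b).filter fun i => y < x i).card := by
        have : (0 : ℝ) < (((armClass l b).filter fun i => y < x i).card : ℝ) := by linarith
        exact_mod_cast this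
      obtain ⟨i, hi⟩ := Finset.card_pos.1 h5
      rw [Finset.mem_filter] at hi
      by_contra h
      exact h3 ⟨u, j, hj.symm, hi.2.trans_le (hmax i hi.1), not_lt.1 h⟩
    have h6 := hclose y (by
      have : Real.exp (-(2 * lam * y)) = (m / l) ^ 2 := by
        rw [← hey, ← Real.exp_nat_mul]; congr 1; push_cast; ring
      rw [this]
      have : (l : ℝ) ^ 2 * (m / l) ^ 2 = m ^ 2 := by field_simp
      rw [this]
      nlinarith)
    refine (measure_mono hsub).trans ((measure_union_le _ _).trans ((add_le_add
      ((measure_union_le _ _).trans (add_le_add (hcard true) (hcard false))) h6).trans ?_))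
    rw [← ENNReal.ofReal_add (by positivity) (by positivity),
      ← ENNReal.ofReal_add (by positivity) (by positivity)]
    exact ENNReal.ofReal_le_ofReal (by linarith)
  · have hsub : {x : Fin (2 * l) → ℝ | ¬ TopIsolated (c / lam) x} ⊆
        {x | ∃ i j, i ≠ j ∧ -(1 / lam) < x i ∧ |x i - x j| ≤ c / lam} := by
      intro x hx
      by_contra hcon
      refine hx fun hx0 b u hu hmax j hj => ?_
      by_contra h
      have : 0 < 1 / lam := by positivity
      exact hcon ⟨u, j, hj.symm, by linarith [(hx0 u).1], not_lt.1 h⟩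
    refine (measure_mono hsub).trans ((hclose _ ?_).trans (ENNReal.ofReal_le_ofReal (by linarith)))
    have h1 : -(2 * lam * -(1 / lam)) = 1 + 1 := by field_simp; norm_num
    rw [h1, Real.exp_add]
    have h2 := Real.exp_one_lt_d9
    have h3 := Real.exp_pos 1
    have h4 : Real.exp 1 * Real.exp 1 ≤ 8 := by nlinarith
    have h5 : (l : ℝ) ^ 2 ≤ m ^ 2 := by gcongr
    nlinarith [sq_nonneg (l : ℝ)]

/-- Many values of each class are almost maximal. -/
def ManyLarge (P : RSParams) (tw : ℕ) (x : Fin (2 * l) → ℝ) : Prop :=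
  ∀ t ≤ tw, ∀ b, P.δ / 8 * Real.exp (2 / 5 * (expRate l P.δ * P.γ t)) <
    ((armClass l b).filter fun i => 1 / 4 - 2 / 5 * P.γ t < x i).card

/-- The large values are isolated. -/
def LargeIsolated (P : RSParams) (r : ℝ) (tw : ℕ) (x : Fin (2 * l) → ℝ) : Prop :=
  ∀ i j, i ≠ j → 1 / 4 - 16 * P.γ tw < x i → Real.exp (-(200 * r)) < |x i - x j|

variable {P : RSParams} {r : ℝ} {tw : ℕ}

lemma expRate_eq_rateOf (hl : 1 ≤ l) (hδ : 0 < δ) (hr : r ^ 2 = Real.log ((2 * l : ℕ) : ℝ)) :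
    expRate l δ = rateOf δ r := by
  have : (1 : ℝ) ≤ l := by exact_mod_cast hl
  rw [rateOf, hr, expRate, show 4 * (l : ℝ) / δ = ((2 * l : ℕ) : ℝ) * (2 / δ) by push_cast; ring,
    Real.log_mul (by positivity) (by positivity)]
  ring

lemma manyLarge_prob (hl : 1 ≤ l) (hδ : 0 < P.δ) (hδ1 : P.δ ≤ 1 / 2) (hγ : P.γ₀ = 1 / 4)
    (hκ : 1 < P.κ) (hB : ManyArms P.δ P.κ r) (hr : r ^ 2 = Real.log ((2 * l : ℕ) : ℝ))
    (htw : 1 / (P.κ * r) ≤ P.γ tw) (htw' : (tw : ℝ) ≤ roundConst P.κ * r) :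
    sampleXLaw l P.δ {x | ¬ ManyLarge P tw x} ≤ ENNReal.ofReal (P.δ / 16) := by
  have hr4 := hB.four_le
  have hγ0 : 0 < P.γ₀ := by rw [hγ]; norm_num
  have hlam := expRate_pos hl hδ hδ1
  have hl' : (1 : ℝ) ≤ l := by exact_mod_cast hl
  set e := Real.exp (-(P.δ / 32 * Real.exp (8 / 5 * (r / P.κ)))) with he
  have hone : ∀ t ≤ tw, ∀ b, sampleXLaw l P.δ {x |
      (((armClass l b).filter fun i => 1 / 4 - 2 / 5 * P.γ t < x i).card : ℝ) ≤
        P.δ / 8 * Real.exp (2 / 5 * (expRate l P.δ * P.γ t))} ≤ ENNReal.ofReal e := by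
    intro t ht b
    have hγt : P.γ t ≤ 1 / 4 := by
      have := gamma_anti (P := P) hγ0 hκ (Nat.zero_le t)
      simpa [RSParams.γ, hγ] using this
    have h1 : sampleXLaw l P.δ _ ≤ _ := expSample_card_le hlam
      (by linarith : 0 ≤ 1 / 4 - 2 / 5 * P.γ t) (armClass l b)
    have h2 : (l : ℝ) * Real.exp (-(expRate l P.δ * (1 / 4 - 2 / 5 * P.γ t)))
        = P.δ / 4 * Real.exp (2 / 5 * (expRate l P.δ * P.γ t)) := by
      rw [show -(expRate l P.δ * (1 / 4 - 2 / 5 * P.γ t)) = -(expRate l P.δ * (1 / 4)) +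
        2 / 5 * (expRate l P.δ * P.γ t) by ring, Real.exp_add, exp_neg_expRate hl hδ]
      field_simp
    rw [card_armClass, h2, show P.δ / 4 * Real.exp (2 / 5 * (expRate l P.δ * P.γ t)) / 2 =
      P.δ / 8 * Real.exp (2 / 5 * (expRate l P.δ * P.γ t)) by ring] at h1
    refine h1.trans (ENNReal.ofReal_le_ofReal (Real.exp_le_exp.2 ?_))
    rw [expRate_eq_rateOf hl hδ hr]
    have h3 := four_mul_le_rate hδ hδ1 hκ (by linarith : 0 < r)
      (htw.trans (gamma_anti hγ0 hκ ht))
    have h4 : Real.exp (8 / 5 * (r / P.κ)) ≤ Real.exp (2 / 5 * (rateOf P.δ r * P.γ t)) :=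
      Real.exp_le_exp.2 (by linarith)
    have h5 := mul_le_mul_of_nonneg_left h4 hδ.le
    linarith
  have hsub : {x : Fin (2 * l) → ℝ | ¬ ManyLarge P tw x} ⊆ ⋃ t ∈ Finset.range (tw + 1),
      ({x | (((armClass l true).filter fun i => 1 / 4 - 2 / 5 * P.γ t < x i).card : ℝ) ≤
        P.δ / 8 * Real.exp (2 / 5 * (expRate l P.δ * P.γ t))} ∪
      {x | (((armClass l false).filter fun i => 1 / 4 - 2 / 5 * P.γ t < x i).card : ℝ) ≤
        P.δ / 8 * Real.exp (2 / 5 * (expRate l P.δ * P.γ t))}) := by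
    intro x hx
    replace hx : ¬ ManyLarge P tw x := hx
    unfold ManyLarge at hx
    push Not at hx
    obtain ⟨t, ht, b, hb⟩ := hx
    refine Set.mem_biUnion (Finset.mem_range.2 (Nat.lt_succ_of_le ht)) ?_
    cases b
    · exact Or.inr hb
    · exact Or.inl hb
  refine (measure_mono hsub).trans ((measure_biUnion_finset_le _ _).trans ?_)
  refine (Finset.sum_le_sum (g := fun _ => ENNReal.ofReal (2 * e)) fun t ht => ?_).trans ?_
  · have ht' := Nat.lt_succ_iff.1 (Finset.mem_range.1 ht)
    rw [two_mul e, ENNReal.ofReal_add (Real.exp_pos _).le (Real.exp_pos _).le]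
    exact (measure_union_le _ _).trans (add_le_add (hone t ht' true) (hone t ht' false))
  · rw [Finset.sum_const, Finset.card_range, nsmul_eq_mul, ← ENNReal.ofReal_natCast,
      ← ENNReal.ofReal_mul (Nat.cast_nonneg _)]
    refine ENNReal.ofReal_le_ofReal (le_trans ?_ hB.count)
    rw [← he]
    push_cast
    have : 0 < e := Real.exp_pos _
    nlinarith

lemma largeIsolated_prob (hl : 1 ≤ l) (hδ : 0 < P.δ) (hδ1 : P.δ ≤ 1 / 2)
    (hB : ManyArms P.δ P.κ r) (hr : r ^ 2 = Real.log ((2 * l : ℕ) : ℝ))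
    (htw1 : P.γ tw ≤ 1 / r) :
    sampleXLaw l P.δ {x | ¬ LargeIsolated P r tw x} ≤ ENNReal.ofReal (P.δ / 16) := by
  have hlam := expRate_pos hl hδ hδ1
  have hl' : (1 : ℝ) ≤ l := by exact_mod_cast hl
  have hsub : {x : Fin (2 * l) → ℝ | ¬ LargeIsolated P r tw x} ⊆
      {x | ∃ i j, i ≠ j ∧ 1 / 4 - 16 * P.γ tw < x i ∧ |x i - x j| ≤ Real.exp (-(200 * r))} := by
    intro x hx
    replace hx : ¬ LargeIsolated P r tw x := hx
    unfold LargeIsolated at hx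
    push Not at hx
    exact hx
  have h1 : sampleXLaw l P.δ {x | ∃ i j, i ≠ j ∧ 1 / 4 - 16 * P.γ tw < x i ∧
      |x i - x j| ≤ Real.exp (-(200 * r))} ≤ _ :=
    expSample_exists_close hlam (1 / 4 - 16 * P.γ tw) (Real.exp_pos _).le
  refine (measure_mono hsub).trans (h1.trans (ENNReal.ofReal_le_ofReal (le_trans ?_ hB.pairs)))
  rw [← expRate_eq_rateOf hl hδ hr]
  set lam := expRate l P.δ with hlamdef
  set g := Real.exp (-(200 * r)) with hg
  have hg0 : 0 < g := Real.exp_pos _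
  have h2 : Real.exp (-(2 * lam * (1 / 4 - 16 * P.γ tw))) ≤
      (P.δ / (4 * l)) ^ 2 * Real.exp (32 * (lam / r)) := by
    rw [← exp_neg_expRate hl hδ, ← Real.exp_nat_mul, ← Real.exp_add]
    refine Real.exp_le_exp.2 ?_
    have h3 := mul_le_mul_of_nonneg_left htw1 hlam.le
    rw [mul_one_div] at h3
    push_cast
    linarith
  calc ((2 * l : ℕ) : ℝ) ^ 2 * (2 * g * lam * Real.exp (lam * g) *
        Real.exp (-(2 * lam * (1 / 4 - 16 * P.γ tw))))
      ≤ ((2 * l : ℕ) : ℝ) ^ 2 * (2 * g * lam * Real.exp (lam * g) *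
        ((P.δ / (4 * l)) ^ 2 * Real.exp (32 * (lam / r)))) := by gcongr
    _ = P.δ ^ 2 / 4 * (2 * g * lam * Real.exp (lam * g) * Real.exp (32 * (lam / r))) := by
        push_cast
        field_simp
        norm_num

lemma sum_exp_excess_le (hl : 1 ≤ l) (hδ : 0 < δ) {x : Fin (2 * l) → ℝ} (hx : InRange x)
    (hs : SumBounded δ x) :
    ∑ i, Real.exp (-(2 * expRate l δ * excess (armMeans x) i)) ≤ expRate l δ := by
  have hl' : (1 : ℝ) ≤ l := by exact_mod_cast hl
  have h1 : ∀ i, Real.exp (-(2 * expRate l δ * excess (armMeans x) i)) =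
      δ / (4 * l) * Real.exp (expRate l δ * x i) := by
    intro i
    rw [excess_armMeans fun i => (hx i).2, ← exp_neg_expRate hl hδ, ← Real.exp_add]
    congr 1; ring
  simp only [h1]
  rw [← Finset.mul_sum]
  calc δ / (4 * l) * ∑ i, Real.exp (expRate l δ * x i) ≤ δ / (4 * l) * (4 * l * expRate l δ / δ) := by
        gcongr
        exact (hs hx).le
    _ = expRate l δ := by field_simp

lemma typicalInstance (hl : 1 ≤ l) (hδ : 0 < P.δ) (hr : r ^ 2 = Real.log ((2 * l : ℕ) : ℝ))
    {x : Fin (2 * l) → ℝ} (hx : InRange x) (hs : SumBounded P.δ x) (hm : ManyLarge P tw x)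
    (hi : LargeIsolated P r tw x) : TypicalInstance P r tw (armMeans x) := by
  have hx' : ∀ i, x i ≤ 1 / 4 := fun i => (hx i).2
  have hrate := expRate_eq_rateOf hl hδ hr
  refine ⟨?_, fun t ht y => ?_, fun i j hij _ hi' _ => ?_⟩
  · rw [← hrate]
    exact sum_exp_excess_le hl hδ hx hs
  · rw [← hrate]
    refine (hm t ht y).le.trans ?_
    have : ((armClass l y).filter fun i => 1 / 4 - 2 / 5 * P.γ t < x i) ⊆
        Finset.univ.filter fun i => excess (armMeans x) i ≤ P.γ t / 5 ∧
          isPos (armMeans x) i = y := by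
      intro i hi
      rw [Finset.mem_filter, mem_armClass] at hi
      rw [Finset.mem_filter, excess_armMeans hx', isPos_armMeans hx']
      exact ⟨Finset.mem_univ i, by linarith [hi.2], hi.1⟩
    exact_mod_cast Finset.card_le_card this
  · rw [excess_armMeans hx'] at hi' ⊢
    rw [excess_armMeans hx']
    have h1 := hi i j hij (by linarith)
    have h2 : |(1 / 4 - x i) / 2 - (1 / 4 - x j) / 2| = |x i - x j| / 2 := by
      rw [← abs_neg, ← abs_of_pos (by norm_num : (0 : ℝ) < 2), ← abs_div,
        abs_of_pos (by norm_num : (0 : ℝ) < 2)]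
      congr 1; ring
    rw [h2]
    linarith

end TypicalSample


/-! ### Asymptotic inequalities -/

section Asymptotics

lemma eventually_mul_pow_le_exp (A : ℝ) (k : ℕ) {c : ℝ} (hc : 0 < c) :
    ∀ᶠ r : ℝ in Filter.atTop, A * r ^ k ≤ Real.exp (c * r) := by
  have h := (isLittleO_pow_exp_pos_mul_atTop k hc).def (by positivity : 0 < 1 / (|A| + 1))
  filter_upwards [h, Filter.eventually_ge_atTop 0] with r hr hr0
  rw [Real.norm_of_nonneg (by positivity), Real.norm_of_nonneg (Real.exp_pos _).le, one_div,
    ← div_eq_inv_mul, le_div_iff₀ (by positivity)] at hr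
  have : A * r ^ k ≤ (|A| + 1) * r ^ k := by
    gcongr
    linarith [le_abs_self A]
  linarith

set_option maxHeartbeats 1600000 in
lemma eventually_manyArms {δ κ : ℝ} (hδ : 0 < δ) (hδ1 : δ ≤ 1 / 2) (hκ : 1 < κ) :
    ∀ᶠ r : ℝ in Filter.atTop, ManyArms δ κ r := by
  set a := roundConst κ with ha
  have ha1 : 1 ≤ a := one_le_roundConst hκ
  have hd : 0 ≤ Real.log (2 / δ) := Real.log_nonneg (by rw [le_div_iff₀ hδ]; linarith)
  have h8 : 0 ≤ Real.log (8 / δ) := Real.log_nonneg (by rw [le_div_iff₀ hδ]; linarith)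
  have h16 : 0 ≤ Real.log (16 / δ) := Real.log_nonneg (by rw [le_div_iff₀ hδ]; linarith)
  set d := 4 * Real.log (2 / δ) with hd'
  set D := 4 + d with hD
  have hκ0 : 0 < κ := by linarith
  set B := κ ^ 2 * (1 + Real.log (8 / δ) + 800 * a) + 1 with hB
  filter_upwards [Filter.eventually_ge_atTop 4, Filter.eventually_ge_atTop (16 * D + 801),
    Filter.eventually_ge_atTop (10 * Real.log (8 / δ)),
    eventually_mul_pow_le_exp (κ + 1) 1 (by norm_num : (0 : ℝ) < 400),
    eventually_mul_pow_le_exp (128 * (1 + Real.log (16 / δ))) 2 (by norm_num : (0 : ℝ) < 400),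
    eventually_mul_pow_le_exp (3 * (a + 1) * D * (8 / δ)) 3 (by positivity : 0 < 8 / 25 / κ),
    eventually_mul_pow_le_exp 2 0 (by positivity : 0 < 1 / 10 / κ),
    eventually_mul_pow_le_exp ((1 + (a + 1) * 4) * (8 / δ)) 3 (by positivity : 0 < 3 / 2 / κ),
    eventually_mul_pow_le_exp (D * B) 4 one_pos,
    eventually_mul_pow_le_exp (2 * (a + 1) * (16 / δ)) 1 one_pos,
    eventually_mul_pow_le_exp (32 / δ) 1 (by positivity : 0 < 8 / 5 / κ),
    eventually_mul_pow_le_exp D 2 (by norm_num : (0 : ℝ) < 200),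
    eventually_mul_pow_le_exp (8 * δ * D * Real.exp (1 + 32 * d)) 2 (by norm_num : (0 : ℝ) < 72)]
    with r e1 e2 e3 e4 e5 e6 e7 e8 e9 e10 e11 e12 e13
  have hr0 : 0 < r := by linarith
  have hr2 : 1 ≤ r ^ 2 := by nlinarith
  have hrate : rateOf δ r ≤ D * r ^ 2 := by
    unfold rateOf
    rw [← hd', hD]
    have : 0 ≤ d * (r ^ 2 - 1) := mul_nonneg (by positivity) (by linarith)
    linarith
  have hrate0 : 0 ≤ rateOf δ r := by unfold rateOf; positivity
  have har : a * r + 1 ≤ (a + 1) * r := by nlinarith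
  refine ⟨e1, ?_, ?_, ?_, ?_, ?_, ?_, ?_, ?_, ?_⟩
  · rw [pow_one] at e4
    linarith
  · have h1 : r ^ 2 + Real.log (16 / δ) ≤ Real.exp (400 * r) / 128 := by
      rw [le_div_iff₀ (by norm_num)]
      nlinarith [mul_nonneg h16 (by linarith : 0 ≤ r ^ 2 - 1)]
    calc 2 * (Real.exp (r ^ 2) * Real.exp (-(Real.exp (400 * r) / 128)))
        ≤ 2 * (Real.exp (r ^ 2) * Real.exp (-(r ^ 2 + Real.log (16 / δ)))) := by gcongr
      _ = 2 * Real.exp (-Real.log (16 / δ)) := by rw [← Real.exp_add]; congr 2; ring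
      _ = δ / 8 := by
          rw [Real.exp_neg, Real.exp_log (by positivity), inv_div]; ring
  · rw [show 8 / 25 / κ * r = 8 / 25 * (r / κ) by ring] at e6
    rw [Real.exp_neg, ← div_eq_mul_inv, mul_div_assoc', div_le_iff₀ (Real.exp_pos _)]
    calc 3 * (a * r + 1) * rateOf δ r ≤ 3 * ((a + 1) * r) * (D * r ^ 2) := by gcongr
      _ = δ / 8 * (3 * (a + 1) * D * (8 / δ) * r ^ 3) := by field_simp
      _ ≤ δ / 8 * Real.exp (8 / 25 * (r / κ)) := by gcongr
  · rw [show 1 / 10 / κ * r = 1 / 10 * (r / κ) by ring, pow_zero, mul_one] at e7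
    exact e7
  · rw [show 3 / 2 / κ * r = 3 / 2 * (r / κ) by ring] at e8
    have hr3 : 1 ≤ r ^ 3 := one_le_pow₀ (by linarith)
    have h1 : (a * r + 1) * (2 * r ^ 2 + 2) ≤ (a + 1) * r * (4 * r ^ 2) := by
      gcongr; linarith
    calc 1 + (a * r + 1) * (2 * r ^ 2 + 2) ≤ (1 + (a + 1) * 4) * r ^ 3 := by nlinarith
      _ = δ / 8 * ((1 + (a + 1) * 4) * (8 / δ) * r ^ 3) := by field_simp
      _ ≤ δ / 8 * Real.exp (3 / 2 * (r / κ)) := by gcongr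
  · have h1 : rateOf δ r / r ≤ D * r := by
      rw [div_le_iff₀ hr0]; nlinarith
    have h2 : r ^ 2 + Real.log (8 / δ) + 2 * (400 * a * r) ≤
        (1 + Real.log (8 / δ) + 800 * a) * r ^ 2 := by
      have h3 : a * r ≤ a * r ^ 2 := by gcongr; nlinarith
      nlinarith [mul_nonneg h8 (by linarith : 0 ≤ r ^ 2 - 1)]
    have hexp1 : 1 ≤ Real.exp (800 * r) := Real.one_le_exp (by positivity)
    have h4 : κ ^ 2 * Real.exp (800 * r) * (r ^ 2 + Real.log (8 / δ) + 2 * (400 * a * r)) + 1 ≤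
        B * r ^ 2 * Real.exp (800 * r) := by
      have h5 : κ ^ 2 * Real.exp (800 * r) * (r ^ 2 + Real.log (8 / δ) + 2 * (400 * a * r)) ≤
          κ ^ 2 * Real.exp (800 * r) * ((1 + Real.log (8 / δ) + 800 * a) * r ^ 2) := by gcongr
      have h6 : 1 ≤ r ^ 2 * Real.exp (800 * r) := one_le_mul_of_one_le_of_one_le hr2 hexp1
      rw [hB]
      linarith
    calc rateOf δ r * Real.exp (16 * (rateOf δ r / r)) * (κ ^ 2 * Real.exp (800 * r) *
          (r ^ 2 + Real.log (8 / δ) + 2 * (400 * a * r)) + 1)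
        ≤ D * r ^ 2 * Real.exp (16 * (D * r)) * (B * r ^ 2 * Real.exp (800 * r)) := by gcongr
      _ = D * B * r ^ 4 * (Real.exp (16 * (D * r)) * Real.exp (800 * r)) := by ring
      _ ≤ Real.exp (1 * r) * (Real.exp (16 * (D * r)) * Real.exp (800 * r)) := by gcongr
      _ = Real.exp ((16 * D + 801) * r) := by
          rw [← Real.exp_add, ← Real.exp_add]; congr 1; ring
      _ ≤ Real.exp (r ^ 2) := by
          refine Real.exp_le_exp.2 ?_
          rw [sq]
          gcongr
  · nlinarith
  · rw [show 8 / 5 / κ * r = 8 / 5 * (r / κ) by ring, pow_one] at e11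
    rw [one_mul, pow_one] at e10
    have h1 : r ≤ δ / 32 * Real.exp (8 / 5 * (r / κ)) := by
      calc r = δ / 32 * (32 / δ * r) := by field_simp
        _ ≤ _ := by gcongr
    calc 2 * (a * r + 1) * Real.exp (-(δ / 32 * Real.exp (8 / 5 * (r / κ))))
        ≤ 2 * ((a + 1) * r) * Real.exp (-r) := by gcongr
      _ = δ / 16 * (2 * (a + 1) * (16 / δ) * r) * Real.exp (-r) := by field_simp
      _ ≤ δ / 16 * Real.exp r * Real.exp (-r) := by gcongr
      _ = δ / 16 := by rw [mul_assoc, ← Real.exp_add]; simp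
  · have h1 : rateOf δ r / r ≤ 4 * r + d := by
      rw [div_le_iff₀ hr0]
      unfold rateOf
      rw [← hd']
      have : 0 ≤ d * (r - 1) := mul_nonneg (by positivity) (by linarith)
      nlinarith
    have h2 : rateOf δ r * Real.exp (-(200 * r)) ≤ 1 := by
      rw [Real.exp_neg, ← div_eq_mul_inv, div_le_one (Real.exp_pos _)]
      exact hrate.trans e12
    calc δ ^ 2 / 4 * (2 * Real.exp (-(200 * r)) * rateOf δ r *
          Real.exp (rateOf δ r * Real.exp (-(200 * r))) * Real.exp (32 * (rateOf δ r / r)))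
        ≤ δ ^ 2 / 4 * (2 * Real.exp (-(200 * r)) * (D * r ^ 2) *
          Real.exp 1 * Real.exp (32 * (4 * r + d))) := by gcongr
      _ = δ / 16 * (8 * δ * D * Real.exp (1 + 32 * d) * r ^ 2) * Real.exp (-(72 * r)) := by
          have h3 : Real.exp (32 * (4 * r + d)) * Real.exp (-(200 * r)) * Real.exp 1
              = Real.exp (1 + 32 * d) * Real.exp (-(72 * r)) := by
            rw [← Real.exp_add, ← Real.exp_add, ← Real.exp_add]; congr 1; ring
          linear_combination δ ^ 2 / 2 * D * r ^ 2 * h3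
      _ ≤ δ / 16 * Real.exp (72 * r) * Real.exp (-(72 * r)) := by gcongr
      _ = δ / 16 := by rw [mul_assoc, ← Real.exp_add]; simp

end Asymptotics


/-! ### Rank-Search on exponential means -/

section RankSearchExp

/-- Rank-Search on `[0, 1]`-valued means with few or many arms never confuses the classes. -/
lemma class_correct {K : ℕ} [NeZero K] {P : RSParams} {μ : Fin K → ℝ} {lam : ℝ}
    (hγ : P.γ₀ = 1 / 4) (hκ : 1 < P.κ) (hδ : 0 < P.δ) (hδ1 : P.δ ≤ 1 / 2)
    (hμ : ∀ i, μ i ∈ Set.Icc (0 : ℝ) 1) (hgap : ∀ i, 1 / 4 ≤ |μ i - 1 / 2|)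
    (hlam : lam ≤ 4 * Real.log (8 * K / P.δ)) (hlam0 : 0 ≤ lam)
    (hsum : ∑ i, Real.exp (-(2 * lam * excess μ i)) ≤ lam) :
    rewardLaw (meanScore (linearLink μ)) {W | ¬ ∀ t, (idealRun P (isPos μ) W t).active.Nonempty →
      ∀ i k, isPos μ i = true → isPos μ k = false →
        avg W k (rankCount P (isPos μ) W t) - avg W i (rankCount P (isPos μ) W t) ≤ 2 * P.γ t}
      ≤ ENNReal.ofReal (P.δ / 4) := by
  rcases le_total (Real.log (8 * K / P.δ)) (10 * Real.log (8 / P.δ)) with hK | hK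
  · exact class_correct_small hγ hκ hδ hδ1 hμ hgap hK
  · refine (measure_mono ?_).trans (class_correct_large hδ hδ1 hμ hgap hlam hlam0 hsum hK)
    intro W hW hsep
    refine hW fun t ht i k hi hk => ?_
    have hL : 0 < Real.log (8 * K / P.δ) := by
      refine Real.log_pos ?_
      have : (1 : ℝ) ≤ K := by exact_mod_cast NeZero.one_le
      rw [lt_div_iff₀ hδ]
      linarith
    have hsep' : Separated μ W (16 * Real.log (8 * K / P.δ)) := hsep
    rw [avg_sub_avg_eq hi hk]
    have h1 := hsep'.rankCount hγ hL ht i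
    have h2 := hsep'.rankCount hγ hL ht k
    have h3 := gamma_pos (P := P) (by rw [hγ]; norm_num) hκ t
    linarith

lemma armMeans_mem {l : ℕ} {x : Fin (2 * l) → ℝ} (hx : InRange x) (i : Fin (2 * l)) :
    armMeans x i ∈ Set.Icc (0 : ℝ) 1 := by
  have h := hx i
  unfold armMeans
  split_ifs
  · exact ⟨h.1, by linarith [h.2]⟩
  · exact ⟨by linarith [h.2], by linarith [h.1]⟩

lemma le_abs_armMeans_sub {l : ℕ} {x : Fin (2 * l) → ℝ} (hx : InRange x) (i : Fin (2 * l)) :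
    1 / 4 ≤ |armMeans x i - 1 / 2| := by
  rw [abs_armMeans_sub fun i => (hx i).2]
  linarith [(hx i).2]

lemma rankSearch_armMeans {P : RSParams} (hτ : P.τ = 1 / 2) (hR : 1 / 2 ≤ P.R) (hδ : 0 < P.δ)
    (hδ1 : P.δ ≤ 1 / 2) (hγ : P.γ₀ = 1 / 4) (hκ : 1 < P.κ) :
    ∃ C : ℝ, ∀ (l : ℕ) [NeZero l], ∃ X : Set (Fin (2 * l) → ℝ),
      sampleXLaw l P.δ X ≤ ENNReal.ofReal (P.δ / 8) ∧
      ∀ x ∉ X, InRange x → SumBounded P.δ x →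
      ENNReal.ofReal (1 - P.δ) ≤ sampleLaw (linearLink (armMeans x)) (armMeans x)
        {ω | RSReturns P ω (positiveSet (1 / 2) (armMeans x))
          (C * ((2 * l : ℕ) : ℝ) * Real.log ((2 * l : ℕ) : ℝ) ^ 3)
          (C * Real.log ((2 * l : ℕ) : ℝ) ^ 2)} := by
  obtain ⟨r₀, hr₀⟩ := Filter.eventually_atTop.1 (eventually_manyArms hδ hδ1 hκ)
  set K₀ := ⌈Real.exp (r₀ ^ 2)⌉₊ with hK₀
  obtain ⟨C, hC⟩ := rankSearch_few_arms hτ hR hδ hδ1 hγ hκ K₀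
  refine ⟨max C (max (duelsConst P) (pullsConst P)), fun l _ => ?_⟩
  have hl : 1 ≤ l := NeZero.one_le
  have hl' : (1 : ℝ) ≤ l := by exact_mod_cast hl
  have hlam := expRate_pos hl hδ hδ1
  rcases le_total (2 * l) K₀ with hK | hK
  · refine ⟨∅, by simp, fun x _ hx hs => ?_⟩
    refine hC (2 * l) (by omega) hK _ (armMeans_mem hx) (le_abs_armMeans_sub hx) ?_ _
      (le_max_left _ _)
    refine class_correct hγ hκ hδ hδ1 (armMeans_mem hx) (le_abs_armMeans_sub hx) ?_ hlam.le
      (sum_exp_excess_le hl hδ hx hs)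
    unfold expRate
    have : Real.log (4 * l / P.δ) ≤ Real.log (8 * ((2 * l : ℕ) : ℝ) / P.δ) := by
      refine Real.log_le_log (by positivity) ?_
      push_cast
      exact div_le_div_of_nonneg_right (by linarith) hδ.le
    linarith
  · have hKe : Real.exp (r₀ ^ 2) ≤ ((2 * l : ℕ) : ℝ) :=
      (Nat.le_ceil _).trans (by exact_mod_cast hK)
    have hK0 : (0 : ℝ) < ((2 * l : ℕ) : ℝ) := (Real.exp_pos _).trans_le hKe
    have hlog : r₀ ^ 2 ≤ Real.log ((2 * l : ℕ) : ℝ) := (Real.le_log_iff_exp_le hK0).2 hKe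
    set r := √(Real.log ((2 * l : ℕ) : ℝ)) with hrdef
    have hr : r ^ 2 = Real.log ((2 * l : ℕ) : ℝ) := Real.sq_sqrt ((sq_nonneg _).trans hlog)
    have hB : ManyArms P.δ P.κ r := hr₀ r (Real.le_sqrt_of_sq_le hlog)
    have hr4 := hB.four_le
    have hκ0 : 0 < P.κ := by linarith
    obtain ⟨tw, h1, h2, h3⟩ := exists_round hκ (v := r / 4) (by linarith)
    have htw1 : P.γ tw ≤ 1 / r := by
      rw [RSParams.γ, hγ, div_le_div_iff₀ (by positivity) (by linarith)]
      linarith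
    have htw : 1 / (P.κ * r) ≤ P.γ tw := by
      rw [RSParams.γ, hγ, div_le_div_iff₀ (by positivity) (by positivity)]
      linarith
    have htw' : (tw : ℝ) ≤ roundConst P.κ * r := by
      have h4 := Real.log_pos hκ
      have h5 : Real.log (r / 4) / Real.log P.κ ≤ r / Real.log P.κ := by
        gcongr
        have := Real.log_le_sub_one_of_pos (by positivity : 0 < r / 4)
        linarith
      have h6 : roundConst P.κ * r = r + r / Real.log P.κ := by unfold roundConst; ring
      linarith
    refine ⟨{x | ¬ ManyLarge P tw x} ∪ {x | ¬ LargeIsolated P r tw x}, ?_, fun x hX hx hs => ?_⟩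
    · refine (measure_union_le _ _).trans ((add_le_add
        (manyLarge_prob hl hδ hδ1 hγ hκ hB hr htw htw')
        (largeIsolated_prob hl hδ hδ1 hB hr htw1)).trans ?_)
      rw [← ENNReal.ofReal_add (by positivity) (by positivity)]
      exact ENNReal.ofReal_le_ofReal (by linarith)
    · rw [Set.mem_union, not_or] at hX
      exact rankSearch_many_arms hτ hR hδ hδ1 hγ hκ hB hr htw htw1 htw' (armMeans_mem hx)
        (le_abs_armMeans_sub hx) (typicalInstance hl hδ hr hx hs (not_not.1 hX.1)
          (not_not.1 hX.2)) ((le_max_left _ _).trans (le_max_right _ _))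
        ((le_max_right _ _).trans (le_max_right _ _))

/-- The duel complexity of an instance with isolated largest values. -/
lemma duel_complexity_armMeans {l : ℕ} (hl : 1 ≤ l) {δ c : ℝ} (hδ : 0 < δ) (hδ1 : δ ≤ 1 / 2)
    (hc : 0 < c) {x : Fin (2 * l) → ℝ} (hx : InRange x)
    (ht : TopIsolated (c / expRate l δ) x) :
    ∃ u v : Fin (2 * l),
      IsWorstPositive (borda (linearLink (armMeans x))) (positiveSet (1 / 2) (armMeans x)) u ∧
      IsBestNegative (borda (linearLink (armMeans x))) (positiveSet (1 / 2) (armMeans x)) v ∧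
      hc2 (borda (linearLink (armMeans x))) (positiveSet (1 / 2) (armMeans x)) u v =
        hc1 (borda (linearLink (armMeans x))) (positiveSet (1 / 2) (armMeans x)) u v ∧
      hc2 (borda (linearLink (armMeans x))) (positiveSet (1 / 2) (armMeans x)) u v ≤
        ENNReal.ofReal ((8 * (1 + Real.log (2 / δ) / Real.log 2) / c) ^ 2 * ((2 * l : ℕ) : ℝ) *
          Real.log ((2 * l : ℕ) : ℝ) ^ 2) := by
  have hlam := expRate_pos hl hδ hδ1
  have hl' : (1 : ℝ) ≤ l := by exact_mod_cast hl
  have hx' : ∀ i, x i ≤ 1 / 4 := fun i => (hx i).2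
  obtain ⟨u, v, h1, h2, h3, h4⟩ := duel_complexity (by omega : 2 ≤ 2 * l) (armMeans_mem hx)
    (le_abs_armMeans_sub hx)
    ⟨⟨l, by omega⟩, by rw [isPos_armMeans hx']; simp⟩
    ⟨⟨0, by omega⟩, by rw [isPos_armMeans hx']; simp; omega⟩
    (g := c / expRate l δ) (by positivity) (by
      intro u hu j hj hju
      rw [isPos_armMeans hx', isPos_armMeans hx'] at hju
      rw [abs_armMeans_sub_armMeans hju.symm]
      refine (ht hx _ u (mem_armClass.2 rfl) (fun k hk => ?_) j hj).le
      have h5 := hu k (by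
        rw [isPos_armMeans hx', isPos_armMeans hx']
        exact mem_armClass.1 hk)
      rw [abs_armMeans_sub hx', abs_armMeans_sub hx'] at h5
      linarith)
  refine ⟨u, v, h1, h2, h3, h4.trans (ENNReal.ofReal_le_ofReal ?_)⟩
  have hl2 := Real.log_pos (by norm_num : (1 : ℝ) < 2)
  have h2δ : 0 ≤ Real.log (2 / δ) := Real.log_nonneg (by rw [le_div_iff₀ hδ]; linarith)
  have hlogK : Real.log 2 ≤ Real.log ((2 * l : ℕ) : ℝ) :=
    Real.log_le_log (by norm_num) (by push_cast; linarith)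
  have hrate : expRate l δ ≤
      4 * (1 + Real.log (2 / δ) / Real.log 2) * Real.log ((2 * l : ℕ) : ℝ) := by
    have h5 : expRate l δ = 4 * Real.log ((2 * l : ℕ) : ℝ) + 4 * Real.log (2 / δ) := by
      rw [expRate, show 4 * (l : ℝ) / δ = ((2 * l : ℕ) : ℝ) * (2 / δ) by push_cast; ring,
        Real.log_mul (by positivity) (by positivity)]
      ring
    have h6 : Real.log (2 / δ) ≤ Real.log (2 / δ) / Real.log 2 * Real.log ((2 * l : ℕ) : ℝ) := by
      rw [div_mul_eq_mul_div, le_div_iff₀ hl2]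
      gcongr
    rw [h5]
    linarith
  calc ((2 * l : ℕ) : ℝ) * (2 / (c / expRate l δ)) ^ 2
      = ((2 * l : ℕ) : ℝ) * (2 * expRate l δ / c) ^ 2 := by rw [div_div_eq_mul_div]
    _ ≤ ((2 * l : ℕ) : ℝ) * (2 * (4 * (1 + Real.log (2 / δ) / Real.log 2) *
          Real.log ((2 * l : ℕ) : ℝ)) / c) ^ 2 := by gcongr
    _ = _ := by ring

end RankSearchExp

end TBPDC

theorem mainTheorem6 :
    ∃ c₀ : ℝ, 0 < c₀ ∧
    ∀ δ : ℝ, 0 < δ → δ < 1 / 2 →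
    ∃ C₁ c₁ : ℝ, 0 < c₁ ∧
    ∀ R : ℝ, 1 / 2 ≤ R →
    ∃ C₂ : ℝ,
    ∀ κ : ℝ, 1 < κ →
    ∃ C₃ : ℝ,
    ∀ (l : ℕ) [NeZero l],
    ∃ E : Set (Fin (2 * l) → ℝ), MeasurableSet E ∧
      ENNReal.ofReal (1 - δ) ≤ TBPDC.sampleXLaw l δ E ∧
      ∀ x ∈ E, ∀ μ : Fin (2 * l) → ℝ, μ = TBPDC.armMeans x →
        -- all means lie in the unit interval
        (∀ i, μ i ∈ Set.Icc (0 : ℝ) 1) ∧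
        -- the gaps are bounded below by an absolute constant
        (∀ i, c₀ ≤ TBPDC.gap (1 / 2) μ i) ∧
        -- the two duel complexities agree and are of order at most `K log² K`
        (∃ u v : Fin (2 * l),
          TBPDC.IsWorstPositive (TBPDC.borda (TBPDC.linearLink μ))
            (TBPDC.positiveSet (1 / 2) μ) u ∧
          TBPDC.IsBestNegative (TBPDC.borda (TBPDC.linearLink μ))
            (TBPDC.positiveSet (1 / 2) μ) v ∧
          TBPDC.hc2 (TBPDC.borda (TBPDC.linearLink μ)) (TBPDC.positiveSet (1 / 2) μ) u v =
            TBPDC.hc1 (TBPDC.borda (TBPDC.linearLink μ)) (TBPDC.positiveSet (1 / 2) μ) u v ∧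
          TBPDC.hc2 (TBPDC.borda (TBPDC.linearLink μ)) (TBPDC.positiveSet (1 / 2) μ) u v ≤
            ENNReal.ofReal (C₁ * ((2 * l : ℕ) : ℝ) * Real.log ((2 * l : ℕ) : ℝ) ^ 2)) ∧
        -- every correct pull-only algorithm needs at least order `K` pulls
        (∀ A : TBPDC.PullAlgorithm (2 * l), A.IsCorrect (1 / 2) δ →
          ENNReal.ofReal (c₁ * ((2 * l : ℕ) : ℝ)) ≤
            ∫⁻ ω, A.pulls ω.1 ω.2 ∂(A.runLaw μ)) ∧
        -- CLUCB succeeds with order at most `K log K` pulls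
        (ENNReal.ofReal (1 - δ) ≤
          (TBPDC.clucb (2 * l) R (1 / 2) δ).runLaw μ
            {ω | (TBPDC.clucb (2 * l) R (1 / 2) δ).Returns ω.1 ω.2
                (TBPDC.positiveSet (1 / 2) μ) ∧
              (TBPDC.clucb (2 * l) R (1 / 2) δ).pulls ω.1 ω.2 ≤
                ENNReal.ofReal (C₂ * ((2 * l : ℕ) : ℝ) * Real.log ((2 * l : ℕ) : ℝ))}) ∧
        -- Rank-Search succeeds with order at most `K log³ K` duels and `log² K` pulls
        (ENNReal.ofReal (1 - δ) ≤
          TBPDC.sampleLaw (TBPDC.linearLink μ) μ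
            {ω | TBPDC.RSReturns ⟨δ, 1 / 2, R, 1 / 4, κ⟩ ω (TBPDC.positiveSet (1 / 2) μ)
              (C₃ * ((2 * l : ℕ) : ℝ) * Real.log ((2 * l : ℕ) : ℝ) ^ 3)
              (C₃ * Real.log ((2 * l : ℕ) : ℝ) ^ 2)}) := by
  refine ⟨1 / 4, by norm_num, fun δ hδ hδ2 => ?_⟩
  obtain ⟨c, hc, htop⟩ := TBPDC.topIsolated_prob hδ hδ2.le
  refine ⟨(8 * (1 + Real.log (2 / δ) / Real.log 2) / c) ^ 2, 1 - 2 * δ, by linarith,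
    fun R hR => ⟨TBPDC.clucbConst R δ, fun κ hκ => ?_⟩⟩
  obtain ⟨C, hC⟩ := TBPDC.rankSearch_armMeans (P := ⟨δ, 1 / 2, R, 1 / 4, κ⟩) rfl hR hδ hδ2.le rfl hκ
  refine ⟨C, fun l _ => ?_⟩
  have hl : 1 ≤ l := NeZero.one_le
  obtain ⟨X, hX, hXs⟩ := hC l
  have hprob : IsProbabilityMeasure (TBPDC.sampleXLaw l δ) :=
    TBPDC.expSample_isProbabilityMeasure (TBPDC.expRate_pos hl hδ hδ2.le)
  set B := {x : Fin (2 * l) → ℝ | ¬ TBPDC.InRange x} ∪ {x | ¬ TBPDC.SumBounded δ x} ∪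
    {x | ¬ TBPDC.TopIsolated (c / TBPDC.expRate l δ) x} ∪ X with hB
  refine ⟨(toMeasurable (TBPDC.sampleXLaw l δ) B)ᶜ, (measurableSet_toMeasurable _ _).compl,
    TBPDC.ofReal_one_sub_le_of_compl hδ.le subset_rfl ?_, fun x hx μ hμ => ?_⟩
  · rw [measure_toMeasurable]
    refine (measure_union_le _ _).trans ((add_le_add ((measure_union_le _ _).trans (add_le_add
      ((measure_union_le _ _).trans (add_le_add (TBPDC.inRange_prob hl hδ hδ2.le)
        (TBPDC.sumBounded_prob hl hδ hδ2.le))) (htop l hl))) hX).trans ?_)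
    rw [← ENNReal.ofReal_add (by positivity) (by positivity),
      ← ENNReal.ofReal_add (by positivity) (by positivity),
      ← ENNReal.ofReal_add (by positivity) (by positivity)]
    exact ENNReal.ofReal_le_ofReal (by linarith)
  · have hxB : x ∉ B := fun h => hx (subset_toMeasurable _ _ h)
    simp only [hB, Set.mem_union, not_or] at hxB
    obtain ⟨⟨⟨h1, h2⟩, h3⟩, h4⟩ := hxB
    replace h1 : TBPDC.InRange x := not_not.1 h1
    replace h2 : TBPDC.SumBounded δ x := not_not.1 h2
    replace h3 : TBPDC.TopIsolated (c / TBPDC.expRate l δ) x := not_not.1 h3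
    subst hμ
    have hmem := TBPDC.armMeans_mem h1
    have hgap := TBPDC.le_abs_armMeans_sub h1
    refine ⟨hmem, hgap, TBPDC.duel_complexity_armMeans hl hδ hδ2.le hc h1 h3, fun A hA => ?_,
      TBPDC.clucb_spec hR hδ (by linarith) (by omega) hmem hgap, hXs x h4 h1 h2⟩
    refine TBPDC.lintegral_pulls_ge A hδ.le hA hmem fun i hi => ?_
    have := hgap i
    rw [hi] at this
    norm_num at this
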